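/- **Conventions.** All triangulated categories and Picard groupoids are small. A *Picard groupoid* is a symmetric monoidal groupoid $(\mathcal P,+)$ in which $x+(-)$ is an equivalence for every object $x$. Picard groupoids, symmetric monoidal functors and monoidal natural transformations form a 2-category $\mathrm{Pic}$. For a triangulated category $\mathcal T$, $\mathrm{isom}(\mathcal T)$ denotes the category with the same objects and the isomorphisms of $\mathcal T$ as morphisms. *Determinant functors.* A determinant functor $d\colon\mathcal T\to\mathcal P$ is a functor $d\colon\mathrm{isom}(\mathcal T)\to\mathcal P$ together with additivity data: a morphism $d(\Delta)\colon d(z)+d(x)\to d(y)$ in $\mathcal P$ for each distinguished triangle $\Delta\colon x\to y\to z\to\Sigma x$, natural in isomorphisms of distinguished triangles, such that 1. (commutativity) for $\Delta_1\colon x\to x\oplus y\to y\xrightarrow{0}\Sigma x$ and $\Delta_2\colon y\to x\oplus y\to x\xrightarrow{0}\Sigma y$, the map $d(\Delta_2)\colon d(x)+d(y)\to d(x\oplus y)$ is the symmetry $d(x)+d(y)\cong d(y)+d(x)$ followed by $d(\Delta_1)$; 2. (octahedron) for every octahedron on distinguished triangles $\Delta_1\colon x\to y\to z'\to\Sigma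 x$, $\Delta_2\colon x\to z\to y'\to\Sigma x$, $\Delta_3\colon y\to z\to x'\to\Sigma y$, $\Delta_4\colon z'\to y'\to x'\to\Sigma z'$, the map $d(\Delta_2)\circ(d(\Delta_4)+\mathrm{id})\colon (d(x')+d(z'))+d(x)\to d(z)$ equals the associativity isomorphism followed by $d(\Delta_3)\circ(\mathrm{id}+d(\Delta_1))$. A morphism of determinant functors $\theta\colon d\Rightarrow d'$ is a natural transformation with $\theta_y\circ d(\Delta)=d'(\Delta)\circ(\theta_z+\theta_x)$ for all $\Delta$. Determinant functors can be composed with symmetric monoidal functors. A determinant functor $d\colon\mathcal T\to\mathcal V$ into a Picard groupoid $\mathcal V$ is *universal* if for every Picard groupoid $\mathcal P'$ and every determinant functor $D\colon\mathcal T\to\mathcal P'$ there is a pair $(f,\alpha)$ of a symmetric monoidal functor $f\colon\mathcal V\to\mathcal P'$ and a morphism of determinant functors $\alpha\colon f\circ d\Rightarrow D$, such that for every other such pair $(f',\alpha')$ there is a unique monoidal natural transformation $\beta\colon f\Rightarrow f'$ with $\alpha'\circ(\beta * d)=\alpha$. *Multi-determinant functors.* Let $\mathcal T_0,\dots,\mathcal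 T_n$ be triangulated categories ($n\ge 0$). A multi-determinant functor $D\colon\mathcal T_0\times\dots\times\mathcal T_n\to\mathcal P$ is a functor $\mathrm{isom}(\mathcal T_0)\times\dots\times\mathrm{isom}(\mathcal T_n)\to\mathcal P$ with the structure of a determinant functor in each variable (for all fixed values of the other variables) such that (unchanged variables are not displayed) 1. (triangle–function) for distinct $i,j$, the additivity data $D(\Delta_j)\colon D(z_j)+D(x_j)\to D(y_j)$ in the $j$-th variable are natural with respect to isomorphisms in the $i$-th variable; 2. (two triangles) for distinct $i,j$ and distinguished triangles $\Delta_i\colon x_i\to y_i\to z_i\to\Sigma x_i$ in $\mathcal T_i$ and $\Delta_j\colon x_j\to y_j\to z_j\to\Sigma x_j$ in $\mathcal T_j$, the two morphisms $$(D(z_i,z_j)+D(x_i,z_j))+(D(z_i,x_j)+D(x_i,x_j))\to D(y_i,y_j)$$ agree which are given by $D(\Delta_i)+D(\Delta_i)$ followed by $D(\Delta_j)$, respectively by the interchange of the two middle summands, followed by $D(\Delta_j)+D(\Delta_j)$ and then $D(\Delta_i)$. A morphism of multi-determinant functors is a natural transformation compatible with the additivity data in each variable. The resulting category is $\mathrm{Det}(\mathcal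 T_0,\dots,\mathcal T_n;\mathcal P)$. *Multiexact functors.* For Picard groupoids $\mathcal V_0,\dots,\mathcal V_n$, a multiexact functor $F\colon\mathcal V_0\times\dots\times\mathcal V_n\to\mathcal P$ is a functor with the structure of a symmetric monoidal functor in each variable, such that the structure maps $F(v_j)+F(v'_j)\to F(v_j+v'_j)$ in one variable are natural in the other variables and, for distinct $i,j$, the two ways $$(F(v_i,v_j)+F(v'_i,v_j))+(F(v_i,v'_j)+F(v'_i,v'_j))\to F(v_i+v'_i,v_j+v'_j)$$ (first the $i$-th and then the $j$-th variable; or interchange of the middle summands, then the $j$-th and then the $i$-th variable) agree. Morphisms are natural transformations which are monoidal in each variable. The resulting category is $\mathrm{Pic}^\times(\mathcal V_0,\dots,\mathcal V_n;\mathcal P)$. Both $\mathrm{Det}(\mathcal T_0,\dots,\mathcal T_n;\mathcal P)$ and $\mathrm{Pic}^\times(\mathcal V_0,\dots,\mathcal V_n;\mathcal P)$ are 2-functors of the Picard groupoid $\mathcal P$ by composition. **Statement.** Every small triangulated category $\mathcal T$ has a universal determinant functor $\det\colon\mathcal T\to V(\mathcal T)$ into a Picard groupoid. Let $n\ge 0$,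 let $\mathcal T_0,\dots,\mathcal T_n$ be small triangulated categories and let $\det\colon\mathcal T_i\to V(\mathcal T_i)$ be universal determinant functors. Then, for every Picard groupoid $\mathcal P$, $\mathrm{Det}(\mathcal T_0,\dots,\mathcal T_n;\mathcal P)$ and $\mathrm{Pic}^\times(V(\mathcal T_0),\dots,V(\mathcal T_n);\mathcal P)$ are groupoids, and pullback along the universal determinants, $f\mapsto f\circ(\det\times\dots\times\det)$, is an equivalence of groupoids $$\mathrm{Pic}^\times(V(\mathcal T_0),\dots,V(\mathcal T_n);\mathcal P)\;\simeq\;\mathrm{Det}(\mathcal T_0,\dots,\mathcal T_n;\mathcal P).$$ Moreover the 2-functor $\mathcal P\mapsto\mathrm{Det}(\mathcal T_0,\dots,\mathcal T_n;\mathcal P)$ is co-represented by the tuple $(V(\mathcal T_0),\dots,V(\mathcal T_n))$: these pullback functors are the components of a (pseudo)natural transformation of 2-functors on $\mathrm{Pic}$ from $\mathrm{Pic}^\times(V(\mathcal T_0),\dots,V(\mathcal T_n);-)$ to $\mathrm{Det}(\mathcal T_0,\dots,\mathcal T_n;-)$, and every component is an equivalence. -/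

import Mathlib

open CategoryTheory Category MonoidalCategory Functor Limits Pretriangulated Triangulated

noncomputable section

namespace MultiDeterminant

universe v v' v'' u u' u'' w w'

section Slots

variable {ι : Type w} [DecidableEq ι] {C : ι → Type u} [∀ i, Category.{v} (C i)]

/-- The morphism of tuples between `a` with `i`-th entry replaced by `x` and `b` with `i`-th entry
replaced by `y`, given by `f : x ⟶ y` in the `i`-th entry and by `φ` in all other entries. -/
def updHom {a b : ∀ j, C j} (i : ι) (φ : ∀ j, j ≠ i → (a j ⟶ b j)) {x y : C i} (f : x ⟶ y) :
    (Function.update a i x : ∀ j, C j) ⟶ Function.update b i y := fun j =>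
  if h : j = i then by
    subst h
    exact eqToHom (Function.update_self _ _ _) ≫ f ≫ eqToHom (Function.update_self _ _ _).symm
  else eqToHom (Function.update_of_ne h _ _) ≫ φ j h ≫
    eqToHom (Function.update_of_ne h _ _).symm

theorem updHom_self {a b : ∀ j, C j} (i : ι) (φ : ∀ j, j ≠ i → (a j ⟶ b j)) {x y : C i}
    (f : x ⟶ y) : updHom i φ f i =
      eqToHom (Function.update_self _ _ _) ≫ f ≫ eqToHom (Function.update_self _ _ _).symm := by
  simp [updHom]

theorem updHom_of_ne {a b : ∀ j, C j} (i : ι) (φ : ∀ j, j ≠ i → (a j ⟶ b j)) {x y : C i}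
    (f : x ⟶ y) {j : ι} (h : j ≠ i) : updHom i φ f j =
      eqToHom (Function.update_of_ne h _ _) ≫ φ j h ≫
        eqToHom (Function.update_of_ne h _ _).symm := by
  simp [updHom, h]

theorem updHom_id (a : ∀ j, C j) (i : ι) (x : C i) :
    updHom i (fun j _ => 𝟙 (a j)) (𝟙 x) = 𝟙 (Function.update a i x : ∀ j, C j) := by
  funext j
  by_cases h : j = i
  · subst h; rw [updHom_self]; simp
  · rw [updHom_of_ne _ _ _ h]; simp

theorem updHom_comp {a b c : ∀ j, C j} (i : ι) (φ : ∀ j, j ≠ i → (a j ⟶ b j))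
    (ψ : ∀ j, j ≠ i → (b j ⟶ c j)) {x y z : C i} (f : x ⟶ y) (g : y ⟶ z) :
    updHom i φ f ≫ updHom i ψ g = updHom i (fun j h => φ j h ≫ ψ j h) (f ≫ g) := by
  funext j
  by_cases h : j = i
  · subst h; simp [updHom_self]
  · simp [updHom_of_ne _ _ _ h]

/-- The functor that puts a variable object in the `i`-th entry of the tuple `a`
(the old entry `a i` is irrelevant). -/
abbrev slot (a : ∀ j, C j) (i : ι) : C i ⥤ ∀ j, C j where
  obj x := Function.update a i x
  map f := updHom i (fun j _ => 𝟙 (a j)) f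
  map_id x := updHom_id a i x
  map_comp f g := by rw [updHom_comp]; simp

/-- Exchanging the order in which the `i`-th and the `j`-th entry are replaced. -/
def swap {i j : ι} (h : i ≠ j) (a : ∀ k, C k) (x : C i) (y : C j) :
    (Function.update (Function.update a i x) j y : ∀ k, C k) ⟶
      Function.update (Function.update a j y) i x :=
  eqToHom (Function.update_comm h x y a)

variable {P : Type u'} [Category.{v'} P] [MonoidalCategory P]

/-- An operation `F(z) + F(x) ⟶ F(y)` in the `i`-th variable of `F`, for all values of the other
variables. -/
abbrev SlotOp (F : (∀ k, C k) ⥤ P) (i : ι) (z x y : C i) :=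
  ∀ a : ∀ k, C k, F.obj (Function.update a i z) ⊗ F.obj (Function.update a i x) ⟶
    F.obj (Function.update a i y)

/-- The operation `m` in the `i`-th variable is natural in all other variables; in particular
it does not depend on the old `i`-th entry of the tuple. -/
def SlotOp.IsNatural {F : (∀ k, C k) ⥤ P} {i : ι} {z x y : C i} (m : SlotOp F i z x y) : Prop :=
  ∀ (a b : ∀ k, C k) (φ : ∀ k, k ≠ i → (a k ⟶ b k)),
    m a ≫ F.map (updHom i φ (𝟙 y)) =
      (F.map (updHom i φ (𝟙 z)) ⊗ₘ F.map (updHom i φ (𝟙 x))) ≫ m b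

/-- The operations `m` in the `i`-th variable and `m'` in the `j`-th variable commute:
the two ways from
`(F(z,z') + F(x,z')) + (F(z,x') + F(x,x'))` to `F(y,y')` agree, where one of the two starts with the
exchange of the two middle summands. -/
def SlotOp.Interchange [BraidedCategory P] {F : (∀ k, C k) ⥤ P} {i j : ι} (h : i ≠ j)
    {z x y : C i} {z' x' y' : C j} (m : SlotOp F i z x y) (m' : SlotOp F j z' x' y') : Prop :=
  ∀ a : ∀ k, C k,
    (m (Function.update a j z') ⊗ₘ m (Function.update a j x')) ≫
      (F.map (swap h.symm a z' y) ⊗ₘ F.map (swap h.symm a x' y)) ≫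
      m' (Function.update a i y) =
    tensorμ _ _ _ _ ≫
      ((F.map (swap h.symm a z' z) ⊗ₘ F.map (swap h.symm a x' z)) ⊗ₘ
        (F.map (swap h.symm a z' x) ⊗ₘ F.map (swap h.symm a x' x))) ≫
      (m' (Function.update a i z) ⊗ₘ m' (Function.update a i x)) ≫
      (F.map (swap h a z y') ⊗ₘ F.map (swap h a x y')) ≫
      m (Function.update a j y') ≫
      F.map (swap h.symm a y' y)

section post

variable {Q : Type w'} [Category.{v''} Q] [MonoidalCategory Q]
  {F : (∀ k, C k) ⥤ P} (g : P ⥤ Q)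

/-- Applying a monoidal functor to an operation in the `i`-th variable. -/
def SlotOp.post [g.LaxMonoidal] {i : ι} {z x y : C i} (m : SlotOp F i z x y) :
    SlotOp (F ⋙ g) i z x y :=
  fun a => LaxMonoidal.μ g _ _ ≫ g.map (m a)

theorem SlotOp.IsNatural.post [g.LaxMonoidal] {i : ι} {z x y : C i} {m : SlotOp F i z x y}
    (hm : m.IsNatural) : (m.post g).IsNatural := by
  intro a b φ
  simp only [SlotOp.post, Functor.comp_map, assoc, ← g.map_comp, hm a b φ]
  rw [LaxMonoidal.μ_natural_assoc, g.map_comp]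

theorem SlotOp.Interchange.post [BraidedCategory P] [BraidedCategory Q] [g.LaxBraided] {i j : ι}
    {h : i ≠ j} {z x y : C i} {z' x' y' : C j} {m : SlotOp F i z x y} {m' : SlotOp F j z' x' y'}
    (hm : SlotOp.Interchange h m m') : SlotOp.Interchange h (m.post g) (m'.post g) := by
  intro a
  have := congr_arg (fun t => (LaxMonoidal.μ g _ _ ⊗ₘ LaxMonoidal.μ g _ _) ≫
    LaxMonoidal.μ g _ _ ≫ g.map t) (hm a)

  simp only [SlotOp.post, Functor.comp_map]
  simp only [← tensorHom_comp_tensorHom, assoc, LaxMonoidal.μ_natural_assoc, ← g.map_comp]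
  refine this.trans ?_
  rw [g.map_comp (tensorμ _ _ _ _), ← tensorμ_comp_μ_tensorHom_μ_comp_μ_assoc]
  simp only [tensorHom_comp_tensorHom_assoc, LaxMonoidal.μ_natural, g.map_comp]
  simp only [← tensorHom_comp_tensorHom, assoc, LaxMonoidal.μ_natural_assoc]
  simp only [← g.map_comp, assoc]
  rfl

end post

section mapOut

variable {F : (∀ k, C k) ⥤ P}

/-- Composing the target of an operation in the `i`-th variable with a morphism. -/
def SlotOp.mapOut {i : ι} {z x y y' : C i} (m : SlotOp F i z x y) (f : y ⟶ y') :
    SlotOp F i z x y' :=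
  fun a => m a ≫ F.map (updHom i (fun k _ => 𝟙 (a k)) f)

theorem SlotOp.IsNatural.mapOut {i : ι} {z x y y' : C i} {m : SlotOp F i z x y}
    (hm : m.IsNatural) (f : y ⟶ y') : (m.mapOut f).IsNatural := by
  intro a b φ
  simp only [SlotOp.mapOut, assoc, ← F.map_comp, updHom_comp, id_comp, comp_id]
  rw [← reassoc_of% (hm a b φ), ← F.map_comp, updHom_comp]
  simp

theorem updHom_swap {a b : ∀ k, C k} {i j : ι} (h : i ≠ j) (φ : ∀ k, (a k ⟶ b k))
    {x x' : C i} {y y' : C j} (f : x ⟶ x') (g : y ⟶ y') :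
    updHom j (fun k _ => updHom i (fun k _ => φ k) f k) g ≫ swap h b x' y' =
      swap h a x y ≫ updHom i (fun k _ => updHom j (fun k _ => φ k) g k) f := by
  funext k
  rw [Pi.comp_apply, Pi.comp_apply]
  simp only [swap]
  by_cases hi : k = i
  · subst hi
    simp [updHom_self, updHom_of_ne _ _ _ h]
  · by_cases hj : k = j
    · subst hj
      simp [updHom_self, updHom_of_ne _ _ _ hi]
    · simp [updHom_of_ne _ _ _ hi, updHom_of_ne _ _ _ hj]

theorem updHom_eq_of_id {a : ∀ k, C k} (i j : ι) (x : C i) {y y' : C j} (g : y ⟶ y') :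
    updHom j (fun k _ => updHom i (fun k _ => 𝟙 (a k)) (𝟙 x) k) g =
      updHom j (fun k _ => 𝟙 (Function.update a i x k)) g := by
  rw [updHom_id]; rfl

theorem SlotOp.Interchange.mapOut [BraidedCategory P] {i j : ι}
    {h : i ≠ j} {z x y t : C i} {z' x' y' t' : C j} {m : SlotOp F i z x y}
    {m' : SlotOp F j z' x' y'} (nm : m.IsNatural) (nm' : m'.IsNatural)
    (hm : SlotOp.Interchange h m m') (f : y ⟶ t) (f' : y' ⟶ t') :
    SlotOp.Interchange h (m.mapOut f) (m'.mapOut f') := by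
  intro a
  have e1 (u : C j) : F.map (updHom i (fun k _ => 𝟙 (Function.update a j u k)) f) ≫
      F.map (swap h.symm a u t) = F.map (swap h.symm a u y) ≫
        F.map (updHom j (fun k _ => updHom i (fun k _ => 𝟙 (a k)) f k) (𝟙 u)) := by
    rw [← F.map_comp, ← F.map_comp, ← updHom_swap h.symm (fun k => 𝟙 (a k)) (𝟙 u) f,
      updHom_eq_of_id]
  have e2 (u : C i) : F.map (updHom j (fun k _ => 𝟙 (Function.update a i u k)) f') ≫
      F.map (swap h a u t') = F.map (swap h a u y') ≫
        F.map (updHom i (fun k _ => updHom j (fun k _ => 𝟙 (a k)) f' k) (𝟙 u)) := by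
    rw [← F.map_comp, ← F.map_comp, ← updHom_swap h (fun k => 𝟙 (a k)) (𝟙 u) f',
      updHom_eq_of_id]
  have n1 := nm' _ _ (fun k _ => updHom i (fun k _ => 𝟙 (a k)) f k)
  have n2 := nm _ _ (fun k _ => updHom j (fun k _ => 𝟙 (a k)) f' k)
  simp only [SlotOp.mapOut]
  rw [tensorHom_comp_tensorHom_assoc, assoc, assoc, e1, e1]
  simp only [← tensorHom_comp_tensorHom, assoc]
  rw [← reassoc_of% n1, reassoc_of% (hm a), tensorHom_comp_tensorHom_assoc
    (F.map (updHom j _ f')), e2, e2]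
  simp only [← tensorHom_comp_tensorHom, assoc]
  rw [← reassoc_of% n2]
  simp only [← F.map_comp]
  congr 6
  rw [updHom_comp, ← assoc, updHom_comp]
  simp only [comp_id, id_comp]
  exact (updHom_swap h.symm (fun k => 𝟙 (a k)) f' f).symm

end mapOut

section pull

variable {B : ι → Type u''} [∀ i, Category.{v''} (B i)] (d : ∀ k, B k ⥤ C k)
  {F : (∀ k, C k) ⥤ P}

theorem pi_obj_update (a : ∀ k, B k) (i : ι) (x : B i) :
    (Functor.pi d).obj (Function.update a i x) =
      Function.update ((Functor.pi d).obj a) i ((d i).obj x) :=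
  funext fun k => Function.apply_update (fun k => (d k).obj) a i x k

theorem eqToHom_conj {D : Type u'} [Category.{v'} D] {X X' X'' Y Y' Y'' : D} (f : X ⟶ Y)
    (p : X' = X) (q : Y = Y') (r : Y' = Y'') (s : X' = X'') (t : X'' = X) (t' : Y = Y'') :
    (eqToHom p ≫ f ≫ eqToHom q) ≫ eqToHom r = eqToHom s ≫ eqToHom t ≫ f ≫ eqToHom t' := by
  subst p q r s; simp

theorem eqToHom_transpose {D : Type u'} [Category.{v'} D] {X X' Y Y' : D} {f : X ⟶ Y}
    {g : X' ⟶ Y'} (p : X = X') (q : Y = Y') (h : f ≫ eqToHom q = eqToHom p ≫ g) :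
    g ≫ eqToHom q.symm = eqToHom p.symm ≫ f := by
  subst p q; simpa using h.symm

/-- Applying the functors `d` to the morphisms `φ` between the entries different from the `i`-th. -/
def mapOff {a b : ∀ k, B k} (i : ι) (φ : ∀ k, k ≠ i → (a k ⟶ b k)) (k : ι) (h : k ≠ i) :
    (Functor.pi d).obj a k ⟶ (Functor.pi d).obj b k :=
  (d k).map (φ k h)

theorem pi_map_updHom {a b : ∀ k, B k} (i : ι) (φ : ∀ k, k ≠ i → (a k ⟶ b k)) {x y : B i}
    (f : x ⟶ y) :
    (Functor.pi d).map (updHom i φ f) ≫ eqToHom (pi_obj_update d b i y) =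
      eqToHom (pi_obj_update d a i x) ≫
        updHom i (mapOff d i φ) ((d i).map f) := by
  funext k
  rw [Pi.comp_apply, Pi.comp_apply]
  by_cases h : k = i
  · subst h
    rw [updHom_self, Functor.pi_map, updHom_self]
    simp only [Functor.map_comp, eqToHom_map, Functor.eqToHom_proj]
    exact eqToHom_conj ((d k).map f) _ _ _ _ _ _
  · rw [updHom_of_ne _ _ _ h, Functor.pi_map, updHom_of_ne _ _ _ h]
    simp only [Functor.map_comp, eqToHom_map, Functor.eqToHom_proj]
    exact eqToHom_conj ((d k).map (φ k h)) _ _ _ _ _ _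

/-- Putting a variable object in the `i`-th entry commutes with functors applied entrywise. -/
def slotPiIso (a : ∀ k, B k) (i : ι) :
    d i ⋙ slot ((Functor.pi d).obj a) i ≅ slot a i ⋙ Functor.pi d :=
  NatIso.ofComponents (fun x => eqToIso (pi_obj_update d a i x).symm) fun {x y} f => by
    have := pi_map_updHom d i (fun k _ => 𝟙 (a k)) f
    have e : mapOff d i (fun k _ => 𝟙 (a k)) = fun k _ => 𝟙 ((Functor.pi d).obj a k) := by
      funext k h; exact (d k).map_id _
    rw [e] at this
    exact eqToHom_transpose _ _ this

/-- Pulling back an operation in the `i`-th variable along functors applied entrywise. -/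
def SlotOp.pull {i : ι} {z x y : B i}
    (m : SlotOp F i ((d i).obj z) ((d i).obj x) ((d i).obj y)) :
    SlotOp (Functor.pi d ⋙ F) i z x y :=
  fun a => (F.map (eqToHom (pi_obj_update d a i z)) ⊗ₘ
    F.map (eqToHom (pi_obj_update d a i x))) ≫
    m ((Functor.pi d).obj a) ≫ F.map (eqToHom (pi_obj_update d a i y).symm)

theorem SlotOp.IsNatural.pull {i : ι} {z x y : B i}
    {m : SlotOp F i ((d i).obj z) ((d i).obj x) ((d i).obj y)}
    (hm : m.IsNatural) : (m.pull d).IsNatural := by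
  intro a b φ
  have e (x : B i) : F.map ((Functor.pi d).map (updHom i φ (𝟙 x))) ≫
      F.map (eqToHom (pi_obj_update d b i x)) = F.map (eqToHom (pi_obj_update d a i x)) ≫
        F.map (updHom i (mapOff d i φ) (𝟙 ((d i).obj x))) := by
    have := congr_arg F.map (pi_map_updHom d i φ (𝟙 x))
    rwa [F.map_comp, F.map_comp, (d i).map_id] at this
  have e' : F.map (eqToHom (pi_obj_update d a i y).symm) ≫
      F.map ((Functor.pi d).map (updHom i φ (𝟙 y))) =
        F.map (updHom i (mapOff d i φ) (𝟙 ((d i).obj y))) ≫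
          F.map (eqToHom (pi_obj_update d b i y).symm) := by
    have := e y
    rw [eqToHom_map F, eqToHom_map F] at this ⊢
    exact (eqToHom_transpose _ _ this).symm
  simp only [SlotOp.pull, assoc, Functor.comp_map, e']
  rw [tensorHom_comp_tensorHom_assoc, e, e, ← tensorHom_comp_tensorHom_assoc,
    ← reassoc_of% (hm _ _ _)]

theorem SlotOp.congr {i : ι} {z x y : C i} (m : SlotOp F i z x y) {a b : ∀ k, C k} (h : a = b) :
    m a = eqToHom (by rw [h]) ≫ m b ≫ eqToHom (by rw [h]) := by
  subst h; simp

theorem eqToHom_tensor {X X' Y Y' : P} (p : X = X') (q : Y = Y') :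
    eqToHom p ⊗ₘ eqToHom q = eqToHom (by rw [p, q]) := by
  subst p q; simp

theorem eqToHom_tensorμ [BraidedCategory P] {X X' Y Y' Z Z' W W' : P}
    (p : X = X') (q : Y = Y') (r : Z = Z') (s : W = W') :
    tensorμ X Y Z W = eqToHom (by rw [p, q, r, s]) ≫
      tensorμ X' Y' Z' W' ≫ eqToHom (by rw [p, q, r, s]) := by
  subst p q r s; simp

theorem SlotOp.Interchange.pull [BraidedCategory P] {i j : ι}
    {h : i ≠ j} {z x y : B i} {z' x' y' : B j}
    {m : SlotOp F i ((d i).obj z) ((d i).obj x) ((d i).obj y)}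
    {m' : SlotOp F j ((d j).obj z') ((d j).obj x') ((d j).obj y')}
    (hm : SlotOp.Interchange h m m') : SlotOp.Interchange h (m.pull d) (m'.pull d) := by
  intro a
  have H := hm ((Functor.pi d).obj a)
  simp only [swap, eqToHom_map, eqToHom_tensor] at H
  simp only [SlotOp.pull, swap, eqToHom_map, ← tensorHom_comp_tensorHom, assoc, eqToHom_tensor,
    m.congr (pi_obj_update d a j _), m'.congr (pi_obj_update d a i _), eqToHom_trans_assoc]
  have c (u : B i) (t : B j) :
      (Functor.pi d ⋙ F).obj (Function.update (Function.update a j t) i u) =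
        F.obj (Function.update (Function.update ((Functor.pi d).obj a) j ((d j).obj t)) i
          ((d i).obj u)) := by
    rw [Functor.comp_obj, pi_obj_update, pi_obj_update]
  have c' : F.obj (Function.update (Function.update ((Functor.pi d).obj a) i ((d i).obj y)) j
      ((d j).obj y')) = (Functor.pi d ⋙ F).obj (Function.update (Function.update a i y) j y') := by
    rw [Functor.comp_obj, pi_obj_update, pi_obj_update]
  have H' := congr_arg (fun t => ((eqToHom (c z z') ⊗ₘ eqToHom (c x z')) ⊗ₘ
    (eqToHom (c z x') ⊗ₘ eqToHom (c x x'))) ≫ t ≫ eqToHom c') H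
  rw [eqToHom_tensorμ (c z z') (c x z') (c z x') (c x x')]
  simp only [assoc, eqToHom_trans, eqToHom_trans_assoc, eqToHom_tensor] at H' ⊢
  exact H'

end pull

end Slots

section DeterminantFunctors

variable {T : Type u} [Category.{v} T] [Preadditive T] [HasZeroObject T] [HasShift T ℤ]
  [∀ n : ℤ, (shiftFunctor T n).Additive] [Pretriangulated T]

/-- The triangle `x ⟶ x ⊞ y ⟶ y ⟶ Σ x` is distinguished. -/
theorem biprod_inl_snd_distinguished (x y : T) :
    Triangle.mk (biprod.inl : x ⟶ x ⊞ y) (biprod.snd : x ⊞ y ⟶ y) 0 ∈ distTriang T :=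
  binaryBiproductTriangle_distinguished x y

/-- The triangle `y ⟶ x ⊞ y ⟶ x ⟶ Σ y` is distinguished. -/
theorem biprod_inr_fst_distinguished (x y : T) :
    Triangle.mk (biprod.inr : y ⟶ x ⊞ y) (biprod.fst : x ⊞ y ⟶ x) 0 ∈ distTriang T := by
  refine isomorphic_distinguished _ (biprod_inl_snd_distinguished y x) _
    (Triangle.isoMk _ _ (Iso.refl y) (biprod.braiding x y) (Iso.refl x) ?_ ?_ ?_)
  · exact (by ext <;> simp : biprod.inr ≫ (biprod.braiding x y).hom = 𝟙 y ≫ biprod.inl)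
  · exact (by simp : biprod.fst ≫ 𝟙 x = (biprod.braiding x y).hom ≫ biprod.snd)
  · exact (by simp : (0 : x ⟶ y⟦(1 : ℤ)⟧) ≫ (𝟙 y)⟦(1 : ℤ)⟧' = 𝟙 x ≫ 0)

variable {P : Type u'} [Category.{v'} P] [MonoidalCategory P] [BraidedCategory P]

/-- Additivity data on a functor `F` from the category of isomorphisms of a triangulated category
to a symmetric monoidal category (whose product is the "addition"), which turn `F` into a
determinant functor. -/
structure AdditivityData (F : Core T ⥤ P) where
  /-- the morphism `F(z) + F(x) ⟶ F(y)` of a distinguished triangle `x ⟶ y ⟶ z ⟶ Σ x` -/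
  add {x y z : T} (f : x ⟶ y) (g : y ⟶ z) (h : z ⟶ x⟦(1 : ℤ)⟧)
    (hΔ : Triangle.mk f g h ∈ distTriang T) : F.obj ⟨z⟩ ⊗ F.obj ⟨x⟩ ⟶ F.obj ⟨y⟩
  /-- naturality with respect to isomorphisms `(a, b, c)` of distinguished triangles -/
  naturality {x y z x' y' z' : T} (f : x ⟶ y) (g : y ⟶ z) (h : z ⟶ x⟦(1 : ℤ)⟧)
    (f' : x' ⟶ y') (g' : y' ⟶ z') (h' : z' ⟶ x'⟦(1 : ℤ)⟧)
    (hΔ : Triangle.mk f g h ∈ distTriang T) (hΔ' : Triangle.mk f' g' h' ∈ distTriang T)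
    (a : x ≅ x') (b : y ≅ y') (c : z ≅ z') (hab : f ≫ b.hom = a.hom ≫ f')
    (hbc : g ≫ c.hom = b.hom ≫ g') (hca : h ≫ a.hom⟦(1 : ℤ)⟧' = c.hom ≫ h') :
    add f g h hΔ ≫ F.map (CoreHom.mk b : Core.mk y ⟶ Core.mk y') =
      (F.map (CoreHom.mk c : Core.mk z ⟶ Core.mk z') ⊗ₘ
        F.map (CoreHom.mk a : Core.mk x ⟶ Core.mk x')) ≫ add f' g' h' hΔ'
  /-- commutativity axiom, for the triangles `x ⟶ x ⊞ y ⟶ y ⟶ Σ x` and `y ⟶ x ⊞ y ⟶ x ⟶ Σ y` -/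
  commutativity (x y : T) :
    (β_ (F.obj ⟨x⟩) (F.obj ⟨y⟩)).hom ≫
        add (biprod.inl : x ⟶ x ⊞ y) biprod.snd 0 (biprod_inl_snd_distinguished x y) =
      add (biprod.inr : y ⟶ x ⊞ y) biprod.fst 0 (biprod_inr_fst_distinguished x y)
  /-- octahedron axiom, for the triangles `x ⟶ y ⟶ z'`, `x ⟶ z ⟶ y'`, `y ⟶ z ⟶ x'` and
  `z' ⟶ y' ⟶ x'` of an octahedron -/
  octahedron {x y z z' x' y' : T} {f : x ⟶ y} {g : y ⟶ z} {k : x ⟶ z} (comm : f ≫ g = k)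
    {f' : y ⟶ z'} {f'' : z' ⟶ x⟦(1 : ℤ)⟧} (hf : Triangle.mk f f' f'' ∈ distTriang T)
    {g' : z ⟶ x'} {g'' : x' ⟶ y⟦(1 : ℤ)⟧} (hg : Triangle.mk g g' g'' ∈ distTriang T)
    {k' : z ⟶ y'} {k'' : y' ⟶ x⟦(1 : ℤ)⟧} (hk : Triangle.mk k k' k'' ∈ distTriang T)
    (o : Octahedron comm hf hg hk) :
    (add o.m₁ o.m₃ (g'' ≫ f'⟦(1 : ℤ)⟧') o.mem ▷ F.obj ⟨x⟩) ≫ add k k' k'' hk =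
      (α_ (F.obj ⟨x'⟩) (F.obj ⟨z'⟩) (F.obj ⟨x⟩)).hom ≫
        (F.obj ⟨x'⟩ ◁ add f f' f'' hf) ≫ add g g' g'' hg

/-- A natural transformation between determinant functors is a morphism of determinant functors if
it is compatible with the additivity data. -/
def AdditivityData.Compatible {F G : Core T ⥤ P} (s : AdditivityData F) (t : AdditivityData G)
    (θ : F ⟶ G) : Prop :=
  ∀ ⦃x y z : T⦄ (f : x ⟶ y) (g : y ⟶ z) (h : z ⟶ x⟦(1 : ℤ)⟧)
    (hΔ : Triangle.mk f g h ∈ distTriang T),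
    s.add f g h hΔ ≫ θ.app ⟨y⟩ = (θ.app ⟨z⟩ ⊗ₘ θ.app ⟨x⟩) ≫ t.add f g h hΔ

namespace AdditivityData

theorem Compatible.comp {F G H : Core T ⥤ P} {s : AdditivityData F} {t : AdditivityData G}
    {r : AdditivityData H} {α : F ⟶ G} {β : G ⟶ H} (hα : s.Compatible t α)
    (hβ : t.Compatible r β) : s.Compatible r (α ≫ β) := fun _ _ _ f g h hΔ => by
  simp only [NatTrans.comp_app, ← tensorHom_comp_tensorHom, assoc]
  rw [reassoc_of% (hα f g h hΔ), hβ f g h hΔ]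

variable {Q : Type w'} [Category.{v''} Q] [MonoidalCategory Q] [BraidedCategory Q]

/-- Composing a determinant functor with a symmetric monoidal functor `k`: the additivity data are
`k(F(z)) + k(F(x)) ⟶ k(F(z) + F(x)) ⟶ k(F(y))`. -/
def post {F : Core T ⥤ P} (s : AdditivityData F) (p : P ⥤ Q) [p.Braided] :
    AdditivityData (F ⋙ p) where
  add f g h hΔ := LaxMonoidal.μ p _ _ ≫ p.map (s.add f g h hΔ)
  naturality f g h f' g' h' hΔ hΔ' a b c hab hbc hca := by
    simp only [Functor.comp_map, assoc, ← p.map_comp,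
      s.naturality f g h f' g' h' hΔ hΔ' a b c hab hbc hca]
    rw [LaxMonoidal.μ_natural_assoc, p.map_comp]
  commutativity x y := by
    have := LaxBraided.braided (F := p) (F.obj ⟨x⟩) (F.obj ⟨y⟩)
    rw [← s.commutativity x y, p.map_comp, reassoc_of% this]
    rfl
  octahedron {x y z z' x' y'} f g k comm f' f'' hf g' g'' hg k' k'' hk o := by
    have h := congr_arg p.map (s.octahedron comm hf hg hk o)
    simp only [p.map_comp] at h
    simp only [comp_whiskerRight, MonoidalCategory.whiskerLeft_comp, assoc, Functor.comp_obj]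
    rw [LaxMonoidal.μ_natural_left_assoc, h, LaxMonoidal.associativity_assoc,
      LaxMonoidal.μ_natural_right_assoc]

/-- Transport of additivity data along an isomorphism of functors. -/
def ofIso {F G : Core T ⥤ P} (s : AdditivityData F) (e : F ≅ G) : AdditivityData G where
  add f g h hΔ := (e.inv.app _ ⊗ₘ e.inv.app _) ≫ s.add f g h hΔ ≫ e.hom.app _
  naturality f g h f' g' h' hΔ hΔ' a b c hab hbc hca := by
    simp only [assoc, ← e.hom.naturality]
    rw [reassoc_of% (s.naturality f g h f' g' h' hΔ hΔ' a b c hab hbc hca),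
      tensorHom_comp_tensorHom_assoc, tensorHom_comp_tensorHom_assoc, e.inv.naturality,
      e.inv.naturality]
  commutativity x y := by
    rw [← s.commutativity x y]
    simp
  octahedron {x y z z' x' y'} f g k comm f' f'' hf g' g'' hg k' k'' hk o := by
    have h := s.octahedron comm hf hg hk o
    have h' := congr_arg (fun t => ((e.inv.app ⟨x'⟩ ⊗ₘ e.inv.app ⟨z'⟩) ⊗ₘ e.inv.app ⟨x⟩) ≫
      t ≫ e.hom.app ⟨z⟩) h
    simp only [← tensorHom_id, ← id_tensorHom, assoc] at h' ⊢
    rw [tensorHom_comp_tensorHom_assoc, tensorHom_comp_tensorHom_assoc]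
    simp only [assoc, Iso.hom_inv_id_app, comp_id, id_comp]
    have h₁ := associator_naturality (e.inv.app ⟨x'⟩) (e.inv.app ⟨z'⟩) (e.inv.app ⟨x⟩)
    rw [reassoc_of% h₁, tensorHom_comp_tensorHom_assoc, tensorHom_comp_tensorHom_assoc] at h'
    simpa only [comp_id, assoc] using h'

theorem Compatible.ofIso {F G F' G' : Core T ⥤ P} {s : AdditivityData F} {t : AdditivityData G}
    {θ : F ⟶ G} (hθ : s.Compatible t θ) (e : F ≅ F') (e' : G ≅ G') {θ' : F' ⟶ G'}
    (w : e.hom ≫ θ' = θ ≫ e'.hom) : (s.ofIso e).Compatible (t.ofIso e') θ' :=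
  fun x y z f g h hΔ => by
    have w₁ (x : Core T) : e.hom.app x ≫ θ'.app x = θ.app x ≫ e'.hom.app x :=
      congr_arg (fun t => t.app x) w
    have w₂ (x : Core T) : e.inv.app x ≫ θ.app x = θ'.app x ≫ e'.inv.app x := by
      rw [← cancel_mono (e'.hom.app x)]; simp [← w₁]
    simp only [AdditivityData.ofIso, assoc, w₁]
    rw [reassoc_of% (hθ f g h hΔ), tensorHom_comp_tensorHom_assoc, tensorHom_comp_tensorHom_assoc,
      w₂, w₂]

end AdditivityData

variable (T P) in
/-- A determinant functor on `T` with values in `P`. -/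
structure DetFunctor where
  /-- the functor on the category of isomorphisms -/
  functor : Core T ⥤ P
  /-- the additivity data -/
  data : AdditivityData functor

namespace DetFunctor

/-- Morphisms of determinant functors. -/
@[ext]
structure Hom (D E : DetFunctor T P) where
  /-- the natural transformation -/
  natTrans : D.functor ⟶ E.functor
  compatible : D.data.Compatible E.data natTrans

instance : Category (DetFunctor T P) where
  Hom := Hom
  id D := ⟨𝟙 _, fun _ _ _ f g h hΔ => by simp⟩
  comp α β := ⟨α.natTrans ≫ β.natTrans, fun _ _ _ f g h hΔ => by
    simp only [NatTrans.comp_app, ← tensorHom_comp_tensorHom, assoc]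
    rw [reassoc_of% (α.compatible f g h hΔ), β.compatible f g h hΔ]⟩
  id_comp _ := Hom.ext (id_comp _)
  comp_id _ := Hom.ext (comp_id _)
  assoc _ _ _ := Hom.ext (assoc _ _ _)

variable {Q : Type w'} [Category.{v''} Q] [MonoidalCategory Q] [BraidedCategory Q]

/-- The composite of a determinant functor with a symmetric monoidal functor. -/
def post (D : DetFunctor T P) (p : P ⥤ Q) [p.Braided] : DetFunctor T Q :=
  ⟨D.functor ⋙ p, D.data.post p⟩

/-- The whiskering of a determinant functor with a monoidal natural transformation. -/
def whisker (D : DetFunctor T P) {p q : P ⥤ Q} [p.Braided] [q.Braided] (β : p ⟶ q)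
    [NatTrans.IsMonoidal β] : D.post p ⟶ D.post q :=
  ⟨Functor.whiskerLeft D.functor β, fun _ _ _ f g h hΔ => by
    simp only [post, AdditivityData.post, Functor.whiskerLeft_app, assoc, β.naturality,
      NatTrans.IsMonoidal.tensor_assoc]⟩

end DetFunctor

end DeterminantFunctors

section Picard

/-- A (small) Picard groupoid: a groupoid with a symmetric monoidal structure `⊗` (the "addition")
such that `x ⊗ -` is an equivalence for all objects `x`. -/
structure PicardGroupoid where
  /-- the type of objects -/
  carrier : Type u
  [category : Category.{u} carrier]
  [isGroupoid : IsGroupoid carrier]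
  [monoidal : MonoidalCategory carrier]
  [symmetric : SymmetricCategory carrier]
  isEquivalence_tensorLeft : ∀ x : carrier, (tensorLeft x).IsEquivalence

namespace PicardGroupoid

instance : CoeSort PicardGroupoid.{u} (Type u) := ⟨carrier⟩

attribute [instance] category isGroupoid monoidal symmetric

/-- A morphism of Picard groupoids: a symmetric monoidal functor. -/
structure Hom (P Q : PicardGroupoid.{u}) where
  /-- the functor -/
  functor : P ⥤ Q
  [braided : functor.Braided]

attribute [instance] Hom.braided

/-- A 2-morphism between morphisms of Picard groupoids: a monoidal natural transformation. -/
@[ext]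
structure Hom₂ {P Q : PicardGroupoid.{u}} (f g : Hom P Q) where
  /-- the natural transformation -/
  natTrans : f.functor ⟶ g.functor
  [isMonoidal : NatTrans.IsMonoidal natTrans]

attribute [instance] Hom₂.isMonoidal

instance : CategoryStruct PicardGroupoid.{u} where
  Hom := Hom
  id P := ⟨𝟭 P⟩
  comp f g := ⟨f.functor ⋙ g.functor⟩

instance (P Q : PicardGroupoid.{u}) : Category (P ⟶ Q) where
  Hom f g := Hom₂ f g
  id f := ⟨𝟙 f.functor⟩
  comp α β := ⟨α.natTrans ≫ β.natTrans⟩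
  id_comp _ := Hom₂.ext (id_comp _)
  comp_id _ := Hom₂.ext (comp_id _)
  assoc _ _ _ := Hom₂.ext (assoc _ _ _)

@[simp]
theorem comp_functor {P Q R : PicardGroupoid.{u}} (f : P ⟶ Q) (g : Q ⟶ R) :
    (f ≫ g).functor = f.functor ⋙ g.functor := rfl

@[simp]
theorem id_functor (P : PicardGroupoid.{u}) : Hom.functor (𝟙 P) = 𝟭 P := rfl

@[ext]
theorem hom₂_ext {P Q : PicardGroupoid.{u}} {f g : P ⟶ Q} {α β : f ⟶ g}
    (h : ∀ x : P, α.natTrans.app x = β.natTrans.app x) : α = β :=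
  Hom₂.ext (NatTrans.ext (funext h))

@[simp]
theorem comp_natTrans_app {P Q : PicardGroupoid.{u}} {f g h : P ⟶ Q} (α : f ⟶ g) (β : g ⟶ h)
    (x : P) : (α ≫ β).natTrans.app x = α.natTrans.app x ≫ β.natTrans.app x := rfl

@[simp]
theorem id_natTrans_app {P Q : PicardGroupoid.{u}} (f : P ⟶ Q) (x : P) :
    (𝟙 f : f ⟶ f).natTrans.app x = 𝟙 (f.functor.obj x) := rfl

/-- An isomorphism of morphisms of Picard groupoids, from a monoidal natural isomorphism. -/
@[simps]
def isoMk {P Q : PicardGroupoid.{u}} {f g : P ⟶ Q} (e : f.functor ≅ g.functor)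
    [NatTrans.IsMonoidal e.hom] : f ≅ g where
  hom := ⟨e.hom⟩
  inv := ⟨e.inv⟩
  hom_inv_id := by ext x; exact e.hom_inv_id_app x
  inv_hom_id := by ext x; exact e.inv_hom_id_app x

/-- The 2-category of Picard groupoids, symmetric monoidal functors and monoidal natural
transformations. -/
instance : Bicategory PicardGroupoid.{u} where
  homCategory := inferInstance
  whiskerLeft f _ _ η := ⟨Functor.whiskerLeft f.functor η.natTrans⟩
  whiskerRight η h := ⟨Functor.whiskerRight η.natTrans h.functor⟩
  associator f g h := isoMk (Functor.associator f.functor g.functor h.functor)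
  leftUnitor f := isoMk f.functor.leftUnitor
  rightUnitor f := isoMk f.functor.rightUnitor
  whiskerLeft_id := by intros; ext x; simp
  whiskerLeft_comp := by intros; ext x; simp
  id_whiskerLeft := by intros; ext x; simp
  comp_whiskerLeft := by intros; ext x; simp
  id_whiskerRight := by intros; ext x; simp
  comp_whiskerRight := by intros; ext x; simp
  whiskerRight_id := by intros; ext x; simp
  whiskerRight_comp := by intros; ext x; simp
  whisker_assoc := by intros; ext x; simp
  whisker_exchange := by intros; ext x; simp
  pentagon := by intros; ext x; simp
  triangle := by intros; ext x; simp

end PicardGroupoid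

end Picard

section Multi

variable {ι : Type} [DecidableEq ι]

/-- A multi-determinant functor `∏ᵢ Tᵢ ⟶ P` on triangulated categories `T i`, `i : ι`. -/
structure MultiDet (T : ι → Type u) [∀ i, Category.{v} (T i)] [∀ i, Preadditive (T i)]
    [∀ i, HasZeroObject (T i)] [∀ i, HasShift (T i) ℤ]
    [∀ i, ∀ n : ℤ, (shiftFunctor (T i) n).Additive] [∀ i, Pretriangulated (T i)]
    (P : Type u') [Category.{v'} P] [MonoidalCategory P] [BraidedCategory P] where
  /-- the functor of several variables on the categories of isomorphisms -/
  functor : (∀ i, Core (T i)) ⥤ P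
  /-- the functor is a determinant functor in each variable -/
  data (i : ι) (a : ∀ i, Core (T i)) : AdditivityData (slot a i ⋙ functor)
  /-- triangle-function axiom: the additivity data in the `i`-th variable are natural with respect
  to isomorphisms in the other variables (and only depend on the other variables) -/
  triangle_function (i : ι) {x y z : T i} (f : x ⟶ y) (g : y ⟶ z) (h : z ⟶ x⟦(1 : ℤ)⟧)
    (hΔ : Triangle.mk f g h ∈ distTriang (T i)) :
    SlotOp.IsNatural (F := functor) (i := i) (z := ⟨z⟩) (x := ⟨x⟩) (y := ⟨y⟩)
      fun a => (data i a).add f g h hΔ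
  /-- two triangles axiom -/
  two_triangles {i j : ι} (hij : i ≠ j)
    {x y z : T i} (f : x ⟶ y) (g : y ⟶ z) (h : z ⟶ x⟦(1 : ℤ)⟧)
    (hΔ : Triangle.mk f g h ∈ distTriang (T i))
    {x' y' z' : T j} (f' : x' ⟶ y') (g' : y' ⟶ z') (h' : z' ⟶ x'⟦(1 : ℤ)⟧)
    (hΔ' : Triangle.mk f' g' h' ∈ distTriang (T j)) :
    SlotOp.Interchange (F := functor) hij (z := ⟨z⟩) (x := ⟨x⟩) (y := ⟨y⟩)
      (z' := ⟨z'⟩) (x' := ⟨x'⟩) (y' := ⟨y'⟩)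
      (fun a => (data i a).add f g h hΔ) (fun a => (data j a).add f' g' h' hΔ')

/-- The tensorator `F(x) + F(y) ⟶ F(x + y)` in the `i`-th variable of a functor of several
variables which is symmetric monoidal in each variable. -/
def slotμ {V : ι → Type u} [∀ i, Category.{v} (V i)] [∀ i, MonoidalCategory (V i)]
    [∀ i, BraidedCategory (V i)]
    {P : Type u'} [Category.{v'} P] [MonoidalCategory P] [BraidedCategory P]
    {F : (∀ i, V i) ⥤ P} (b : ∀ i a, (slot a i ⋙ F).Braided) (i : ι) (x y : V i) :
    SlotOp F i x y (x ⊗ y) :=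
  fun a => letI := b i a; LaxMonoidal.μ (slot a i ⋙ F) x y

/-- A multiexact functor `∏ᵢ Vᵢ ⟶ P` of Picard groupoids: a functor which is symmetric monoidal in
each variable, naturally in the other variables, such that the monoidal structures in different
variables commute. -/
structure MultiExact (V : ι → Type u) [∀ i, Category.{v} (V i)] [∀ i, MonoidalCategory (V i)]
    [∀ i, BraidedCategory (V i)]
    (P : Type u') [Category.{v'} P] [MonoidalCategory P] [BraidedCategory P] where
  /-- the functor of several variables -/
  functor : (∀ i, V i) ⥤ P
  /-- the functor is symmetric monoidal in each variable -/
  braided (i : ι) (a : ∀ i, V i) : (slot a i ⋙ functor).Braided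
  /-- the monoidal structure in the `i`-th variable is natural in the other variables (and only
  depends on the other variables) -/
  natural (i : ι) (x y : V i) : (slotμ braided i x y).IsNatural
  interchange {i j : ι} (hij : i ≠ j) (x y : V i) (x' y' : V j) :
    SlotOp.Interchange hij (slotμ braided i x y) (slotμ braided j x' y')

namespace MultiDet

variable {T : ι → Type u} [∀ i, Category.{v} (T i)] [∀ i, Preadditive (T i)]
    [∀ i, HasZeroObject (T i)] [∀ i, HasShift (T i) ℤ]
    [∀ i, ∀ n : ℤ, (shiftFunctor (T i) n).Additive] [∀ i, Pretriangulated (T i)]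
    {P : Type u'} [Category.{v'} P] [MonoidalCategory P] [BraidedCategory P]

/-- A morphism of multi-determinant functors: a natural transformation that is compatible with the
additivity data in each variable. -/
@[ext]
structure Hom (D E : MultiDet T P) where
  /-- the natural transformation -/
  natTrans : D.functor ⟶ E.functor
  compatible (i : ι) (a : ∀ i, Core (T i)) :
    (D.data i a).Compatible (E.data i a) (Functor.whiskerLeft (slot a i) natTrans)

/-- The category `Det(T; P)` of multi-determinant functors. -/
instance : Category (MultiDet T P) where
  Hom := Hom
  id D := ⟨𝟙 _, fun i a _ _ _ f g h hΔ => by simp⟩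
  comp α β := ⟨α.natTrans ≫ β.natTrans, fun i a => (α.compatible i a).comp (β.compatible i a)⟩
  id_comp _ := Hom.ext (id_comp _)
  comp_id _ := Hom.ext (comp_id _)
  assoc _ _ _ := Hom.ext (assoc _ _ _)

@[ext]
theorem hom_ext {D E : MultiDet T P} {α β : D ⟶ E}
    (h : ∀ x, α.natTrans.app x = β.natTrans.app x) : α = β :=
  Hom.ext (NatTrans.ext (funext h))

@[simp]
theorem comp_natTrans_app {D E G : MultiDet T P} (α : D ⟶ E) (β : E ⟶ G) (x) :
    (α ≫ β).natTrans.app x = α.natTrans.app x ≫ β.natTrans.app x := rfl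

@[simp]
theorem id_natTrans_app (D : MultiDet T P) (x) :
    (Hom.natTrans (𝟙 D)).app x = 𝟙 (D.functor.obj x) := rfl

variable {Q : Type w'} [Category.{v''} Q] [MonoidalCategory Q] [BraidedCategory Q]

/-- The composite of a multi-determinant functor with a symmetric monoidal functor. -/
def post (D : MultiDet T P) (p : P ⥤ Q) [p.Braided] : MultiDet T Q where
  functor := D.functor ⋙ p
  data i a := (D.data i a).post p
  triangle_function i _ _ _ f g h hΔ := (D.triangle_function i f g h hΔ).post p
  two_triangles hij _ _ _ f g h hΔ _ _ _ f' g' h' hΔ' :=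
    (D.two_triangles hij f g h hΔ f' g' h' hΔ').post p

/-- Composing multi-determinant functors with a symmetric monoidal functor, as a functor
`Det(T; P) ⥤ Det(T; Q)`. -/
def postFunctor (p : P ⥤ Q) [p.Braided] : MultiDet T P ⥤ MultiDet T Q where
  obj D := D.post p
  map α := ⟨Functor.whiskerRight α.natTrans p, fun i a x y z f g h hΔ => by
    simp only [post, AdditivityData.post, Functor.whiskerLeft_app, Functor.whiskerRight_app,
      assoc, ← p.map_comp]
    refine (congr_arg (fun t => LaxMonoidal.μ p _ _ ≫ p.map t) (α.compatible i a f g h hΔ)).trans ?_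
    rw [p.map_comp]
    exact (LaxMonoidal.μ_natural_assoc p _ _ _).symm⟩
  map_id _ := hom_ext fun _ => p.map_id _
  map_comp _ _ := hom_ext fun _ => p.map_comp _ _

/-- The effect of a monoidal natural transformation on composites with multi-determinant
functors. -/
def postNatTrans {p q : P ⥤ Q} [p.Braided] [q.Braided] (β : p ⟶ q) [NatTrans.IsMonoidal β] :
    postFunctor (T := T) p ⟶ postFunctor q where
  app D := ⟨Functor.whiskerLeft D.functor β, fun i a _ _ _ f g h hΔ =>
    (DetFunctor.whisker ⟨slot a i ⋙ D.functor, D.data i a⟩ β).compatible f g h hΔ⟩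
  naturality _ _ _ := hom_ext fun _ => β.naturality _

end MultiDet

namespace MultiExact

variable {V : ι → Type u} [∀ i, Category.{v} (V i)] [∀ i, MonoidalCategory (V i)]
    [∀ i, BraidedCategory (V i)]
    {P : Type u'} [Category.{v'} P] [MonoidalCategory P] [BraidedCategory P]

attribute [instance] MultiExact.braided

/-- A morphism of multiexact functors: a natural transformation which is monoidal in each
variable. -/
@[ext]
structure Hom (F G : MultiExact V P) where
  /-- the natural transformation -/
  natTrans : F.functor ⟶ G.functor
  isMonoidal (i : ι) (a : ∀ i, V i) :
    NatTrans.IsMonoidal (Functor.whiskerLeft (slot a i) natTrans)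

/-- The category `Pic(V; P)` of multiexact functors. -/
instance : Category (MultiExact V P) where
  Hom := Hom
  id F := ⟨𝟙 _, fun i a => by
    rw [Functor.whiskerLeft_id']; infer_instance⟩
  comp α β := ⟨α.natTrans ≫ β.natTrans, fun i a => by
    have := α.isMonoidal i a
    have := β.isMonoidal i a
    rw [Functor.whiskerLeft_comp]; infer_instance⟩
  id_comp _ := Hom.ext (id_comp _)
  comp_id _ := Hom.ext (comp_id _)
  assoc _ _ _ := Hom.ext (assoc _ _ _)

@[ext]
theorem hom_ext {F G : MultiExact V P} {α β : F ⟶ G}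
    (h : ∀ x, α.natTrans.app x = β.natTrans.app x) : α = β :=
  Hom.ext (NatTrans.ext (funext h))

@[simp]
theorem comp_natTrans_app {F G H : MultiExact V P} (α : F ⟶ G) (β : G ⟶ H) (x) :
    (α ≫ β).natTrans.app x = α.natTrans.app x ≫ β.natTrans.app x := rfl

@[simp]
theorem id_natTrans_app (F : MultiExact V P) (x) :
    (Hom.natTrans (𝟙 F)).app x = 𝟙 (F.functor.obj x) := rfl

variable {Q : Type w'} [Category.{v''} Q] [MonoidalCategory Q] [BraidedCategory Q]

/-- The composite of a multiexact functor with a symmetric monoidal functor. -/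
def post (F : MultiExact V P) (p : P ⥤ Q) [p.Braided] : MultiExact V Q where
  functor := F.functor ⋙ p
  braided i a := inferInstanceAs ((slot a i ⋙ F.functor) ⋙ p).Braided
  natural i x y := (F.natural i x y).post p
  interchange hij x y x' y' := (F.interchange hij x y x' y').post p

/-- Composing multiexact functors with a symmetric monoidal functor, as a functor
`Pic(V; P) ⥤ Pic(V; Q)`. -/
def postFunctor (p : P ⥤ Q) [p.Braided] : MultiExact V P ⥤ MultiExact V Q where
  obj F := F.post p
  map α := ⟨Functor.whiskerRight α.natTrans p, fun i a => by
    have := α.isMonoidal i a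
    exact inferInstanceAs
      (NatTrans.IsMonoidal (Functor.whiskerRight (Functor.whiskerLeft (slot a i) α.natTrans) p))⟩
  map_id _ := hom_ext fun _ => p.map_id _
  map_comp _ _ := hom_ext fun _ => p.map_comp _ _

/-- The effect of a monoidal natural transformation on composites with multiexact functors. -/
def postNatTrans {p q : P ⥤ Q} [p.Braided] [q.Braided] (β : p ⟶ q) [NatTrans.IsMonoidal β] :
    postFunctor (V := V) p ⟶ postFunctor q where
  app F := ⟨Functor.whiskerLeft F.functor β, fun i a =>
    inferInstanceAs (NatTrans.IsMonoidal (Functor.whiskerLeft (slot a i ⋙ F.functor) β))⟩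
  naturality _ _ _ := hom_ext fun _ => β.naturality _

end MultiExact

end Multi

section Universal

/-- A determinant functor `d : T ⟶ V` is universal if every determinant functor
`E : T ⟶ P'` is of the form `f ∘ d` up to a morphism `α`, and the pair `(f, α)` is unique up to
a unique 2-morphism. -/
def DetFunctor.IsUniversal {T : Type u} [SmallCategory T] [Preadditive T] [HasZeroObject T]
    [HasShift T ℤ] [∀ n : ℤ, (shiftFunctor T n).Additive] [Pretriangulated T]
    {V : PicardGroupoid.{u}} (d : DetFunctor T V) : Prop :=
  ∀ (P' : PicardGroupoid.{u}) (E : DetFunctor T P'),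
    ∃ (f : V ⟶ P') (α : d.post f.functor ⟶ E),
      ∀ (f' : V ⟶ P') (α' : d.post f'.functor ⟶ E),
        ∃! β : f ⟶ f', d.whisker β.natTrans ≫ α' = α

variable {ι : Type} [DecidableEq ι]
  {T : ι → Type u} [∀ i, Category.{v} (T i)] [∀ i, Preadditive (T i)]
  [∀ i, HasZeroObject (T i)] [∀ i, HasShift (T i) ℤ]
  [∀ i, ∀ n : ℤ, (shiftFunctor (T i) n).Additive] [∀ i, Pretriangulated (T i)]
  {V : ι → Type u'} [∀ i, Category.{v'} (V i)] [∀ i, MonoidalCategory (V i)]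
  [∀ i, BraidedCategory (V i)]
  {P : Type w'} [Category.{v''} P] [MonoidalCategory P] [BraidedCategory P]

/-- The product of the functors underlying a family of determinant functors. -/
abbrev prodFunctor (det : ∀ i, DetFunctor (T i) (V i)) : (∀ i, Core (T i)) ⥤ ∀ i, V i :=
  Functor.pi fun i => (det i).functor

/-- The additivity data of `F ∘ det` in the `i`-th variable: with the other variables fixed,
`F ∘ det` is the composite of the determinant functor `det i` with the symmetric monoidal functor
given by `F` in the `i`-th variable. -/
def pullbackData (det : ∀ i, DetFunctor (T i) (V i)) (F : MultiExact V P) (i : ι)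
    (a : ∀ i, Core (T i)) : AdditivityData (slot a i ⋙ prodFunctor det ⋙ F.functor) :=
  ((det i).data.post (slot ((prodFunctor det).obj a) i ⋙ F.functor)).ofIso
    (isoWhiskerRight (slotPiIso (fun i => (det i).functor) a i) F.functor)

theorem pullbackData_add (det : ∀ i, DetFunctor (T i) (V i)) (F : MultiExact V P) (i : ι)
    {x y z : T i} (f : x ⟶ y) (g : y ⟶ z) (h : z ⟶ x⟦(1 : ℤ)⟧)
    (hΔ : Triangle.mk f g h ∈ distTriang (T i)) :
    (fun a => (pullbackData det F i a).add f g h hΔ) =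
      SlotOp.pull (fun i => (det i).functor) (z := ⟨z⟩) (x := ⟨x⟩) (y := ⟨y⟩)
        ((slotμ F.braided i ((det i).functor.obj ⟨z⟩) ((det i).functor.obj ⟨x⟩)).mapOut
          ((det i).data.add f g h hΔ)) :=
  rfl

/-- The pullback `F ∘ det` of a multiexact functor `F` along a family of determinant functors. -/
def pullbackObj (det : ∀ i, DetFunctor (T i) (V i)) (F : MultiExact V P) : MultiDet T P where
  functor := prodFunctor det ⋙ F.functor
  data i a := pullbackData det F i a
  triangle_function i _ _ _ f g h hΔ := by
    rw [pullbackData_add]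
    exact ((F.natural i _ _).mapOut _).pull _
  two_triangles {i j} hij _ _ _ f g h hΔ _ _ _ f' g' h' hΔ' := by
    rw [pullbackData_add, pullbackData_add]
    exact ((F.interchange hij _ _ _ _).mapOut (F.natural _ _ _) (F.natural _ _ _) _ _).pull _

theorem pullbackData_post_add {Q : Type w} [Category.{v} Q] [MonoidalCategory Q]
    [BraidedCategory Q] (det : ∀ i, DetFunctor (T i) (V i)) (F : MultiExact V P)
    (p : P ⥤ Q) [p.Braided] (i : ι) (a : ∀ i, Core (T i))
    {x y z : T i} (f : x ⟶ y) (g : y ⟶ z) (h : z ⟶ x⟦(1 : ℤ)⟧)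
    (hΔ : Triangle.mk f g h ∈ distTriang (T i)) :
    (pullbackData det (F.post p) i a).add f g h hΔ =
      (AdditivityData.post (pullbackData det F i a) p).add f g h hΔ := by
  have key : ∀ {A A' B B' C D E : P} (α : A ⟶ A') (β : B ⟶ B') (m : A' ⊗ B' ⟶ C) (s : C ⟶ D)
      (t : D ⟶ E), (p.map α ⊗ₘ p.map β) ≫ ((LaxMonoidal.μ p _ _ ≫ p.map m) ≫ p.map s) ≫ p.map t =
        LaxMonoidal.μ p _ _ ≫ p.map ((α ⊗ₘ β) ≫ (m ≫ s) ≫ t) := fun α β m s t => by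
    simp only [p.map_comp, assoc, LaxMonoidal.μ_natural_assoc]
  exact key _ _ _ _ _

/-- Pullback of multiexact functors along a family of determinant functors, as a functor
`Pic(V; P) ⥤ Det(T; P)`, `F ↦ F ∘ det`. -/
def pullbackFunctor (det : ∀ i, DetFunctor (T i) (V i))
    (P : Type w') [Category.{v''} P] [MonoidalCategory P] [BraidedCategory P] :
    MultiExact V P ⥤ MultiDet T P where
  obj F := pullbackObj det F
  map {F G} θ := ⟨Functor.whiskerLeft (prodFunctor det) θ.natTrans, fun i a => by
    have := θ.isMonoidal i ((prodFunctor det).obj a)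
    refine ((det i).whisker (Functor.whiskerLeft (slot ((prodFunctor det).obj a) i)
      θ.natTrans)).compatible.ofIso _ _ ?_
    ext x
    exact θ.natTrans.naturality _⟩
  map_id _ := MultiDet.hom_ext fun _ => rfl
  map_comp _ _ := MultiDet.hom_ext fun _ => rfl

end Universal

section Functoriality

open Bicategory

theorem id_tensor_comp_of_eq {P : Type u'} [Category.{v'} P] [MonoidalCategory P] {X Y Z : P}
    {f f' : X ⊗ Y ⟶ Z} (h : f = f') : f ≫ 𝟙 Z = (𝟙 X ⊗ₘ 𝟙 Y) ≫ f' := by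
  rw [h, comp_id, id_tensorHom_id, id_comp]

namespace MultiDet

variable {ι : Type} [DecidableEq ι]
  {T : ι → Type u} [∀ i, Category.{v} (T i)] [∀ i, Preadditive (T i)]
  [∀ i, HasZeroObject (T i)] [∀ i, HasShift (T i) ℤ]
  [∀ i, ∀ n : ℤ, (shiftFunctor (T i) n).Additive] [∀ i, Pretriangulated (T i)]
  {P : Type u'} [Category.{v'} P] [MonoidalCategory P] [BraidedCategory P]

/-- A natural isomorphism compatible with the additivity data is an isomorphism of
multi-determinant functors. -/
def isoMk {D E : MultiDet T P} (e : D.functor ≅ E.functor)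
    (h : ∀ i a, (D.data i a).Compatible (E.data i a) (Functor.whiskerLeft (slot a i) e.hom)) :
    D ≅ E where
  hom := ⟨e.hom, h⟩
  inv := ⟨e.inv, fun i a x y z f g k hΔ => by
    have w (t) : e.hom.app t ≫ e.inv.app t = 𝟙 _ := e.hom_inv_id_app t
    have w' (t) : e.inv.app t ≫ e.hom.app t = 𝟙 _ := e.inv_hom_id_app t
    have := h i a f g k hΔ
    simp only [Functor.whiskerLeft_app] at this ⊢
    rw [← cancel_mono (e.hom.app _), assoc, assoc]
    erw [this, w', comp_id, tensorHom_comp_tensorHom_assoc, w', w']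
    simp⟩
  hom_inv_id := hom_ext fun x => e.hom_inv_id_app x
  inv_hom_id := hom_ext fun x => e.inv_hom_id_app x

end MultiDet

namespace MultiExact

variable {ι : Type} [DecidableEq ι]
    {V : ι → Type u} [∀ i, Category.{v} (V i)] [∀ i, MonoidalCategory (V i)]
    [∀ i, BraidedCategory (V i)]
    {P : Type u'} [Category.{v'} P] [MonoidalCategory P] [BraidedCategory P]

/-- A natural isomorphism which is monoidal in each variable is an isomorphism of multiexact
functors. -/
def isoMk {F G : MultiExact V P} (e : F.functor ≅ G.functor)
    (h : ∀ i a, NatTrans.IsMonoidal (Functor.whiskerLeft (slot a i) e.hom)) : F ≅ G where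
  hom := ⟨e.hom, h⟩
  inv := ⟨e.inv, fun i a => by
    have : NatTrans.IsMonoidal (isoWhiskerLeft (slot a i) e).hom := h i a
    exact inferInstanceAs (NatTrans.IsMonoidal (isoWhiskerLeft (slot a i) e).inv)⟩
  hom_inv_id := hom_ext fun x => e.hom_inv_id_app x
  inv_hom_id := hom_ext fun x => e.inv_hom_id_app x

end MultiExact

variable {ι : Type} [DecidableEq ι]
  (T : ι → Type u) [∀ i, SmallCategory (T i)] [∀ i, Preadditive (T i)]
  [∀ i, HasZeroObject (T i)] [∀ i, HasShift (T i) ℤ]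
  [∀ i, ∀ n : ℤ, (shiftFunctor (T i) n).Additive] [∀ i, Pretriangulated (T i)]
  (V : ι → PicardGroupoid.{u})

/-- The 2-functor `P ↦ Det(T; P)` from Picard groupoids to categories. -/
def detFunctor : PicardGroupoid.{u} ⥤ᵖ Cat.{u, u} where
  obj P := Cat.of (MultiDet T P)
  map f := (MultiDet.postFunctor f.functor).toCatHom
  map₂ β := (MultiDet.postNatTrans β.natTrans).toCatHom₂
  map₂_id f := by
    ext D
    exact MultiDet.hom_ext fun x => rfl
  map₂_comp β γ := by
    ext D
    exact MultiDet.hom_ext fun x => rfl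
  mapId P := Cat.Hom.isoMk (NatIso.ofComponents
    (fun D => MultiDet.isoMk (E := D) D.functor.rightUnitor (fun i a x y z f g h hΔ => by
      exact id_tensor_comp_of_eq (id_comp ((D.data i a).add f g h hΔ)))) (fun {D E} α => MultiDet.hom_ext fun x => by
      exact (comp_id _).trans (id_comp _).symm))
  mapComp p q := Cat.Hom.isoMk (NatIso.ofComponents
    (fun D => MultiDet.isoMk (Functor.associator D.functor p.functor q.functor).symm
      (fun i a x y z f g h hΔ => by
      refine id_tensor_comp_of_eq ?_
      have : (LaxMonoidal.μ q.functor _ _ ≫ q.functor.map (LaxMonoidal.μ p.functor _ _)) ≫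
          q.functor.map (p.functor.map ((D.data i a).add f g h hΔ)) =
          LaxMonoidal.μ q.functor _ _ ≫ q.functor.map (LaxMonoidal.μ p.functor _ _ ≫
            p.functor.map ((D.data i a).add f g h hΔ)) := by
        rw [q.functor.map_comp, assoc]
      exact this)) (fun {D E} α => MultiDet.hom_ext fun x => by
      exact (comp_id _).trans (id_comp _).symm))
  map₂_whisker_left p _ _ β := by
    ext D
    refine MultiDet.hom_ext fun x => ?_
    exact ((id_comp _).trans (comp_id _)).symm
  map₂_whisker_right β q := by
    ext D
    refine MultiDet.hom_ext fun x => ?_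
    exact ((id_comp _).trans (comp_id _)).symm
  map₂_associator p q r := by
    ext D
    refine MultiDet.hom_ext fun x => ?_
    symm
    change 𝟙 _ ≫ r.functor.map (𝟙 _) ≫ 𝟙 _ ≫ 𝟙 _ ≫ 𝟙 _ = 𝟙 _
    simp
  map₂_left_unitor p := by
    ext D
    refine MultiDet.hom_ext fun x => ?_
    symm
    change 𝟙 _ ≫ p.functor.map (𝟙 _) ≫ 𝟙 _ = 𝟙 _
    simp
  map₂_right_unitor p := by
    ext D
    refine MultiDet.hom_ext fun x => ?_
    symm
    change 𝟙 _ ≫ 𝟙 _ ≫ 𝟙 _ = 𝟙 _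
    simp

/-- The 2-functor `P ↦ Pic(V; P)` from Picard groupoids to categories. -/
def picFunctor : PicardGroupoid.{u} ⥤ᵖ Cat.{u, u} where
  obj P := Cat.of (MultiExact (fun i => V i) P)
  map f := (MultiExact.postFunctor f.functor).toCatHom
  map₂ β := (MultiExact.postNatTrans β.natTrans).toCatHom₂
  map₂_id f := by
    ext D
    exact MultiExact.hom_ext fun x => rfl
  map₂_comp β γ := by
    ext D
    exact MultiExact.hom_ext fun x => rfl
  mapId P := Cat.Hom.isoMk (NatIso.ofComponents
    (fun F => MultiExact.isoMk (G := F) F.functor.rightUnitor (fun i a =>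
      inferInstanceAs (NatTrans.IsMonoidal (slot a i ⋙ F.functor).rightUnitor.hom)))
    (fun {D E} α => MultiExact.hom_ext fun x => by
      exact (comp_id _).trans (id_comp _).symm))
  mapComp p q := Cat.Hom.isoMk (NatIso.ofComponents
    (fun F => MultiExact.isoMk (Functor.associator F.functor p.functor q.functor).symm
      (fun i a => inferInstanceAs (NatTrans.IsMonoidal
        (Functor.associator (slot a i ⋙ F.functor) p.functor q.functor).inv)))
    (fun {D E} α => MultiExact.hom_ext fun x => by
      exact (comp_id _).trans (id_comp _).symm))
  map₂_whisker_left p _ _ β := by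
    ext D
    refine MultiExact.hom_ext fun x => ?_
    exact ((id_comp _).trans (comp_id _)).symm
  map₂_whisker_right β q := by
    ext D
    refine MultiExact.hom_ext fun x => ?_
    exact ((id_comp _).trans (comp_id _)).symm
  map₂_associator p q r := by
    ext D
    refine MultiExact.hom_ext fun x => ?_
    symm
    change 𝟙 _ ≫ r.functor.map (𝟙 _) ≫ 𝟙 _ ≫ 𝟙 _ ≫ 𝟙 _ = 𝟙 _
    simp
  map₂_left_unitor p := by
    ext D
    refine MultiExact.hom_ext fun x => ?_
    symm
    change 𝟙 _ ≫ p.functor.map (𝟙 _) ≫ 𝟙 _ = 𝟙 _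
    simp
  map₂_right_unitor p := by
    ext D
    refine MultiExact.hom_ext fun x => ?_
    symm
    change 𝟙 _ ≫ 𝟙 _ ≫ 𝟙 _ = 𝟙 _
    simp

variable {T V}

/-- Pullback along a family of determinant functors as a transformation of 2-functors
`Pic(V; -) ⟶ Det(T; -)`. -/
def detPullback (det : ∀ i, DetFunctor (T i) (V i)) :
    Pseudofunctor.StrongTrans (picFunctor V) (detFunctor T) where
  app P := (pullbackFunctor det P).toCatHom
  naturality {P Q} p := Cat.Hom.isoMk (C := MultiExact (fun i => V i) P) (D := MultiDet T Q)
    (F := MultiExact.postFunctor p.functor ⋙ pullbackFunctor det Q)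
    (G := pullbackFunctor det P ⋙ MultiDet.postFunctor p.functor)
    (NatIso.ofComponents (fun F => MultiDet.isoMk
      (Functor.associator (prodFunctor det) F.functor p.functor).symm
      (fun i a x y z f g h hΔ =>
        id_tensor_comp_of_eq (pullbackData_post_add det F p.functor i a f g h hΔ))) (fun {D E} α => MultiDet.hom_ext fun x => by
      exact (comp_id _).trans (id_comp _).symm))
  naturality_naturality η := by
    ext D
    refine MultiDet.hom_ext fun x => ?_
    exact (comp_id _).trans (id_comp _).symm
  naturality_id P := by
    ext D
    refine MultiDet.hom_ext fun x => ?_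
    change 𝟙 _ ≫ 𝟙 _ = 𝟙 _ ≫ 𝟙 _ ≫ 𝟙 _
    simp
  naturality_comp p q := by
    ext D
    refine MultiDet.hom_ext fun x => ?_
    change 𝟙 _ ≫ 𝟙 _ = 𝟙 _ ≫ 𝟙 _ ≫ 𝟙 _ ≫ 𝟙 _ ≫ q.functor.map (𝟙 _) ≫ 𝟙 _
    simp

end Functoriality

end MultiDeterminant

end

open CategoryTheory Limits Pretriangulated MultiDeterminant

universe u

open CategoryTheory Category MonoidalCategory Functor Limits Pretriangulated Triangulated

noncomputable section

/-! Existence. The universal Picard groupoid is built from syntax: formal sums and negatives of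
objects of `T`, and formal composites of structural morphisms, isomorphisms of `T` and triangles.
Two formal morphisms are identified when every determinant functor into every Picard groupoid gives
them the same value. Every equation that holds under all determinant functors then holds by
construction, evaluation at `D` is a strictly monoidal extension of `D`, and its comparison with any
other extension is forced by recursion on formal objects.

One variable. For a universal `d` with target `V`, restriction along `d` is bijective on monoidal
transformations (`existsUnique`), and every object of `V` is isomorphic to a value of `d`
(`essSurj`), since the unit, sums and negatives are the values at zero objects, direct sums and
shifts. Hence `V` is equivalent to the category `DetValues`, with the objects of `T` and the
morphisms of `V`. A morphism d(x) ⟶ d(y) acts on every determinant functor E as a morphism E(x) ⟶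
E(y), through an extension of E to `V` (`act`). This action does not depend on the extension, is
natural in E and respects pointwise sums.

Several variables. A multi-determinant functor is acted on in each variable. By the two triangles
axiom, a triangle in one variable gives a morphism of determinant functors in another variable, with
a pointwise sum as source. Naturality and additivity of the action therefore make the action in the
j-th variable a morphism of determinant functors in the i-th one (`slotActHom`), and naturality of
the i-th action with respect to it says that the two actions commute. So the actions assemble to a
functor on the product of the categories of values (`MultiDet.ext`), which is carried to the product
of the `V i`. Its tensorators come from the extensions in one variable; their naturality and
interchange say that certain transformations are monoidal, which can be tested on triangles
(`isMonoidal`), where they are axioms of a multi-determinant functor. This proves essential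
surjectivity of pullback. It is faithful by `essSurj`, and full because `existsUnique`, applied one
variable at a time, extends naturality from isomorphisms of the `T i` to all morphisms between
values. -/

namespace MultiDeterminant

universe v v' v'' u' u'' w w'

/-! ### Inverse objects and cancellation in a Picard groupoid -/

section Negatives

variable {P : PicardGroupoid.{u}}

instance (x : P) : (tensorLeft x).IsEquivalence := P.isEquivalence_tensorLeft x

/-- A chosen inverse of an object of a Picard groupoid. -/
def neg (x : P) : P := (tensorLeft x).objPreimage (𝟙_ P)

/-- The isomorphism `x + (-x) ≅ 0`. -/
def negIso (x : P) : x ⊗ neg x ≅ 𝟙_ P := (tensorLeft x).objObjPreimageIso (𝟙_ P)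

theorem whiskerLeft_injective (x : P) {y z : P} {f g : y ⟶ z} (h : x ◁ f = x ◁ g) : f = g :=
  (tensorLeft x).map_injective h

/-- The morphism `y ⟶ z` which becomes a given morphism after adding `x`. -/
def cancelLeft (x : P) {y z : P} (f : x ⊗ y ⟶ x ⊗ z) : y ⟶ z := (tensorLeft x).preimage f

@[simp]
theorem whiskerLeft_cancelLeft (x : P) {y z : P} (f : x ⊗ y ⟶ x ⊗ z) :
    x ◁ cancelLeft x f = f := (tensorLeft x).map_preimage f

/-- The inverse of a morphism of a Picard groupoid. -/
def pinv {x y : P} (f : x ⟶ y) : y ⟶ x := CategoryTheory.inv f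

@[simp]
theorem comp_pinv {x y : P} (f : x ⟶ y) : f ≫ pinv f = 𝟙 x := IsIso.hom_inv_id f

@[simp]
theorem comp_pinv_assoc {x y z : P} (f : x ⟶ y) (g : x ⟶ z) : f ≫ pinv f ≫ g = g :=
  IsIso.hom_inv_id_assoc f g

@[simp]
theorem pinv_comp {x y : P} (f : x ⟶ y) : pinv f ≫ f = 𝟙 y := IsIso.inv_hom_id f

@[simp]
theorem pinv_comp_assoc {x y z : P} (f : x ⟶ y) (g : y ⟶ z) : pinv f ≫ f ≫ g = g :=
  IsIso.inv_hom_id_assoc f g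

end Negatives

/-- Formal objects of the universal Picard groupoid of a triangulated category. -/
inductive FreeObj (T : Type u) : Type u
  | of (x : T) : FreeObj T
  | zero : FreeObj T
  | add (a b : FreeObj T) : FreeObj T
  | neg (a : FreeObj T) : FreeObj T

/-! ### The syntactic model of the universal Picard groupoid -/

section Model

variable (T : Type u) [SmallCategory T] [Preadditive T] [HasZeroObject T] [HasShift T ℤ]
  [∀ n : ℤ, (shiftFunctor T n).Additive] [Pretriangulated T]

/-- Formal morphisms of the universal Picard groupoid of a triangulated category. -/
inductive PreHom : FreeObj T → FreeObj T → Type u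
  | id (a : FreeObj T) : PreHom a a
  | comp {a b c : FreeObj T} (f : PreHom a b) (g : PreHom b c) : PreHom a c
  -- Formal inverses of everything make a groupoid, so each structural isomorphism below is needed
  -- in one direction only.
  | inv {a b : FreeObj T} (f : PreHom a b) : PreHom b a
  | tensor {a b c d : FreeObj T} (f : PreHom a b) (g : PreHom c d) :
      PreHom (a.add c) (b.add d)
  | assoc (a b c : FreeObj T) : PreHom ((a.add b).add c) (a.add (b.add c))
  | lunit (a : FreeObj T) : PreHom (FreeObj.zero.add a) a
  | runit (a : FreeObj T) : PreHom (a.add FreeObj.zero) a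
  | braid (a b : FreeObj T) : PreHom (a.add b) (b.add a)
  | cancel (a : FreeObj T) : PreHom (a.add a.neg) FreeObj.zero
  | iso {x y : T} (e : x ≅ y) : PreHom (.of x) (.of y)
  | triangle {x y z : T} (f : x ⟶ y) (g : y ⟶ z) (h : z ⟶ x⟦(1 : ℤ)⟧)
      (hΔ : Triangle.mk f g h ∈ distTriang T) : PreHom ((FreeObj.of z).add (.of x)) (.of y)

variable {T} {P : PicardGroupoid.{u}} (D : DetFunctor T P)

/-- The value of a formal object under a determinant functor. -/
def evalObj : FreeObj T → P
  | .of x => D.functor.obj ⟨x⟩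
  | .zero => 𝟙_ P
  | .add a b => evalObj a ⊗ evalObj b
  | .neg a => neg (evalObj a)

/-- The value of a formal morphism under a determinant functor. -/
def evalHom : {a b : FreeObj T} → PreHom T a b → (evalObj D a ⟶ evalObj D b)
  | _, _, .id a => 𝟙 _
  | _, _, .comp f g => evalHom f ≫ evalHom g
  | _, _, .inv f => CategoryTheory.inv (evalHom f)
  | _, _, .tensor f g => evalHom f ⊗ₘ evalHom g
  | _, _, .assoc a b c => (α_ (evalObj D a) (evalObj D b) (evalObj D c)).hom
  | _, _, .lunit a => (λ_ (evalObj D a)).hom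
  | _, _, .runit a => (ρ_ (evalObj D a)).hom
  | _, _, .braid a b => (β_ (evalObj D a) (evalObj D b)).hom
  | _, _, .cancel a => (negIso (evalObj D a)).hom
  | _, _, .iso e => D.functor.map (CoreHom.mk e : Core.mk _ ⟶ Core.mk _)
  | _, _, .triangle f g h hΔ => D.data.add f g h hΔ

/-- Two formal morphisms are identified if their values under all determinant functors agree. -/
instance preHomSetoid (a b : FreeObj T) : Setoid (PreHom T a b) where
  -- This replaces an explicit list of relations. The quantification over all `P` happens in `Prop`,
  -- so the quotient stays in universe `u`.
  r f g := ∀ (P : PicardGroupoid.{u}) (D : DetFunctor T P), evalHom D f = evalHom D g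
  iseqv := ⟨fun _ _ _ => rfl, fun h P D => (h P D).symm, fun h h' P D => (h P D).trans (h' P D)⟩

/-- Morphisms of the universal Picard groupoid. -/
def FreeHom (a b : FreeObj T) : Type u := Quotient (preHomSetoid a b)

namespace FreeHom

/-- The morphism represented by a formal morphism. -/
def mk {a b : FreeObj T} (f : PreHom T a b) : FreeHom a b := Quotient.mk _ f

/-- The value of a morphism under a determinant functor. -/
def eval {a b : FreeObj T} (f : FreeHom a b) : evalObj D a ⟶ evalObj D b :=
  Quotient.lift (evalHom D) (fun _ _ (h : ∀ _ _, _) => h _ D) f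

@[simp]
theorem eval_mk {a b : FreeObj T} (f : PreHom T a b) : (mk f).eval D = evalHom D f := rfl

/-- The evaluations are jointly faithful by the choice of the relation. All axioms of the model are
proved by evaluating and quoting the same axiom in the target. -/
theorem eval_ext {a b : FreeObj T} {f g : FreeHom a b}
    (h : ∀ (P : PicardGroupoid.{u}) (D : DetFunctor T P), f.eval D = g.eval D) : f = g := by
  induction f using Quotient.ind
  induction g using Quotient.ind
  exact Quotient.sound h

theorem mk_surjective {a b : FreeObj T} : Function.Surjective (mk : PreHom T a b → FreeHom a b) :=
  Quotient.exists_rep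

/-- Composition of morphisms. -/
def comp {a b c : FreeObj T} (f : FreeHom a b) (g : FreeHom b c) : FreeHom a c :=
  Quotient.map₂ PreHom.comp (fun _ _ (h : ∀ P D, _) _ _ (h' : ∀ P D, _) P D => by
    simp only [evalHom]; rw [h P D, h' P D]) f g

/-- The sum of two morphisms. -/
def tensor {a b c d : FreeObj T} (f : FreeHom a b) (g : FreeHom c d) :
    FreeHom (a.add c) (b.add d) :=
  Quotient.map₂ PreHom.tensor (fun _ _ (h : ∀ P D, _) _ _ (h' : ∀ P D, _) P D => by
    simp only [evalHom]; rw [h P D, h' P D]) f g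

@[simp]
theorem eval_comp {a b c : FreeObj T} (f : FreeHom a b) (g : FreeHom b c) :
    (f.comp g).eval D = f.eval D ≫ g.eval D := by
  induction f using Quotient.ind
  induction g using Quotient.ind
  rfl

@[simp]
theorem eval_tensor {a b c d : FreeObj T} (f : FreeHom a b) (g : FreeHom c d) :
    (f.tensor g).eval D = f.eval D ⊗ₘ g.eval D := by
  induction f using Quotient.ind
  induction g using Quotient.ind
  rfl

instance : Category (FreeObj T) where
  Hom := FreeHom
  id a := mk (.id a)
  comp := comp
  id_comp f := eval_ext fun P D => by simp [evalHom]
  comp_id f := eval_ext fun P D => by simp [evalHom]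
  assoc f g h := eval_ext fun P D => by simp

/-- A formal morphism as a morphism of the universal Picard groupoid. -/
def hom {a b : FreeObj T} (f : PreHom T a b) : a ⟶ b := mk f

/-- The functor given by a determinant functor. -/
@[simps obj]
def evalFunctor : FreeObj T ⥤ P where
  obj := evalObj D
  map f := eval D f
  map_id _ := rfl
  map_comp f g := eval_comp D f g

theorem hom_ext {a b : FreeObj T} {f g : a ⟶ b}
    (h : ∀ (P : PicardGroupoid.{u}) (D : DetFunctor T P),
      (evalFunctor D).map f = (evalFunctor D).map g) : f = g := eval_ext h

theorem hom_surjective {a b : FreeObj T} : Function.Surjective (hom : PreHom T a b → (a ⟶ b)) :=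
  mk_surjective

/-- Invertibility of all morphisms of the universal Picard groupoid. -/
def isoOfHom {a b : FreeObj T} (f : PreHom T a b) : a ≅ b where
  hom := hom f
  inv := hom (.inv f)
  hom_inv_id := eval_ext fun _ D =>
    (eval_comp D _ _).trans (IsIso.hom_inv_id (evalHom D f))
  inv_hom_id := eval_ext fun _ D =>
    (eval_comp D _ _).trans (IsIso.inv_hom_id (evalHom D f))

instance : IsGroupoid (FreeObj T) where
  all_isIso f := by
    obtain ⟨f, rfl⟩ := hom_surjective f
    exact (isoOfHom f).isIso_hom

instance : MonoidalCategoryStruct (FreeObj T) where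
  tensorObj := .add
  tensorUnit := .zero
  tensorHom f g := tensor f g
  whiskerLeft a _ _ f := tensor (mk (.id a)) f
  whiskerRight f a := tensor f (mk (.id a))
  associator a b c := isoOfHom (.assoc a b c)
  leftUnitor a := isoOfHom (.lunit a)
  rightUnitor a := isoOfHom (.runit a)

@[simp]
theorem evalFunctor_tensorHom {a b c d : FreeObj T} (f : a ⟶ b) (g : c ⟶ d) :
    (evalFunctor D).map (f ⊗ₘ g) =
      ((evalFunctor D).map f ⊗ₘ (evalFunctor D).map g :
        evalObj D a ⊗ evalObj D c ⟶ evalObj D b ⊗ evalObj D d) := eval_tensor D f g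

@[simp]
theorem evalFunctor_whiskerLeft (a : FreeObj T) {c d : FreeObj T} (g : c ⟶ d) :
    (evalFunctor D).map (a ◁ g) =
      (evalObj D a ◁ (evalFunctor D).map g :
        evalObj D a ⊗ evalObj D c ⟶ evalObj D a ⊗ evalObj D d) :=
  (eval_tensor D _ g).trans (id_tensorHom _ _)

@[simp]
theorem evalFunctor_whiskerRight {a b : FreeObj T} (f : a ⟶ b) (c : FreeObj T) :
    (evalFunctor D).map (f ▷ c) =
      ((evalFunctor D).map f ▷ evalObj D c :
        evalObj D a ⊗ evalObj D c ⟶ evalObj D b ⊗ evalObj D c) :=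
  (eval_tensor D f _).trans (tensorHom_id _ _)

@[simp]
theorem evalFunctor_associator (a b c : FreeObj T) :
    (evalFunctor D).map (α_ a b c).hom =
      (α_ (evalObj D a) (evalObj D b) (evalObj D c)).hom := rfl

instance : MonoidalCategory (FreeObj T) := .ofTensorHom
  (id_tensorHom_id := fun a b => hom_ext fun P D => by
    simp only [evalFunctor_tensorHom, CategoryTheory.Functor.map_id]
    exact id_tensorHom_id _ _)
  (id_tensorHom := fun a _ _ f => rfl)
  (tensorHom_id := fun f a => rfl)
  (tensorHom_comp_tensorHom := fun f g h k => hom_ext fun P D => by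
    simp only [Functor.map_comp, evalFunctor_tensorHom]
    exact tensorHom_comp_tensorHom _ _ _ _)
  (associator_naturality := fun f g h => hom_ext fun P D => by
    simp only [Functor.map_comp, evalFunctor_tensorHom, evalFunctor_associator]
    exact associator_naturality _ _ _)
  (leftUnitor_naturality := fun f => hom_ext fun P D => by
    simp only [Functor.map_comp, evalFunctor_tensorHom, CategoryTheory.Functor.map_id]
    have := leftUnitor_naturality (eval D f)
    rw [← id_tensorHom] at this
    exact this)
  (rightUnitor_naturality := fun f => hom_ext fun P D => by
    simp only [Functor.map_comp, evalFunctor_tensorHom, CategoryTheory.Functor.map_id]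
    have := rightUnitor_naturality (eval D f)
    rw [← tensorHom_id] at this
    exact this)
  (pentagon := fun a b c d => hom_ext fun P D => by
    simp only [Functor.map_comp, evalFunctor_tensorHom, CategoryTheory.Functor.map_id, evalFunctor_associator]
    have := pentagon (evalObj D a) (evalObj D b) (evalObj D c) (evalObj D d)
    simp only [← tensorHom_id, ← id_tensorHom] at this
    exact this)
  (triangle := fun a b => hom_ext fun P D => by
    simp only [Functor.map_comp, evalFunctor_tensorHom, CategoryTheory.Functor.map_id, evalFunctor_associator]
    have := triangle (evalObj D a) (evalObj D b)
    simp only [← tensorHom_id, ← id_tensorHom] at this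
    exact this)

instance : BraidedCategory (FreeObj T) where
  braiding a b := isoOfHom (.braid a b)
  braiding_naturality_left f c := hom_ext fun P D => by
    simp only [Functor.map_comp, evalFunctor_whiskerLeft, evalFunctor_whiskerRight]
    exact BraidedCategory.braiding_naturality_left _ _
  braiding_naturality_right a _ _ f := hom_ext fun P D => by
    simp only [Functor.map_comp, evalFunctor_whiskerLeft, evalFunctor_whiskerRight]
    exact BraidedCategory.braiding_naturality_right _ _
  hexagon_forward a b c := hom_ext fun P D => by
    simp only [Functor.map_comp, evalFunctor_whiskerLeft, evalFunctor_whiskerRight,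
      evalFunctor_associator]
    exact BraidedCategory.hexagon_forward _ _ _
  hexagon_reverse a b c := hom_ext fun P D => by
    -- The inverse associator is a formal inverse, which evaluates to `CategoryTheory.inv` of the
    -- associator; uniqueness of inverses identifies it with the given inverse.
    have h (a b c : FreeObj T) : (evalFunctor D).map (α_ a b c).inv =
        (α_ (evalObj D a) (evalObj D b) (evalObj D c)).inv := by
      refine (Iso.inv_ext ?_).symm
      refine ((evalFunctor D).map_comp (α_ a b c).hom (α_ a b c).inv).symm.trans ?_
      rw [Iso.hom_inv_id]
      exact (evalFunctor D).map_id _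
    simp only [Functor.map_comp, evalFunctor_whiskerLeft, evalFunctor_whiskerRight, h]
    exact BraidedCategory.hexagon_reverse _ _ _

instance : SymmetricCategory (FreeObj T) where
  symmetry a b := hom_ext fun P D => by
    exact SymmetricCategory.symmetry (evalObj D a) (evalObj D b)

variable (T) in
/-- The additive inverses in the universal Picard groupoid. -/
def cancelIso (a : FreeObj T) : a ⊗ FreeObj.neg a ≅ 𝟙_ (FreeObj T) := isoOfHom (.cancel a)

end FreeHom

/-- Tensoring with an object that has an inverse is an equivalence. -/
theorem isEquivalence_tensorLeft_of_iso {C : Type u} [Category.{v} C] [MonoidalCategory C]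
    [BraidedCategory C] {a b : C} (e : a ⊗ b ≅ 𝟙_ C) : (tensorLeft a).IsEquivalence :=
  (CategoryTheory.Equivalence.mk (tensorLeft a) (tensorLeft b)
    ((leftUnitorNatIso C).symm ≪≫ (curriedTensor C).mapIso (e.symm ≪≫ β_ a b) ≪≫
      tensorLeftTensor b a)
    ((tensorLeftTensor a b).symm ≪≫ (curriedTensor C).mapIso e ≪≫
      leftUnitorNatIso C)).isEquivalence_functor

open FreeHom in
variable (T) in
/-- The tautological determinant functor with values in formal objects. -/
def formalDet : DetFunctor T (FreeObj T) where
  functor :=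
    { obj x := FreeObj.of x.of
      map e := hom (.iso e.iso)
      map_id _ := FreeHom.hom_ext fun _ D => D.functor.map_id _
      map_comp _ _ := FreeHom.hom_ext fun _ D => D.functor.map_comp _ _ }
  data :=
    { add f g h hΔ := hom (.triangle f g h hΔ)
      naturality f g h f' g' h' hΔ hΔ' a b c hab hbc hca := FreeHom.hom_ext fun P D => by
        exact D.data.naturality f g h f' g' h' hΔ hΔ' a b c hab hbc hca
      commutativity x y := FreeHom.hom_ext fun P D => by
        exact D.data.commutativity x y
      octahedron comm _ _ hf _ _ hg _ _ hk o := FreeHom.hom_ext fun P D => by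
        have := D.data.octahedron comm hf hg hk o
        simp only [← tensorHom_id, ← id_tensorHom] at this
        exact this }

/-- Evaluation sends formal sums and the formal unit to sums and the unit on the nose, so its
monoidal structure maps are identities. This and the two following lemmas are the coherence
conditions for such structure maps. -/
theorem associativity_of_id {C : Type u} [Category.{v} C] [MonoidalCategory C] (X Y Z : C) :
    𝟙 (X ⊗ Y) ▷ Z ≫ 𝟙 _ ≫ (α_ X Y Z).hom = (α_ X Y Z).hom ≫ X ◁ 𝟙 (Y ⊗ Z) ≫ 𝟙 _ := by
  simp

theorem left_unitality_of_id {C : Type u} [Category.{v} C] [MonoidalCategory C] (X : C) :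
    (λ_ X).hom = 𝟙 (𝟙_ C) ▷ X ≫ 𝟙 _ ≫ (λ_ X).hom := by
  simp

theorem right_unitality_of_id {C : Type u} [Category.{v} C] [MonoidalCategory C] (X : C) :
    (ρ_ X).hom = X ◁ 𝟙 (𝟙_ C) ≫ 𝟙 _ ≫ (ρ_ X).hom := by
  simp

instance : (FreeHom.evalFunctor D).Braided where
  toMonoidal := Functor.CoreMonoidal.toMonoidal
    { εIso := Iso.refl _
      μIso _ _ := Iso.refl _
      μIso_hom_natural_left f a := by
        exact (comp_id _).trans ((FreeHom.evalFunctor_whiskerRight D f a).symm.trans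
          (id_comp _).symm)
      μIso_hom_natural_right a f := by
        exact (comp_id _).trans ((FreeHom.evalFunctor_whiskerLeft D a f).symm.trans
          (id_comp _).symm)
      associativity a b c := by
        exact associativity_of_id (evalObj D a) (evalObj D b) (evalObj D c)
      left_unitality a := by exact left_unitality_of_id (evalObj D a)
      right_unitality a := by exact right_unitality_of_id (evalObj D a) }
  braided a b := by
    exact (id_comp _).trans (comp_id _).symm

/-! ### Coherence diagrams, one for each kind of structural morphism, for the naturality of the
comparison -/

section Coherence

variable {C : Type u} [Category.{v} C] [MonoidalCategory C]

theorem comparison_tensor {A A' B B' X X' Y Y' Z : C} {f : A ⟶ B} {b : B ⟶ B'} {a : A ⟶ A'}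
    {f' : A' ⟶ B'} {g : X ⟶ Y} {d : Y ⟶ Y'} {c : X ⟶ X'} {g' : X' ⟶ Y'}
    (hf : f ≫ b = a ≫ f') (hg : g ≫ d = c ≫ g') (m : B' ⊗ Y' ⟶ Z) :
    (f ⊗ₘ g) ≫ (b ⊗ₘ d) ≫ m = (a ⊗ₘ c) ≫ (f' ⊗ₘ g') ≫ m := by
  rw [tensorHom_comp_tensorHom_assoc, tensorHom_comp_tensorHom_assoc, hf, hg]

theorem comparison_associator {X X' Y Y' Z Z' XY YZ L R : C} (a : X ⟶ X') (b : Y ⟶ Y')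
    (c : Z ⟶ Z') {m : X' ⊗ Y' ⟶ XY} {n : XY ⊗ Z' ⟶ L} {s : L ⟶ R} {p : Y' ⊗ Z' ⟶ YZ}
    {q : X' ⊗ YZ ⟶ R} (h : m ▷ Z' ≫ n ≫ s = (α_ X' Y' Z').hom ≫ X' ◁ p ≫ q) :
    (α_ X Y Z).hom ≫ (a ⊗ₘ (b ⊗ₘ c) ≫ p) ≫ q = (((a ⊗ₘ b) ≫ m ⊗ₘ c) ≫ n) ≫ s := by
  have e : ((a ⊗ₘ b) ≫ m ⊗ₘ c) = ((a ⊗ₘ b) ⊗ₘ c) ≫ m ▷ Z' := by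
    rw [← tensorHom_id, tensorHom_comp_tensorHom, comp_id]
  have e' : (a ⊗ₘ (b ⊗ₘ c) ≫ p) = (a ⊗ₘ (b ⊗ₘ c)) ≫ X' ◁ p := by
    rw [← id_tensorHom, tensorHom_comp_tensorHom, comp_id]
  rw [e, assoc, assoc, h, associator_naturality_assoc, e', assoc]

theorem comparison_leftUnitor {X X' U L : C} (a : X ⟶ X') {e : 𝟙_ C ⟶ U} {m : U ⊗ X' ⟶ L}
    {s : L ⟶ X'} (h : (λ_ X').hom = e ▷ X' ≫ m ≫ s) :
    (λ_ X).hom ≫ a = ((e ⊗ₘ a) ≫ m) ≫ s := by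
  rw [MonoidalCategory.tensorHom_def', assoc, assoc, ← h, leftUnitor_naturality]

theorem comparison_rightUnitor {X X' U L : C} (a : X ⟶ X') {e : 𝟙_ C ⟶ U} {m : X' ⊗ U ⟶ L}
    {s : L ⟶ X'} (h : (ρ_ X').hom = X' ◁ e ≫ m ≫ s) :
    (ρ_ X).hom ≫ a = ((a ⊗ₘ e) ≫ m) ≫ s := by
  rw [MonoidalCategory.tensorHom_def, assoc, assoc, ← h, rightUnitor_naturality]

theorem comparison_braiding [BraidedCategory C] {X X' Y Y' L R : C} (a : X ⟶ X') (b : Y ⟶ Y')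
    {m : X' ⊗ Y' ⟶ L} {n : Y' ⊗ X' ⟶ R} {s : L ⟶ R} (h : m ≫ s = (β_ X' Y').hom ≫ n) :
    (β_ X Y).hom ≫ (b ⊗ₘ a) ≫ n = ((a ⊗ₘ b) ≫ m) ≫ s := by
  rw [assoc, h, BraidedCategory.braiding_naturality_assoc]

end Coherence

/-! ### Comparison of evaluation with an arbitrary extension -/

section Comparison

/-- The cancelled morphism is the solution, for the unknown component at a negative, of the equation
expressing compatibility with the cancellation of an object against its negative. -/
theorem tensor_cancelLeft_comp {X X' N N' U W Z : P} (n : X ⊗ N ⟶ U) (e : U ⟶ Z) (k : W ⟶ Z)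
    (m : X' ⊗ N' ⟶ W) (t : X ⟶ X') :
    (t ⊗ₘ cancelLeft X (n ≫ e ≫ pinv k ≫ pinv m ≫ pinv t ▷ N')) ≫ m ≫ k = n ≫ e := by
  have h : pinv t ▷ N' ≫ t ▷ N' = 𝟙 _ := by rw [← comp_whiskerRight, pinv_comp, id_whiskerRight]
  rw [MonoidalCategory.tensorHom_def', whiskerLeft_cancelLeft]
  simp only [assoc]
  rw [reassoc_of% h, pinv_comp_assoc, pinv_comp, comp_id]

theorem comparison_cancel {A N X Y W I U : P} {b : A ⟶ X} {b' : N ⟶ Y} {m : X ⊗ Y ⟶ W}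
    {t : A ⊗ N ⟶ W} {c : A ⊗ N ⟶ I} {e e' : I ⟶ U} {k : W ⟶ U} (h₁ : 𝟙 _ ≫ t = (b ⊗ₘ b') ≫ m)
    (h₂ : 𝟙 _ ≫ e = e') (h₃ : c ≫ e = t ≫ k) : (b ⊗ₘ b') ≫ m ≫ k = c ≫ e' := by
  rw [← assoc, ← h₁, ← h₂, id_comp, id_comp, h₃]

theorem comparison_iso {X X' Y Y' : P} {a : X ⟶ X'} {b : Y ⟶ Y'} {f : X ⟶ Y} {f' : X' ⟶ Y'}
    (h : f ≫ b = a ≫ f') : f' ≫ pinv b = pinv a ≫ f := by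
  rw [← cancel_mono b, ← cancel_epi a]
  simp [h]

theorem comparison_triangle {X X' Y Y' Z Z' L : P} {a : X ⟶ X'} {b : Y ⟶ Y'} {c : Z ⟶ Z'}
    {m : Z ⊗ X ⟶ L} {s : L ⟶ Y} {t : Z' ⊗ X' ⟶ Y'} (h : (m ≫ s) ≫ b = (c ⊗ₘ a) ≫ t) :
    t ≫ pinv b = ((pinv c ⊗ₘ pinv a) ≫ m) ≫ s := by
  rw [← cancel_mono b, assoc, pinv_comp, assoc, assoc, ← assoc m, h,
    tensorHom_comp_tensorHom_assoc]
  simp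

variable (G : FreeObj T ⥤ P) [G.Braided]

/-- The component at `-a` of a monoidal transformation, given its component at `a`. -/
def negComponent {a : FreeObj T} (t : evalObj D a ⟶ G.obj a) :
    evalObj D a.neg ⟶ G.obj a.neg :=
  cancelLeft (evalObj D a) ((negIso (evalObj D a)).hom ≫ LaxMonoidal.ε G ≫
    pinv (G.map (FreeHom.hom (.cancel a) : a ⊗ a.neg ⟶ 𝟙_ _)) ≫
    pinv (LaxMonoidal.μ G a a.neg) ≫ pinv t ▷ _)

theorem negComponent_spec {a : FreeObj T} (t : evalObj D a ⟶ G.obj a) :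
    (t ⊗ₘ negComponent D G t) ≫ LaxMonoidal.μ G a a.neg ≫
      G.map (FreeHom.hom (.cancel a) : a ⊗ a.neg ⟶ 𝟙_ _) =
    (negIso (evalObj D a)).hom ≫ LaxMonoidal.ε G := by
  exact tensor_cancelLeft_comp _ _ _ _ t

/-- All morphisms are invertible and adding an object is faithful, so compatibility with
cancellation leaves no freedom at a negative. -/
theorem eq_negComponent {a : FreeObj T} (t : evalObj D a ⟶ G.obj a)
    (s : evalObj D a.neg ⟶ G.obj a.neg)
    (hs : (t ⊗ₘ s) ≫ LaxMonoidal.μ G a a.neg ≫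
        G.map (FreeHom.hom (.cancel a) : a ⊗ a.neg ⟶ 𝟙_ _) =
      (negIso (evalObj D a)).hom ≫ LaxMonoidal.ε G) : s = negComponent D G t := by
  rw [← negComponent_spec D G t] at hs
  have := (cancel_mono _).1 hs
  rw [MonoidalCategory.tensorHom_def', MonoidalCategory.tensorHom_def'] at this
  exact whiskerLeft_injective _ ((cancel_mono _).1 this)

variable {G} (α : (formalDet T).post G ⟶ D)

/-- The components of the comparison of the functor induced by a determinant functor with another
functor extending the determinant functor. -/
def freeComponent : (a : FreeObj T) → (evalObj D a ⟶ G.obj a)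
  | .of x => pinv (α.natTrans.app ⟨x⟩)
  | .zero => LaxMonoidal.ε G
  | .add a b => (freeComponent a ⊗ₘ freeComponent b) ≫ LaxMonoidal.μ G a b
  | .neg a => negComponent D G (freeComponent a)

/-- Induction on the formal morphism. Structural morphisms use the coherence of `G`, cancellation
uses the equation that defines `negComponent`, and the two kinds of generators use the naturality of
`α` and its compatibility with additivity data. Working with representatives suffices because every
morphism has one. -/
theorem freeComponent_naturality {a b : FreeObj T} (p : PreHom T a b) :
    evalHom D p ≫ freeComponent D α b = freeComponent D α a ≫ G.map (FreeHom.hom p) := by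
  induction p with
  | id a => exact (id_comp _).trans ((comp_id _).symm.trans
      (congrArg (_ ≫ ·) (G.map_id a).symm))
  | comp p q hp hq =>
    have := G.map_comp (FreeHom.hom p) (FreeHom.hom q)
    refine Eq.trans ?_ (congrArg (_ ≫ ·) this.symm)
    rw [evalHom, assoc, hq, reassoc_of% hp]
  | @inv a b p hp =>
    have : G.map (FreeHom.hom p) ≫ G.map (FreeHom.hom p.inv) = 𝟙 _ := by
      rw [← G.map_comp]
      exact (congrArg G.map (FreeHom.isoOfHom p).hom_inv_id).trans (G.map_id _)
    rw [evalHom, IsIso.inv_comp_eq, reassoc_of% hp, this, comp_id]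
  | @tensor a b c d p q hp hq =>
    have := LaxMonoidal.μ_natural G (FreeHom.hom p) (FreeHom.hom q)
    refine Eq.trans ?_ ((congrArg (_ ≫ ·) this).trans (assoc _ _ _).symm)
    exact comparison_tensor hp hq _
  | assoc a b c => exact comparison_associator _ _ _ (LaxMonoidal.associativity G a b c)
  | lunit a => exact comparison_leftUnitor _ (LaxMonoidal.left_unitality G a)
  | runit a => exact comparison_rightUnitor _ (LaxMonoidal.right_unitality G a)
  | braid a b => exact comparison_braiding _ _ (LaxBraided.braided (F := G) a b)
  | cancel a => exact (negComponent_spec D G _).symm.trans (assoc _ _ _).symm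
  | @iso x y e =>
    exact comparison_iso (α.natTrans.naturality (CoreHom.mk e : Core.mk x ⟶ Core.mk y))
  | triangle f g h hΔ => exact comparison_triangle (α.compatible f g h hΔ)

/-- The comparison of the functor induced by a determinant functor with another functor extending
the determinant functor. -/
@[simps]
def freeComparison : FreeHom.evalFunctor D ⟶ G where
  app := freeComponent D α
  naturality a b p := by
    obtain ⟨p, rfl⟩ := FreeHom.hom_surjective p
    exact freeComponent_naturality D α p

instance : NatTrans.IsMonoidal (freeComparison D α) where
  unit := by exact id_comp _
  tensor a b := by exact id_comp _

/-- Induction on the formal object: the generators are fixed by the hypothesis, the unit and sums by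
monoidality, and negatives by `eq_negComponent`. -/
theorem eq_freeComponent (β : FreeHom.evalFunctor D ⟶ G) [NatTrans.IsMonoidal β]
    (h : ∀ x : T, β.app (.of x) ≫ α.natTrans.app ⟨x⟩ = 𝟙 _) (a : FreeObj T) :
    β.app a = freeComponent D α a := by
  induction a with
  | of x =>
    refine (cancel_mono (α.natTrans.app ⟨x⟩)).1 ((h x).trans ?_)
    exact (pinv_comp (α.natTrans.app ⟨x⟩)).symm
  | zero => exact (id_comp _).symm.trans (NatTrans.IsMonoidal.unit (τ := β))
  | add a b ha hb =>
    rw [freeComponent, ← ha, ← hb]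
    exact (id_comp _).symm.trans (NatTrans.IsMonoidal.tensor (τ := β) a b)
  | neg a ha =>
    rw [freeComponent, ← ha]
    refine eq_negComponent D G _ _ ?_
    exact comparison_cancel (NatTrans.IsMonoidal.tensor (τ := β) a a.neg)
      (NatTrans.IsMonoidal.unit (τ := β))
      (β.naturality (FreeHom.hom (.cancel a) : a ⊗ a.neg ⟶ 𝟙_ _))

end Comparison
variable (T) in
/-- The universal Picard groupoid of a triangulated category. -/
def freePicard : PicardGroupoid.{u} where
  carrier := FreeObj T
  isEquivalence_tensorLeft a := isEquivalence_tensorLeft_of_iso (FreeHom.cancelIso T a)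

variable (T) in
/-- The universal determinant functor of a triangulated category. -/
def freeDet : DetFunctor T (freePicard T) := formalDet T

/-- The symmetric monoidal functor induced by a determinant functor. -/
def freeLift : freePicard T ⟶ P where
  functor := FreeHom.evalFunctor D
  braided := (inferInstance : (FreeHom.evalFunctor D).Braided)

/-- The symmetric monoidal functor induced by a determinant functor extends it. -/
def freeLiftHom : (freeDet T).post (freeLift D).functor ⟶ D where
  natTrans :=
    { app _ := 𝟙 _
      naturality _ _ f := by exact (comp_id _).trans (id_comp _).symm }
  compatible _ _ _ f g h hΔ := by
    have key {X Y Z : P} (m : X ⊗ Y ⟶ Z) : (𝟙 _ ≫ m) ≫ 𝟙 _ = (𝟙 X ⊗ₘ 𝟙 Y) ≫ m := by simp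
    exact key (D.data.add f g h hΔ)

/-- Evaluation at `E` is the extension. The comparison of `freeComparison` is the required
2-morphism, and `eq_freeComponent` is its uniqueness. -/
theorem freeDet_isUniversal : (freeDet T).IsUniversal := fun P' E => by
  refine ⟨freeLift E, freeLiftHom E, fun f' α' => ?_⟩
  let G : FreeObj T ⥤ P' := f'.functor
  let _ : G.Braided := f'.braided
  let α : (formalDet T).post G ⟶ E := α'
  have hα (x : T) : freeComponent E α (.of x) ≫ α.natTrans.app ⟨x⟩ = 𝟙 _ := pinv_comp _
  refine ⟨@PicardGroupoid.Hom₂.mk _ _ _ _ (freeComparison E α)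
    (inferInstance : NatTrans.IsMonoidal (freeComparison E α)),
    DetFunctor.Hom.ext (NatTrans.ext (funext fun x => hα x.of)), fun β hβ => ?_⟩
  let β' : FreeHom.evalFunctor E ⟶ G := β.natTrans
  have : NatTrans.IsMonoidal β' := β.isMonoidal
  refine PicardGroupoid.Hom₂.ext (NatTrans.ext (funext fun a => ?_))
  refine eq_freeComponent E α β' (fun x => ?_) a
  exact congrArg (fun t => t.natTrans.app ⟨x⟩) hβ

end Model

/-! ### Values of a determinant functor exhaust the universal Picard groupoid -/

section Generators

open scoped ZeroObject

/-- Every object of the target of a determinant functor which is a sum of values of the functor is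
itself such a value. -/
theorem DetFunctor.exists_iso_tensor {T : Type u} [Category.{v} T] [Preadditive T] [HasZeroObject T]
    [HasShift T ℤ] [∀ n : ℤ, (shiftFunctor T n).Additive] [Pretriangulated T] {P : Type u'}
    [Category.{v'} P] [MonoidalCategory P] [BraidedCategory P] [IsGroupoid P] (d : DetFunctor T P)
    (x y : Core T) : ∃ z, Nonempty (d.functor.obj x ⊗ d.functor.obj y ≅ d.functor.obj z) :=
  ⟨⟨y.of ⊞ x.of⟩, ⟨asIso (d.data.add _ _ _ (biprod_inl_snd_distinguished y.of x.of))⟩⟩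

/-- The value of a determinant functor at the zero object is the unit. -/
theorem DetFunctor.nonempty_zero_iso {T : Type u} [SmallCategory T] [Preadditive T]
    [HasZeroObject T] [HasShift T ℤ] [∀ n : ℤ, (shiftFunctor T n).Additive] [Pretriangulated T]
    {P : PicardGroupoid.{u}} (d : DetFunctor T P) :
    Nonempty (d.functor.obj ⟨0⟩ ≅ 𝟙_ P) := by
  -- The contractible triangle on a zero object gives d(0) + d(0) ≅ d(0), and one summand cancels.
  let m : d.functor.obj ⟨0⟩ ⊗ d.functor.obj ⟨0⟩ ≅ d.functor.obj ⟨0⟩ :=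
    asIso (d.data.add _ _ _ (contractible_distinguished (0 : T)))
  exact ⟨(tensorLeft (d.functor.obj ⟨0⟩)).preimageIso (m ≪≫ (ρ_ _).symm)⟩

/-- The value of a determinant functor at a shifted object is the additive inverse. -/
theorem DetFunctor.nonempty_shift_iso {T : Type u} [SmallCategory T] [Preadditive T]
    [HasZeroObject T] [HasShift T ℤ] [∀ n : ℤ, (shiftFunctor T n).Additive] [Pretriangulated T]
    {P : PicardGroupoid.{u}} (d : DetFunctor T P) (x : T) :
    Nonempty (d.functor.obj ⟨x⟩ ⊗ d.functor.obj ⟨x⟦(1 : ℤ)⟧⟩ ≅ 𝟙_ P) := by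
  obtain ⟨e⟩ := d.nonempty_zero_iso
  -- The triangle is x ⟶ 0 ⟶ Σx ⟶ Σx, whose additivity morphism has source d(Σx) + d(x) and target
  -- d(0).
  exact ⟨β_ _ _ ≪≫ asIso (d.data.add _ _ _ (contractible_distinguished₂ x)) ≪≫ e⟩

/-- Induction on formal objects: a zero object, a direct sum and a shift of objects of `T` realise
the unit, a sum and a negative. -/
theorem formalDet_essSurj {T : Type u} [SmallCategory T] [Preadditive T]
    [HasZeroObject T] [HasShift T ℤ] [∀ n : ℤ, (shiftFunctor T n).Additive] [Pretriangulated T]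
    (a : freePicard T) : ∃ x, Nonempty ((freeDet T).functor.obj x ≅ a) := by
  have key (a : FreeObj T) : ∃ x : T, Nonempty ((show freePicard T from .of x) ≅ a) := by
    induction a with
    | of x => exact ⟨x, ⟨Iso.refl _⟩⟩
    | zero => exact ⟨0, (freeDet T).nonempty_zero_iso⟩
    | add a b ha hb =>
      obtain ⟨x, ⟨e⟩⟩ := ha
      obtain ⟨y, ⟨e'⟩⟩ := hb
      obtain ⟨z, ⟨e''⟩⟩ := (freeDet T).exists_iso_tensor ⟨x⟩ ⟨y⟩
      exact ⟨z.of, ⟨e''.symm ≪≫ (e ⊗ᵢ e')⟩⟩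
    | neg a ha =>
      obtain ⟨x, ⟨e⟩⟩ := ha
      obtain ⟨e'⟩ := (freeDet T).nonempty_shift_iso x
      let e'' : (show freePicard T from a.neg) ⊗ (show freePicard T from a) ≅ 𝟙_ _ :=
        β_ _ _ ≪≫ FreeHom.cancelIso T a
      -- Both the value at Σx and the formal negative of `a` are inverse to the value at `x`, so
      -- they are isomorphic by cancellation.
      refine ⟨x⟦(1 : ℤ)⟧, ⟨(tensorLeft ((freeDet T).functor.obj ⟨x⟩)).preimageIso
        (e' ≪≫ (FreeHom.cancelIso T a).symm ≪≫ whiskerRightIso e.symm _)⟩⟩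
  obtain ⟨x, h⟩ := key a
  exact ⟨⟨x⟩, h⟩

end Generators

/-! ### Pointwise sums of symmetric monoidal functors and of determinant functors -/

section Pointwise

section Braiding

variable {C : Type u} [Category.{v} C] [MonoidalCategory C] [SymmetricCategory C]

/-- Addition is itself a symmetric monoidal functor of two variables. This is the symmetry part, on
which the commutativity axiom of a pointwise sum rests. -/
theorem tensorμ_braiding (W X Y Z : C) :
    (β_ (W ⊗ X) (Y ⊗ Z)).hom ≫ tensorμ Y Z W X =
      tensorμ W X Y Z ≫ ((β_ W Y).hom ⊗ₘ (β_ X Z).hom) := by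
  -- The objects W and Z cross twice in opposite order; the crossings cancel because the braiding is
  -- a symmetry.
  have h : Y ◁ (β_ W Z).hom ▷ X ≫ Y ◁ (β_ Z W).hom ▷ X = 𝟙 _ := by
    rw [← MonoidalCategory.whiskerLeft_comp, ← comp_whiskerRight, SymmetricCategory.symmetry]
    simp
  simp only [tensorμ, Category.assoc,
    BraidedCategory.braiding_tensor_right_hom, BraidedCategory.braiding_tensor_left_hom,
    comp_whiskerRight, whisker_assoc, MonoidalCategory.whiskerLeft_comp, pentagon_assoc,
    pentagon_inv_hom_hom_hom_inv_assoc, Iso.inv_hom_id_assoc, whiskerLeft_hom_inv_assoc]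
  rw [reassoc_of% h, MonoidalCategory.tensorHom_def]
  monoidal

theorem tensorμ_comp_naturality {X Y Z X' Y' Z' A B D A' B' D' : C} {m : Z ⊗ X ⟶ Y}
    {m' : Z' ⊗ X' ⟶ Y'} {n : D ⊗ A ⟶ B} {n' : D' ⊗ A' ⟶ B'} {x : X ⟶ X'} {y : Y ⟶ Y'}
    {z : Z ⟶ Z'} {a : A ⟶ A'} {b : B ⟶ B'} {d : D ⟶ D'} (h : m ≫ y = (z ⊗ₘ x) ≫ m')
    (k : n ≫ b = (d ⊗ₘ a) ≫ n') :
    (tensorμ Z D X A ≫ (m ⊗ₘ n)) ≫ (y ⊗ₘ b) =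
      ((z ⊗ₘ d) ⊗ₘ (x ⊗ₘ a)) ≫ tensorμ Z' D' X' A' ≫ (m' ⊗ₘ n') := by
  rw [← assoc (_ ⊗ₘ _), tensorμ_natural, assoc, assoc, tensorHom_comp_tensorHom,
    tensorHom_comp_tensorHom, h, k]

theorem tensorμ_comp_braiding {X Y X' Y' A B : C} {m : X ⊗ Y ⟶ A} {m' : Y ⊗ X ⟶ A}
    {n : X' ⊗ Y' ⟶ B} {n' : Y' ⊗ X' ⟶ B} (h : (β_ X Y).hom ≫ m' = m)
    (k : (β_ X' Y').hom ≫ n' = n) :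
    (β_ (X ⊗ X') (Y ⊗ Y')).hom ≫ tensorμ Y Y' X X' ≫ (m' ⊗ₘ n') =
      tensorμ X X' Y Y' ≫ (m ⊗ₘ n) := by
  rw [← assoc, tensorμ_braiding, assoc, tensorHom_comp_tensorHom, h, k]

theorem tensorμ_comp_map_braiding {X Y X' Y' A B A' B' : C} {m : X ⊗ Y ⟶ A} {m' : Y ⊗ X ⟶ B}
    {n : X' ⊗ Y' ⟶ A'} {n' : Y' ⊗ X' ⟶ B'} {s : A ⟶ B} {t : A' ⟶ B'}
    (h : m ≫ s = (β_ X Y).hom ≫ m') (k : n ≫ t = (β_ X' Y').hom ≫ n') :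
    (tensorμ X X' Y Y' ≫ (m ⊗ₘ n)) ≫ (s ⊗ₘ t) =
      (β_ (X ⊗ X') (Y ⊗ Y')).hom ≫ tensorμ Y Y' X X' ≫ (m' ⊗ₘ n') := by
  rw [assoc, tensorHom_comp_tensorHom, h, k]
  exact (tensorμ_comp_braiding rfl rfl).symm

/-- The octahedron axiom of a pointwise sum: two octahedron equations are added and rearranged by
`tensor_associativity`. -/
theorem tensorμ_comp_associator {X Y Z XY YZ W X' Y' Z' XY' YZ' W' : C} {m : X ⊗ Y ⟶ XY}
    {n : XY ⊗ Z ⟶ W} {p : Y ⊗ Z ⟶ YZ} {q : X ⊗ YZ ⟶ W} {m' : X' ⊗ Y' ⟶ XY'}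
    {n' : XY' ⊗ Z' ⟶ W'} {p' : Y' ⊗ Z' ⟶ YZ'} {q' : X' ⊗ YZ' ⟶ W'}
    (h : m ▷ Z ≫ n = (α_ X Y Z).hom ≫ X ◁ p ≫ q)
    (h' : m' ▷ Z' ≫ n' = (α_ X' Y' Z').hom ≫ X' ◁ p' ≫ q') :
    (tensorμ X X' Y Y' ≫ (m ⊗ₘ m')) ▷ (Z ⊗ Z') ≫ tensorμ XY XY' Z Z' ≫ (n ⊗ₘ n') =
      (α_ (X ⊗ X') (Y ⊗ Y') (Z ⊗ Z')).hom ≫ (X ⊗ X') ◁ (tensorμ Y Y' Z Z' ≫ (p ⊗ₘ p')) ≫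
        tensorμ X X' YZ YZ' ≫ (q ⊗ₘ q') := by
  have key := tensor_associativity X X' Y Y' Z Z'
  simp only [comp_whiskerRight, MonoidalCategory.whiskerLeft_comp, assoc]
  rw [← assoc ((_ ⊗ₘ _) ▷ _), tensorμ_natural_left, assoc, tensorHom_comp_tensorHom, h, h',
    ← tensorHom_comp_tensorHom, reassoc_of% key, ← assoc (_ ◁ (_ ⊗ₘ _)),
    tensorμ_natural_right, assoc, tensorHom_comp_tensorHom]

end Braiding

variable {C : Type u} [Category.{v} C]
  {P : Type u'} [Category.{v'} P] [MonoidalCategory P]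

theorem tensorHom_comp_tensorHom_of_eq {X Y Y' Z A B B' D : P} {f : X ⟶ Y} {g : Y ⟶ Z}
    {f' : X ⟶ Y'} {g' : Y' ⟶ Z} {h : A ⟶ B} {k : B ⟶ D} {h' : A ⟶ B'} {k' : B' ⟶ D}
    (e : f ≫ g = f' ≫ g') (e' : h ≫ k = h' ≫ k') :
    (f ⊗ₘ h) ≫ (g ⊗ₘ k) = (f' ⊗ₘ h') ≫ (g' ⊗ₘ k') := by
  rw [tensorHom_comp_tensorHom, tensorHom_comp_tensorHom, e, e']

/-- The pointwise sum of two functors. -/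
@[simps]
def sumFunctor (F G : C ⥤ P) : C ⥤ P where
  obj x := F.obj x ⊗ G.obj x
  map f := F.map f ⊗ₘ G.map f

/-- The pointwise sum of two natural transformations. -/
@[simps]
def sumNatTrans {F F' G G' : C ⥤ P} (σ : F ⟶ F') (τ : G ⟶ G') :
    sumFunctor F G ⟶ sumFunctor F' G' where
  app x := σ.app x ⊗ₘ τ.app x
  naturality x y f := by
    exact tensorHom_comp_tensorHom_of_eq (σ.naturality f) (τ.naturality f)

variable [SymmetricCategory P]

section

variable [MonoidalCategory C] (F G : C ⥤ P) [F.Monoidal] [G.Monoidal]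

instance : (sumFunctor F G).Monoidal :=
  inferInstanceAs (F.prod' G ⋙ tensor P).Monoidal

theorem sumFunctor_μ (x y : C) : LaxMonoidal.μ (sumFunctor F G) x y =
    tensorμ (F.obj x) (G.obj x) (F.obj y) (G.obj y) ≫
      (LaxMonoidal.μ F x y ⊗ₘ LaxMonoidal.μ G x y) := by
  have : LaxMonoidal.μ (sumFunctor F G) x y =
    tensorμ (F.obj x) (G.obj x) (F.obj y) (G.obj y) ≫
    ((LaxMonoidal.μ (F.prod' G) x y).1 ⊗ₘ (LaxMonoidal.μ (F.prod' G) x y).2) := rfl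
  rw [this, prod'_μ_fst, prod'_μ_snd]

end

instance [MonoidalCategory C] [BraidedCategory C] (F G : C ⥤ P) [F.Braided] [G.Braided] :
    (sumFunctor F G).Braided where
  braided x y := by
    rw [sumFunctor_μ, sumFunctor_μ]
    exact tensorμ_comp_map_braiding (LaxBraided.braided (F := F) x y)
      (LaxBraided.braided (F := G) x y)

variable {T : Type u} [Category.{v} T] [Preadditive T] [HasZeroObject T]
  [HasShift T ℤ] [∀ n : ℤ, (shiftFunctor T n).Additive] [Pretriangulated T]

/-- The pointwise sum of additivity data. -/
def AdditivityData.sum {F G : Core T ⥤ P} (s : AdditivityData F) (t : AdditivityData G) :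
    AdditivityData (sumFunctor F G) where
  add f g h hΔ := tensorμ _ _ _ _ ≫ (s.add f g h hΔ ⊗ₘ t.add f g h hΔ)
  naturality f g h f' g' h' hΔ hΔ' a b c hab hbc hca := by
    exact tensorμ_comp_naturality (s.naturality f g h f' g' h' hΔ hΔ' a b c hab hbc hca)
      (t.naturality f g h f' g' h' hΔ hΔ' a b c hab hbc hca)
  commutativity x y := by
    exact tensorμ_comp_braiding (s.commutativity x y) (t.commutativity x y)
  octahedron comm _ _ hf _ _ hg _ _ hk o := by
    exact tensorμ_comp_associator (s.octahedron comm hf hg hk o) (t.octahedron comm hf hg hk o)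

/-- The pointwise sum of determinant functors. -/
def DetFunctor.sum (D E : DetFunctor T P) : DetFunctor T P :=
  ⟨sumFunctor D.functor E.functor, D.data.sum E.data⟩

/-- The pointwise sum of morphisms of determinant functors. -/
def DetFunctor.sumMap {D D' E E' : DetFunctor T P} (σ : D ⟶ D') (τ : E ⟶ E') :
    D.sum E ⟶ D'.sum E' where
  natTrans := sumNatTrans σ.natTrans τ.natTrans
  compatible x y z f g h hΔ := by
    exact tensorμ_comp_naturality (σ.compatible f g h hΔ) (τ.compatible f g h hΔ)

/-- Symmetric monoidal functors commute with sums of determinant functors. -/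
def DetFunctor.postSum {Q : Type u''} [Category.{v''} Q] [MonoidalCategory Q]
    [BraidedCategory Q] (d : DetFunctor T Q) (p q : Q ⥤ P) [p.Braided] [q.Braided] :
    d.post (sumFunctor p q) ⟶ (d.post p).sum (d.post q) where
  natTrans :=
    { app x := 𝟙 _
      naturality _ _ f := by exact (comp_id _).trans (id_comp _).symm }
  compatible x y z f g h hΔ := by
    have : (d.post (sumFunctor p q)).data.add f g h hΔ =
      ((d.post p).sum (d.post q)).data.add f g h hΔ := by
        refine (congrArg (· ≫ _) (sumFunctor_μ p q _ _)).trans ((assoc _ _ _).trans ?_)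
        exact congrArg (tensorμ _ _ _ _ ≫ ·) (tensorHom_comp_tensorHom _ _ _ _)
    rw [this]
    exact (comp_id _).trans ((id_comp _).symm.trans (congrArg (· ≫ _) (id_tensorHom_id _ _).symm))

end Pointwise

/-! ### Inverse 2-morphisms and conjugation identities -/

section Inverses

theorem comp_eq_of_inverses {P : PicardGroupoid.{u}} {X Y X' Y' Z Z' : P} {x : X ⟶ X'} {y : Y ⟶ Y'} {z : Z ⟶ Z'}
    {m : Z ⊗ X ⟶ Y} {m' : Z' ⊗ X' ⟶ Y'} (h : m ≫ y = (z ⊗ₘ x) ≫ m') :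
    m' ≫ pinv y = (pinv z ⊗ₘ pinv x) ≫ m := by
  rw [← cancel_mono y, assoc, pinv_comp, assoc, h, tensorHom_comp_tensorHom_assoc]
  simp

/-- The inverse of a 2-morphism of Picard groupoids. -/
def PicardGroupoid.Hom₂.symm {P Q : PicardGroupoid.{u}} {f g : P ⟶ Q} (β : f ⟶ g) : g ⟶ f where
  natTrans :=
    { app x := pinv (β.natTrans.app x)
      naturality _ _ h := comparison_iso (β.natTrans.naturality h) }
  isMonoidal :=
    { unit := by
        have := NatTrans.IsMonoidal.unit (τ := β.natTrans)
        rw [← this, assoc, comp_pinv, comp_id]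
      tensor x y := comp_eq_of_inverses (NatTrans.IsMonoidal.tensor (τ := β.natTrans) x y) }

@[simp]
theorem PicardGroupoid.Hom₂.symm_app {P Q : PicardGroupoid.{u}} {f g : P ⟶ Q} (β : f ⟶ g)
    (x : P) : β.symm.natTrans.app x = pinv (β.natTrans.app x) := rfl

variable {T : Type u} [SmallCategory T] [Preadditive T] [HasZeroObject T]
  [HasShift T ℤ] [∀ n : ℤ, (shiftFunctor T n).Additive] [Pretriangulated T]
  {P : PicardGroupoid.{u}}

@[ext]
theorem DetFunctor.hom_ext {D E : DetFunctor T P} {α β : D ⟶ E}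
    (h : ∀ x, α.natTrans.app x = β.natTrans.app x) : α = β :=
  DetFunctor.Hom.ext (NatTrans.ext (funext h))

/-- The inverse of a morphism of determinant functors. -/
def DetFunctor.Hom.symm {D E : DetFunctor T P} (θ : D ⟶ E) : E ⟶ D where
  natTrans :=
    { app x := pinv (θ.natTrans.app x)
      naturality _ _ f := comparison_iso (θ.natTrans.naturality f) }
  compatible _ _ _ f g h hΔ := comp_eq_of_inverses (θ.compatible f g h hΔ)

theorem conj_comp {P : PicardGroupoid.{u}} {X X' Y Y' Z Z' : P} (x : X ⟶ X') (y : Y ⟶ Y')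
    (z : Z ⟶ Z') (f : X ⟶ Y) (g : Y ⟶ Z) :
    pinv x ≫ (f ≫ g) ≫ z = (pinv x ≫ f ≫ y) ≫ pinv y ≫ g ≫ z := by
  simp

theorem conj_eq {P : PicardGroupoid.{u}} {X X' X'' Y Y' Y'' : P} {x : X ⟶ X'} {x' : X'' ⟶ X'}
    {y : Y ⟶ Y'} {y' : Y'' ⟶ Y'} {f : X ⟶ Y} {g : X'' ⟶ Y''} {b : X ⟶ X''} {c : Y ⟶ Y''}
    (hx : b ≫ x' = x) (hy : c ≫ y' = y) (h : f ≫ c = b ≫ g) :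
    pinv x ≫ f ≫ y = pinv x' ≫ g ≫ y' := by
  subst hx hy
  rw [← cancel_epi (b ≫ x'), comp_pinv_assoc, reassoc_of% h, assoc, comp_pinv_assoc]

theorem conj_comp_eq {P : PicardGroupoid.{u}} {X X' X'' Y Y' Y'' : P} (x : X ⟶ X') (y : Y ⟶ Y')
    (f : X ⟶ Y) (s : X' ⟶ X'') (t : Y' ⟶ Y'') :
    (pinv x ≫ f ≫ y) ≫ t = s ≫ pinv (x ≫ s) ≫ f ≫ y ≫ t := by
  rw [← cancel_epi x]
  simp only [assoc, comp_pinv_assoc]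
  rw [← assoc x s, comp_pinv_assoc]

theorem conj_eq_of_naturality {P : PicardGroupoid.{u}} {X X' Y Y' : P} {x : X ⟶ X'} {y : Y ⟶ Y'}
    {f : X ⟶ Y} {g : X' ⟶ Y'} (h : f ≫ y = x ≫ g) : pinv x ≫ f ≫ y = g := by
  rw [h, pinv_comp_assoc]

/-- Pasting: if a symmetric monoidal functor carries one determinant functor to a second and `G`
carries the second to a third, then the composite carries the first to the third. -/
theorem comp_map_compatible {C : Type u} [Category.{v} C] [MonoidalCategory C] {D : Type u'}
    [Category.{v'} D] [MonoidalCategory D] (G : C ⥤ D) [G.LaxMonoidal] {A B L M X Y Z : C}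
    {X' Y' Z' : D} {m : A ⊗ B ⟶ L} {s : L ⟶ M} {y : M ⟶ Y} {z : A ⟶ Z} {x : B ⟶ X}
    {t : Z ⊗ X ⟶ Y} {y' : G.obj Y ⟶ Y'} {z' : G.obj Z ⟶ Z'} {x' : G.obj X ⟶ X'}
    {a : Z' ⊗ X' ⟶ Y'} (h : (m ≫ s) ≫ y = (z ⊗ₘ x) ≫ t)
    (h' : (LaxMonoidal.μ G Z X ≫ G.map t) ≫ y' = (z' ⊗ₘ x') ≫ a) :
    ((LaxMonoidal.μ G A B ≫ G.map m) ≫ G.map s) ≫ G.map y ≫ y' =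
      ((G.map z ≫ z') ⊗ₘ (G.map x ≫ x')) ≫ a := by
  have h₂ := congrArg (fun t => LaxMonoidal.μ G A B ≫ G.map t ≫ y') h
  simp only [Functor.map_comp, assoc] at h₂ h'
  rw [← tensorHom_comp_tensorHom, assoc (_ ⊗ₘ _), ← h', LaxMonoidal.μ_natural_assoc]
  simpa only [assoc] using h₂

end Inverses

/-! ### Consequences of universality in one variable, and the action on determinant functors -/

namespace DetFunctor.IsUniversal

variable {T : Type u} [SmallCategory T] [Preadditive T] [HasZeroObject T]
  [HasShift T ℤ] [∀ n : ℤ, (shiftFunctor T n).Additive] [Pretriangulated T]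
  {V : PicardGroupoid.{u}} {d : DetFunctor T V} {P : PicardGroupoid.{u}}

/-- Restriction of monoidal transformations along a universal determinant functor is bijective. -/
theorem existsUnique (U : d.IsUniversal) {f g : V ⟶ P} (θ : d.post f.functor ⟶ d.post g.functor) :
    ∃! β : f ⟶ g, d.whisker β.natTrans = θ := by
  -- The initial extension `h` of `d.post g` maps to `f` over `θ` and to `g` over the identity. A
  -- transformation restricting to `θ` must be the inverse of the first map followed by the second.
  obtain ⟨h, α, H⟩ := U P (d.post g.functor)
  obtain ⟨δ, hδ, -⟩ := H f θ
  obtain ⟨γ, hγ, uγ⟩ := H g (𝟙 _)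
  have hδ' (x) : δ.natTrans.app (d.functor.obj x) ≫ θ.natTrans.app x = α.natTrans.app x :=
    congrArg (fun t => t.natTrans.app x) hδ
  have hγ' (x) : γ.natTrans.app (d.functor.obj x) = α.natTrans.app x :=
    (comp_id _).symm.trans (congrArg (fun t => t.natTrans.app x) hγ)
  refine ⟨δ.symm ≫ γ, ?_, fun β hβ => ?_⟩
  · ext x
    change δ.symm.natTrans.app (d.functor.obj x) ≫ γ.natTrans.app (d.functor.obj x) = _
    rw [PicardGroupoid.Hom₂.symm_app, hγ' x, ← hδ' x]
    exact pinv_comp_assoc _ _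
  · have : δ ≫ β = γ := uγ _ (by
      ext x
      refine (comp_id _).trans ?_
      rw [← hδ' x, ← hβ]
      rfl)
    rw [← this]
    ext x
    refine Eq.symm ?_
    change δ.symm.natTrans.app x ≫ δ.natTrans.app x ≫ β.natTrans.app x = _
    rw [PicardGroupoid.Hom₂.symm_app]
    exact pinv_comp_assoc _ _

/-- The claim is transferred from the syntactic model. Universality on both sides gives functors to
the model and back whose composite on `V` agrees with the identity along `d`, hence is isomorphic to
it by `existsUnique`; objects of the model are values by `formalDet_essSurj`. -/
theorem essSurj (U : d.IsUniversal) (v : V) : ∃ x, Nonempty (d.functor.obj x ≅ v) := by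
  obtain ⟨f, α, -⟩ := U (freePicard T) (freeDet T)
  obtain ⟨g, α', -⟩ := freeDet_isUniversal V d
  let θ : d.post (f ≫ g).functor ⟶ d.post (PicardGroupoid.Hom.functor (𝟙 V)) :=
    { natTrans := Functor.whiskerRight α.natTrans g.functor ≫ α'.natTrans
      compatible x y z p q r hΔ :=
        (comp_map_compatible g.functor (α.compatible p q r hΔ) (α'.compatible p q r hΔ)).trans
          (congrArg (_ ≫ ·) (id_comp _).symm) }
  obtain ⟨β, -⟩ := U.existsUnique θ
  obtain ⟨x, ⟨e⟩⟩ := formalDet_essSurj (f.functor.obj v)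
  exact ⟨x, ⟨(asIso (α'.natTrans.app x)).symm ≪≫ g.functor.mapIso e ≪≫ asIso (β.natTrans.app v)⟩⟩

theorem natTrans_app_eq (U : d.IsUniversal) {C : Type w} [Category.{w'} C] {F G : V ⥤ C} {σ τ : F ⟶ G}
    (h : ∀ x, σ.app (d.functor.obj x) = τ.app (d.functor.obj x)) (v : V) :
    σ.app v = τ.app v := by
  obtain ⟨x, ⟨e⟩⟩ := U.essSurj v
  rw [← cancel_epi (F.map e.hom), σ.naturality, τ.naturality, h]

/-- A natural transformation between symmetric monoidal functors is monoidal if its restriction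
along a universal determinant functor is compatible with the additivity data. -/
theorem isMonoidal (U : d.IsUniversal) {f g : V ⥤ P} [f.Braided] [g.Braided] (τ : f ⟶ g)
    (h : (d.data.post f).Compatible (d.data.post g) (Functor.whiskerLeft d.functor τ)) :
    NatTrans.IsMonoidal τ := by
  obtain ⟨β, hβ, -⟩ := U.existsUnique (f := ⟨f⟩) (g := ⟨g⟩) ⟨Functor.whiskerLeft d.functor τ, h⟩
  let β' : f ⟶ g := β.natTrans
  have : NatTrans.IsMonoidal β' := β.isMonoidal
  have e : τ = β' := NatTrans.ext (funext (U.natTrans_app_eq fun x =>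
    (congrArg (fun t => t.natTrans.app x) hβ).symm))
  rwa [e]

/-- The symmetric monoidal functor induced by a determinant functor. -/
def lift (U : d.IsUniversal) (E : DetFunctor T P) : V ⟶ P := (U P E).choose

/-- The symmetric monoidal functor induced by a determinant functor extends it. -/
def liftHom (U : d.IsUniversal) (E : DetFunctor T P) : d.post (U.lift E).functor ⟶ E := (U P E).choose_spec.choose

/-- The action of the morphisms between values of a universal determinant functor on the values of
another determinant functor. -/
def act (U : d.IsUniversal) (E : DetFunctor T P) : InducedCategory V d.functor.obj ⥤ P where
  obj x := E.functor.obj x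
  map {x y} f := pinv ((U.liftHom E).natTrans.app x) ≫ (U.lift E).functor.map f.hom ≫
    (U.liftHom E).natTrans.app y
  map_id x := by
    rw [InducedCategory.id_hom, CategoryTheory.Functor.map_id]
    exact (congrArg (_ ≫ ·) (id_comp _)).trans (pinv_comp _)
  map_comp f g := by
    rw [InducedCategory.comp_hom, Functor.map_comp]
    exact conj_comp _ _ _ _ _

/-- The action can be computed with any extension of `E`, because two extensions are related by a
transformation over `E`. The next properties follow by picking a convenient extension. -/
theorem act_map (U : d.IsUniversal) (E : DetFunctor T P) (g : V ⥤ P) [g.Braided] (θ : d.post g ⟶ E)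
    {x y : InducedCategory V d.functor.obj} (f : x ⟶ y) :
    (U.act E).map f = pinv (θ.natTrans.app x) ≫ g.map f.hom ≫ θ.natTrans.app y := by
  obtain ⟨β, hβ, -⟩ := U.existsUnique (f := U.lift E) (g := ⟨g⟩) (U.liftHom E ≫ θ.symm)
  have h (x) : β.natTrans.app (d.functor.obj x) ≫ θ.natTrans.app x =
      (U.liftHom E).natTrans.app x := by
    have : β.natTrans.app (d.functor.obj x) =
      (U.liftHom E).natTrans.app x ≫ pinv (θ.natTrans.app x) :=
        congrArg (fun t => t.natTrans.app x) hβ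
    rw [this]
    exact (assoc _ _ _).trans ((congrArg (_ ≫ ·) (pinv_comp _)).trans (comp_id _))
  exact conj_eq (h x) (h y) (β.natTrans.naturality f.hom)

/-- The lift of `E`, with its comparison followed by `θ`, is also an extension of `E'`. -/
theorem act_naturality (U : d.IsUniversal) {E E' : DetFunctor T P} (θ : E ⟶ E')
    {x y : InducedCategory V d.functor.obj} (f : x ⟶ y) :
    (U.act E).map f ≫ θ.natTrans.app y = θ.natTrans.app x ≫ (U.act E').map f := by
  rw [U.act_map E' (U.lift E).functor (U.liftHom E ≫ θ) f]
  exact conj_comp_eq _ _ _ _ _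

/-- The pointwise sum of the two lifts is an extension of the pointwise sum. -/
theorem act_sum (U : d.IsUniversal) (E E' : DetFunctor T P)
    {x y : InducedCategory V d.functor.obj} (f : x ⟶ y) :
    (U.act (E.sum E')).map f = ((U.act E).map f ⊗ₘ (U.act E').map f) := by
  rw [U.act_map (E.sum E') (sumFunctor (U.lift E).functor (U.lift E').functor)
    (d.postSum _ _ ≫ DetFunctor.sumMap (U.liftHom E) (U.liftHom E')) f]
  refine conj_eq_of_naturality ?_
  have e (x) : (d.postSum (U.lift E).functor (U.lift E').functor ≫
      DetFunctor.sumMap (U.liftHom E) (U.liftHom E')).natTrans.app x =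
        ((U.liftHom E).natTrans.app x ⊗ₘ (U.liftHom E').natTrans.app x) := id_comp _
  rw [e, e]
  refine (tensorHom_comp_tensorHom _ _ _ _).trans (Eq.trans ?_ (tensorHom_comp_tensorHom _ _ _ _).symm)
  congr 1 <;> exact (comp_pinv_assoc _ _).symm

theorem act_map_det (U : d.IsUniversal) (E : DetFunctor T P) {x y : Core T} (e : x ⟶ y) :
    (U.act E).map (InducedCategory.homMk (d.functor.map e)) = E.functor.map e :=
  conj_eq_of_naturality ((U.liftHom E).natTrans.naturality e)

end DetFunctor.IsUniversal

/-! ### Functors on a product category from commuting actions in the single variables -/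

section ProductCategory

variable {ι : Type w} {C : ι → Type u} [∀ i, Category.{v} (C i)]

variable {P : Type u'} [Category.{v'} P]

/-- Compatible actions of the morphisms of the categories `C i` on a family of objects indexed by
tuples: a morphism `p ⟶ q` in `C i` acts as a morphism from `obj x` to `obj y` if `x` and `y` are
tuples with entries `p` and `q` at `i` which agree elsewhere. -/
structure SlotAction (obj : (∀ i, C i) → P) where
  /-- the action -/
  map (i : ι) {x y : ∀ k, C k} (h : ∀ k, k ≠ i → x k = y k) {p q : C i} (hp : x i = p)
    (hq : y i = q) (f : p ⟶ q) : obj x ⟶ obj y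
  map_id (i : ι) (x : ∀ k, C k) {p : C i} (hp : x i = p) :
    map i (x := x) (fun _ _ => rfl) hp hp (𝟙 p) = 𝟙 (obj x)
  map_comp (i : ι) {x y z : ∀ k, C k} (h : ∀ k, k ≠ i → x k = y k) (h' : ∀ k, k ≠ i → y k = z k)
    (h'' : ∀ k, k ≠ i → x k = z k) {p q r : C i} (hp : x i = p) (hq : y i = q) (hr : z i = r)
    (f : p ⟶ q) (g : q ⟶ r) : map i h hp hq f ≫ map i h' hq hr g = map i h'' hp hr (f ≫ g)
  map_comm {i j : ι} (hij : i ≠ j) {x y z t : ∀ k, C k} (hxy : ∀ k, k ≠ i → x k = y k)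
    (hyt : ∀ k, k ≠ j → y k = t k) (hxz : ∀ k, k ≠ j → x k = z k) (hzt : ∀ k, k ≠ i → z k = t k)
    {p q : C i} {r s : C j} (hp : x i = p) (hp' : z i = p) (hq : y i = q) (hq' : t i = q)
    (hr : x j = r) (hr' : y j = r) (hs : z j = s) (hs' : t j = s) (f : p ⟶ q) (g : r ⟶ s) :
    map i hxy hp hq f ≫ map j hyt hr' hs' g = map j hxz hr hs g ≫ map i hzt hp' hq' f

namespace SlotAction

variable {obj : (∀ i, C i) → P} (A : SlotAction obj)

theorem map_eqToHom (i : ι) {x y : ∀ k, C k} (h : ∀ k, k ≠ i → x k = y k) {p q : C i}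
    (hp : x i = p) (hq : y i = q) (e : p = q) (h' : x = y) :
    A.map i h hp hq (eqToHom e) = eqToHom (by rw [h']) := by
  subst e h'
  exact A.map_id i x hp

theorem map_conj (i : ι) {x y : ∀ k, C k} (h : ∀ k, k ≠ i → x k = y k) {p q p' q' : C i}
    (hp : x i = p) (hq : y i = q) (f : p ⟶ q) (ep : p' = p) (eq : q = q') :
    A.map i h (hp.trans ep.symm) (hq.trans eq) (eqToHom ep ≫ f ≫ eqToHom eq) =
      A.map i h hp hq f := by
  subst ep eq
  simp

theorem eqToHom_map_eqToHom (i : ι) {x y x' y' : ∀ k, C k} (h : ∀ k, k ≠ i → x k = y k)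
    {p q : C i} (hp : x i = p) (hq : y i = q) (f : p ⟶ q) (ex : x' = x) (ey : y = y')
    (h' : ∀ k, k ≠ i → x' k = y' k) (hp' : x' i = p) (hq' : y' i = q) :
    eqToHom (congrArg obj ex) ≫ A.map i h hp hq f ≫ eqToHom (congrArg obj ey) =
      A.map i h' hp' hq' f := by
  subst ex ey
  simp

variable [DecidableEq ι]

/-- The action of a morphism of tuples, for the entries in a list. -/
def mapList : (l : List ι) → l.Nodup → {x y : ∀ k, C k} → (∀ k, k ∉ l → x k = y k) →
    {p q : ∀ k, C k} → (∀ k, k ∈ l → x k = p k) → (∀ k, k ∈ l → y k = q k) → (p ⟶ q) →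
    (obj x ⟶ obj y)
  | [], _, _, _, h, _, _, _, _, _ => eqToHom (congrArg obj (funext fun k => h k (by simp)))
  | i :: l, hl, x, y, h, p, q, hp, hq, φ =>
    A.map i (y := Function.update x i (q i)) (fun k hk => by simp [hk]) (hp i (by simp))
        (by simp) (φ i) ≫
      mapList l (List.nodup_cons.1 hl).2 (fun k hk => by
        by_cases hk' : k = i
        · subst hk'; simpa using (hq k (by simp)).symm
        · simpa [hk'] using h k (by simp [hk, hk']))
        (fun k hk => by
          have hk' : k ≠ i := fun e => (List.nodup_cons.1 hl).1 (e ▸ hk)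
          simpa [hk'] using hp k (by simp [hk])) (fun k hk => hq k (by simp [hk])) φ

/-- Iterated `map_comm`: an action in a variable outside the list moves past all variables of the
list. -/
theorem mapList_comm (l : List ι) (hl : l.Nodup) {j : ι} (hj : j ∉ l) {x y z t : ∀ k, C k}
    (hxy : ∀ k, k ∉ l → x k = y k)
    (hyt : ∀ k, k ≠ j → y k = t k) (hxz : ∀ k, k ≠ j → x k = z k) (hzt : ∀ k, k ∉ l → z k = t k)
    {p q : ∀ k, C k} {r s : C j} (hp : ∀ k, k ∈ l → x k = p k) (hp' : ∀ k, k ∈ l → z k = p k)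
    (hq : ∀ k, k ∈ l → y k = q k) (hq' : ∀ k, k ∈ l → t k = q k)
    (hr : x j = r) (hr' : y j = r) (hs : z j = s) (hs' : t j = s) (φ : p ⟶ q) (g : r ⟶ s) :
    A.mapList l hl hxy hp hq φ ≫ A.map j hyt hr' hs' g =
      A.map j hxz hr hs g ≫ A.mapList l hl hzt hp' hq' φ := by
  induction l generalizing x z with
  | nil =>
    obtain rfl : x = y := funext fun k => hxy k (by simp)
    obtain rfl : z = t := funext fun k => hzt k (by simp)
    simp [mapList]
  | cons i l ih =>
    have hij : i ≠ j := fun e => hj (by simp [e])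
    have hjl : j ∉ l := fun e => hj (by simp [e])
    simp only [mapList, assoc]
    rw [ih (List.nodup_cons.1 hl).2 hjl (z := Function.update z i (q i)), ← assoc, ← assoc,
      A.map_comm hij]
    · intro k hk
      by_cases hk' : k = i
      · subst hk'; simp
      · simpa [hk'] using hxz k hk
    · simpa [hij.symm] using hr
    · simpa [hij.symm] using hs

/-- The first entry of `ψ` is moved in front of the remaining entries of `φ` and merged with the
first entry of `φ`; the tails are composed by induction. -/
theorem mapList_comp (l : List ι) (hl : l.Nodup) {x y z : ∀ k, C k}
    (hxy : ∀ k, k ∉ l → x k = y k) (hyz : ∀ k, k ∉ l → y k = z k) (hxz : ∀ k, k ∉ l → x k = z k)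
    {p q r : ∀ k, C k} (hp : ∀ k, k ∈ l → x k = p k) (hq : ∀ k, k ∈ l → y k = q k)
    (hr : ∀ k, k ∈ l → z k = r k) (φ : p ⟶ q) (ψ : q ⟶ r) :
    A.mapList l hl hxy hp hq φ ≫ A.mapList l hl hyz hq hr ψ =
      A.mapList l hl hxz hp hr (φ ≫ ψ) := by
  induction l generalizing x y with
  | nil => simp [mapList]
  | cons i l ih =>
    have hil := (List.nodup_cons.1 hl).1
    simp only [mapList, assoc]
    -- The intermediate tuple is `x` with only its `i`-th entry already carried through both
    -- morphisms.
    rw [← assoc (A.mapList _ _ _ _ _ _), A.mapList_comm l _ hil (z := Function.update x i (r i)),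
      assoc, ih, ← assoc, A.map_comp]
    · rfl
    · intro k hk
      simp [hk]
    · intro k hk
      by_cases hk' : k = i
      · subst hk'; simp
      · simpa [hk'] using hxy k (by simp [hk, hk'])
    · intro k hk
      have hk' : k ≠ i := fun e => hil (e ▸ hk)
      simpa [hk'] using hq k (by simp [hk])
    · simp

theorem mapList_eqToHom (l : List ι) (hl : l.Nodup) {x y : ∀ k, C k}
    (h : ∀ k, k ∉ l → x k = y k) {p q : ∀ k, C k} (hp : ∀ k, k ∈ l → x k = p k)
    (hq : ∀ k, k ∈ l → y k = q k) (φ : p ⟶ q) (hφ : ∀ k, k ∈ l → ∃ e, φ k = eqToHom e)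
    (hxy : x = y) : A.mapList l hl h hp hq φ = eqToHom (congrArg obj hxy) := by
  induction l generalizing x with
  | nil => rfl
  | cons i l ih =>
    obtain ⟨e, he⟩ := hφ i (by simp)
    have hx : x = Function.update x i (q i) := by
      rw [← e, ← hp i (by simp), Function.update_eq_self]
    simp only [mapList, he]
    rw [A.map_eqToHom i _ _ _ _ hx, ih _ _ _ _ (fun k hk => hφ k (by simp [hk]))
      (hx.symm.trans hxy), eqToHom_trans]

/-- Entries that are equalities act as equalities, so only the `i`-th one contributes. In particular
the arbitrary order in which `functor` runs through the variables is invisible here. -/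
theorem mapList_single (l : List ι) (hl : l.Nodup) {x y : ∀ k, C k}
    (h : ∀ k, k ∉ l → x k = y k) {p q : ∀ k, C k} (hp : ∀ k, k ∈ l → x k = p k)
    (hq : ∀ k, k ∈ l → y k = q k) (φ : p ⟶ q) (i : ι) (hi : i ∈ l)
    (hφ : ∀ k, k ∈ l → k ≠ i → ∃ e, φ k = eqToHom e) (h' : ∀ k, k ≠ i → x k = y k) :
    A.mapList l hl h hp hq φ = A.map i h' (hp i hi) (hq i hi) (φ i) := by
  induction l generalizing x with
  | nil => simp at hi
  | cons j l ih =>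
    have hjl := (List.nodup_cons.1 hl).1
    simp only [mapList]
    by_cases hj : j = i
    · subst hj
      have hy : Function.update x j (q j) = y := by
        funext k
        by_cases hk : k = j
        · subst hk; simpa using (hq k (by simp)).symm
        · simpa [hk] using h' k hk
      rw [A.mapList_eqToHom l _ _ _ _ _ (fun k hk => hφ k (by simp [hk])
        (fun e => hjl (e ▸ hk))) hy]
      simpa using A.eqToHom_map_eqToHom j _ _ _ (φ j) rfl hy h' (hp j (by simp)) (hq j (by simp))
    · obtain ⟨e, he⟩ := hφ j (by simp) hj
      have hx : x = Function.update x j (q j) := by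
        rw [← e, ← hp j (by simp), Function.update_eq_self]
      have hi' : i ∈ l := by simpa [Ne.symm hj] using hi
      rw [he, A.map_eqToHom j _ _ _ _ hx, ih (List.nodup_cons.1 hl).2 _ _ _ hi'
        (fun k hk => hφ k (by simp [hk])) (fun k hk => by rw [← hx]; exact h' k hk)]
      simpa using A.eqToHom_map_eqToHom i _ _ _ (φ i) hx rfl h' (hp i hi) (hq i hi)

variable [Fintype ι]

/-- The functor on the product category given by compatible actions. -/
@[simps obj]
def functor : (∀ i, C i) ⥤ P where
  obj := obj
  map {x y} φ := A.mapList Finset.univ.toList (Finset.nodup_toList _)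
    (fun k hk => absurd (by simp) hk) (fun _ _ => rfl) (fun _ _ => rfl) φ
  map_id x := A.mapList_eqToHom _ _ _ _ _ _ (fun k _ => ⟨rfl, rfl⟩) rfl
  map_comp φ ψ := (A.mapList_comp _ _ _ _ _ _ _ _ φ ψ).symm

theorem functor_map {x y : ∀ k, C k} (φ : x ⟶ y) (i : ι) (h : ∀ k, k ≠ i → x k = y k)
    (hφ : ∀ k, (hk : k ≠ i) → φ k = eqToHom (h k hk)) :
    A.functor.map φ = A.map i h rfl rfl (φ i) :=
  A.mapList_single _ _ _ _ _ φ i (by simp) (fun k _ hk => ⟨_, hφ k hk⟩) h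

theorem functor_map_of_conj {x y : ∀ k, C k} (φ : x ⟶ y) (i : ι) (h : ∀ k, k ≠ i → x k = y k)
    (hφ : ∀ k, (hk : k ≠ i) → φ k = eqToHom (h k hk)) {p q : C i} (hp : x i = p) (hq : y i = q)
    (f : p ⟶ q) (hf : φ i = eqToHom hp ≫ f ≫ eqToHom hq.symm) :
    A.functor.map φ = A.map i h hp hq f := by
  rw [A.functor_map φ i h hφ, hf]
  exact A.map_conj i h hp hq f hp hq.symm

theorem functor_map_updHom (a : ∀ k, C k) (i : ι) {p q : C i} (f : p ⟶ q) :
    A.functor.map (updHom i (fun k _ => 𝟙 (a k)) f) =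
      A.map i (fun k hk => by simp [hk]) (Function.update_self i p a)
        (Function.update_self i q a) f :=
  A.functor_map_of_conj _ i _ (fun k hk => by simp [updHom_of_ne _ _ _ hk]) _ _ f
    (updHom_self i _ f)

end SlotAction

/-- Morphisms in a product category are composites of morphisms which change one entry. -/
theorem pi_hom_induction [DecidableEq ι] [Finite ι] {Q : ∀ {x y : ∀ k, C k}, (x ⟶ y) → Prop}
    (id : ∀ x : ∀ k, C k, Q (𝟙 x))
    (comp : ∀ {x y z : ∀ k, C k} (φ : x ⟶ y) (ψ : y ⟶ z), Q φ → Q ψ → Q (φ ≫ ψ))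
    (single : ∀ (i : ι) (a : ∀ k, C k) {p q : C i} (f : p ⟶ q),
      Q (updHom i (fun k _ => 𝟙 (a k)) f)) {x y : ∀ k, C k} (φ : x ⟶ y) : Q φ := by
  have hQ {x y : ∀ k, C k} (e : x = y) : Q (eqToHom e) := by subst e; exact id x
  -- Induction on a list of the entries in which `φ` is allowed to differ from an equality; each
  -- step splits off one entry.
  have key (l : List ι) : ∀ {x y : ∀ k, C k} (φ : x ⟶ y),
      (∀ k, k ∉ l → ∃ e : x k = y k, φ k = eqToHom e) → Q φ := by
    induction l with
    | nil =>
      intro x y φ h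
      obtain rfl : x = y := funext fun k => (h k (by simp)).choose
      have : φ = 𝟙 x := funext fun k => (h k (by simp)).choose_spec
      rw [this]
      exact id x
    | cons i l ih =>
      intro x y φ h
      have e : φ = (eqToHom (Function.update_eq_self i x).symm ≫
          updHom i (fun k _ => 𝟙 (x k)) (φ i)) ≫
          (updHom i (fun k _ => φ k) (𝟙 (y i)) ≫ eqToHom (Function.update_eq_self i y)) := by
        rw [assoc, ← assoc (updHom _ _ _), updHom_comp]
        funext k
        rw [Pi.comp_apply, Pi.comp_apply]
        by_cases hk : k = i
        · subst hk
          simp [updHom_self]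
        · simp [updHom_of_ne _ _ _ hk]
      rw [e]
      refine comp _ _ (comp _ _ (hQ _) (single _ _ _)) (comp _ _ (ih _ fun k hk => ?_) (hQ _))
      by_cases hk' : k = i
      · subst hk'
        exact ⟨by simp, by simp [updHom_self]⟩
      · obtain ⟨e, he⟩ := h k (by simp [hk, hk'])
        exact ⟨by simp [hk', e], by simp [updHom_of_ne _ _ _ hk', he]⟩
  obtain ⟨_⟩ := nonempty_fintype ι
  exact key Finset.univ.toList φ (fun k hk => absurd (by simp) hk)

end ProductCategory

/-! ### Operations in one variable as natural transformations in another -/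

section SlotOperations

variable {ι : Type w} [DecidableEq ι] {C : ι → Type u} [∀ i, Category.{v} (C i)]

section

variable {P : Type u'} [Category.{v'} P] {F : (∀ k, C k) ⥤ P}

theorem swap_comp_swap {i j : ι} (h : i ≠ j) (a : ∀ k, C k) (x : C i) (y : C j) :
    swap h a x y ≫ swap h.symm a y x = 𝟙 _ := by
  simp [swap]

theorem map_swap_comp_map_swap {i j : ι} (h : i ≠ j) (a : ∀ k, C k) (x : C i) (y : C j) :
    F.map (swap h a x y) ≫ F.map (swap h.symm a y x) = 𝟙 _ := by
  rw [← F.map_comp, swap_comp_swap, F.map_id]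

theorem map_slot_comp_swap {i j : ι} (h : i ≠ j) (a : ∀ k, C k) (u : C i) {v v' : C j}
    (g : v ⟶ v') : F.map (updHom j (fun k _ => 𝟙 (Function.update a i u k)) g) ≫
      F.map (swap h a u v') = F.map (swap h a u v) ≫
        F.map (updHom i (fun k _ => updHom j (fun k _ => 𝟙 (a k)) g k) (𝟙 u)) := by
  rw [← F.map_comp, ← F.map_comp, ← updHom_swap h (fun k => 𝟙 (a k)) (𝟙 u) g, updHom_eq_of_id]

theorem map_updHom_comp_swap {i j : ι} (h : i ≠ j) (a : ∀ k, C k) (u : C i) {v v' : C j}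
    (g : v ⟶ v') :
    F.map (updHom i (fun k _ => updHom j (fun k _ => 𝟙 (a k)) g k) (𝟙 u)) ≫
      F.map (swap h.symm a v' u) = F.map (swap h.symm a v u) ≫
        F.map (updHom j (fun k _ => 𝟙 (Function.update a i u k)) g) := by
  rw [← F.map_comp, ← F.map_comp, updHom_swap h.symm (fun k => 𝟙 (a k)) g (𝟙 u), updHom_eq_of_id]

variable [MonoidalCategory P]

theorem natural_of_swap {A B A' B' L M N A₁ B₁ A₁' B₁' L' : P} {f : A ⟶ A'} {g : B ⟶ B'}
    {s : A' ⟶ A₁'} {t : B' ⟶ B₁'} {s' : A ⟶ A₁} {t' : B ⟶ B₁} {f' : A₁ ⟶ A₁'} {g' : B₁ ⟶ B₁'}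
    {m' : A₁' ⊗ B₁' ⟶ M} {m : A₁ ⊗ B₁ ⟶ L} {q : L ⟶ M} {r : M ⟶ N} {r' : L ⟶ L'} {q' : L' ⟶ N}
    (h₁ : f ≫ s = s' ≫ f') (h₂ : g ≫ t = t' ≫ g') (h : m ≫ q = (f' ⊗ₘ g') ≫ m')
    (h₃ : q ≫ r = r' ≫ q') :
    (f ⊗ₘ g) ≫ (s ⊗ₘ t) ≫ m' ≫ r = ((s' ⊗ₘ t') ≫ m ≫ r') ≫ q' := by
  rw [tensorHom_comp_tensorHom_assoc, h₁, h₂, ← tensorHom_comp_tensorHom_assoc, ← reassoc_of% h,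
    h₃, assoc, assoc]

/-- An operation in the `i`-th variable, regarded as a natural transformation of functors in the
`j`-th variable. -/
def SlotOp.transpose {i j : ι} (h : i ≠ j) {z x y : C i} (m : SlotOp F i z x y) (hm : m.IsNatural)
    (a : ∀ k, C k) :
    sumFunctor (slot (Function.update a i z) j ⋙ F) (slot (Function.update a i x) j ⋙ F) ⟶
      slot (Function.update a i y) j ⋙ F where
  app v := (F.map (swap h a z v) ⊗ₘ F.map (swap h a x v)) ≫ m (Function.update a j v) ≫
    F.map (swap h.symm a v y)
  naturality v v' g := by
    exact natural_of_swap (map_slot_comp_swap h a z g) (map_slot_comp_swap h a x g)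
      (hm _ _ (fun k _ => updHom j (fun k _ => 𝟙 (a k)) g k)) (map_updHom_comp_swap h a y g)

/-- Transport of an operation along morphisms of its arguments and its value. -/
def SlotOp.conj {i : ι} {z x y z' x' y' : C i} (m : SlotOp F i z x y) (ez : z' ⟶ z) (ex : x' ⟶ x)
    (ey : y ⟶ y') : SlotOp F i z' x' y' :=
  fun a => (F.map (updHom i (fun k _ => 𝟙 (a k)) ez) ⊗ₘ F.map (updHom i (fun k _ => 𝟙 (a k)) ex)) ≫
    m a ≫ F.map (updHom i (fun k _ => 𝟙 (a k)) ey)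

theorem SlotOp.IsNatural.conj {i : ι} {z x y z' x' y' : C i} {m : SlotOp F i z x y}
    (hm : m.IsNatural) (ez : z' ⟶ z) (ex : x' ⟶ x) (ey : y ⟶ y') :
    (m.conj ez ex ey).IsNatural := by
  intro a b φ
  simp only [SlotOp.conj, assoc, ← F.map_comp, updHom_comp, id_comp, comp_id]
  rw [tensorHom_comp_tensorHom_assoc]
  simp only [← F.map_comp, updHom_comp, id_comp, comp_id]
  have e₁ (u u' : C i) (f : u ⟶ u') : updHom i φ f = updHom i (fun k _ => 𝟙 (a k)) f ≫
      updHom i φ (𝟙 u') := by simp [updHom_comp]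
  have e₂ : updHom i φ ey = updHom i φ (𝟙 y) ≫ updHom i (fun k _ => 𝟙 (b k)) ey := by
    simp [updHom_comp]
  rw [e₂, e₁ _ _ ez, e₁ _ _ ex]
  simp only [F.map_comp]
  rw [reassoc_of% hm a b φ, ← tensorHom_comp_tensorHom_assoc]

end

section

variable {P : Type u'} [Category.{v'} P] [MonoidalCategory P] [SymmetricCategory P]
  {F : (∀ k, C k) ⥤ P}

/-- The exchanges of two variables are isomorphisms and pass through `tensorμ` by naturality, so
they can be moved from one side of the interchange law to the other. -/
theorem interchange_key {A₁ A₂ A₃ A₄ B₁ B₂ B₃ B₄ M N M' N' K L Z : P} {s₁ : A₁ ⟶ B₁} {s₂ : A₂ ⟶ B₂}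
    {s₃ : A₃ ⟶ B₃} {s₄ : A₄ ⟶ B₄} {t₁ : B₁ ⟶ A₁} {t₂ : B₂ ⟶ A₂} {t₃ : B₃ ⟶ A₃} {t₄ : B₄ ⟶ A₄}
    (h₁ : s₁ ≫ t₁ = 𝟙 _) (h₂ : s₂ ≫ t₂ = 𝟙 _) (h₃ : s₃ ≫ t₃ = 𝟙 _) (h₄ : s₄ ≫ t₄ = 𝟙 _)
    (h₁' : t₁ ≫ s₁ = 𝟙 _) (h₂' : t₂ ≫ s₂ = 𝟙 _) (h₃' : t₃ ≫ s₃ = 𝟙 _) (h₄' : t₄ ≫ s₄ = 𝟙 _)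
    {m : A₁ ⊗ A₂ ⟶ M} {n : A₃ ⊗ A₄ ⟶ N} {p : M ⟶ M'} {q : N ⟶ N'} {r : M' ⊗ N' ⟶ Z}
    {m' : B₁ ⊗ B₃ ⟶ K} {n' : B₂ ⊗ B₄ ⟶ L} {τ : K ⊗ L ⟶ Z} :
    (m ⊗ₘ n) ≫ (p ⊗ₘ q) ≫ r =
        tensorμ A₁ A₂ A₃ A₄ ≫ ((s₁ ⊗ₘ s₃) ⊗ₘ (s₂ ⊗ₘ s₄)) ≫ (m' ⊗ₘ n') ≫ τ ↔
      (tensorμ B₁ B₂ B₃ B₄ ≫ (m' ⊗ₘ n')) ≫ τ =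
        (((t₁ ⊗ₘ t₂) ≫ m ≫ p) ⊗ₘ ((t₃ ⊗ₘ t₄) ≫ n ≫ q)) ≫ r := by
  have hs : ((s₁ ⊗ₘ s₂) ⊗ₘ (s₃ ⊗ₘ s₄)) ≫ ((t₁ ⊗ₘ t₂) ⊗ₘ (t₃ ⊗ₘ t₄)) = 𝟙 _ := by
    simp only [tensorHom_comp_tensorHom, h₁, h₂, h₃, h₄, id_tensorHom_id]
  have ht : ((t₁ ⊗ₘ t₂) ⊗ₘ (t₃ ⊗ₘ t₄)) ≫ ((s₁ ⊗ₘ s₂) ⊗ₘ (s₃ ⊗ₘ s₄)) = 𝟙 _ := by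
    simp only [tensorHom_comp_tensorHom, h₁', h₂', h₃', h₄', id_tensorHom_id]
  have e := tensorμ_natural s₁ s₂ s₃ s₄
  rw [← tensorHom_comp_tensorHom, ← tensorHom_comp_tensorHom, assoc, assoc, assoc]
  constructor
  · intro H
    rw [H, ← reassoc_of% e, reassoc_of% ht]
  · intro H
    rw [← reassoc_of% e, H, reassoc_of% hs]

/-- Two operations commute if and only if the natural transformation given by the first is
compatible with the second. -/
theorem SlotOp.interchange_iff {i j : ι} {h : i ≠ j}
    {z x y : C i} {z' x' y' : C j} {m : SlotOp F i z x y} (hm : m.IsNatural)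
    {m' : SlotOp F j z' x' y'} :
    SlotOp.Interchange h m m' ↔ ∀ a,
      (tensorμ (F.obj (Function.update (Function.update a i z) j z'))
        (F.obj (Function.update (Function.update a i x) j z'))
        (F.obj (Function.update (Function.update a i z) j x'))
        (F.obj (Function.update (Function.update a i x) j x')) ≫
        (m' (Function.update a i z) ⊗ₘ m' (Function.update a i x))) ≫
          (m.transpose h hm a).app y' =
      ((m.transpose h hm a).app z' ⊗ₘ (m.transpose h hm a).app x') ≫
        m' (Function.update a i y) :=
  forall_congr' fun a => interchange_key
    (map_swap_comp_map_swap h.symm a z' z) (map_swap_comp_map_swap h.symm a z' x)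
    (map_swap_comp_map_swap h.symm a x' z) (map_swap_comp_map_swap h.symm a x' x)
    (map_swap_comp_map_swap h a z z') (map_swap_comp_map_swap h a x z')
    (map_swap_comp_map_swap h a z x') (map_swap_comp_map_swap h a x x')

end

end SlotOperations

/-! ### The action of morphisms between values in one variable of a multi-determinant functor -/

section Extension

variable {ι : Type} [DecidableEq ι]
  {T : ι → Type u} [∀ i, SmallCategory (T i)] [∀ i, Preadditive (T i)]
  [∀ i, HasZeroObject (T i)] [∀ i, HasShift (T i) ℤ]
  [∀ i, ∀ n : ℤ, (shiftFunctor (T i) n).Additive] [∀ i, Pretriangulated (T i)]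
  {P : PicardGroupoid.{u}}

namespace MultiDet

variable (D : MultiDet T P)

/-- The determinant functor given by a multi-determinant functor in one variable. -/
def inSlot (i : ι) (a : ∀ k, Core (T k)) : DetFunctor (T i) P :=
  ⟨slot a i ⋙ D.functor, D.data i a⟩

/-- The additivity data of a triangle in one variable, for all values of the others. -/
def slotAdd (i : ι) {x y z : T i} (f : x ⟶ y) (g : y ⟶ z) (h : z ⟶ x⟦(1 : ℤ)⟧)
    (hΔ : Triangle.mk f g h ∈ distTriang (T i)) : SlotOp D.functor i ⟨z⟩ ⟨x⟩ ⟨y⟩ :=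
  fun a => (D.data i a).add f g h hΔ

/-- The morphism of determinant functors in one variable given by morphisms in the others. -/
def inSlotMap (i : ι) {a b : ∀ k, Core (T k)} (φ : ∀ k, k ≠ i → (a k ⟶ b k)) :
    D.inSlot i a ⟶ D.inSlot i b where
  natTrans :=
    { app x := D.functor.map (updHom i φ (𝟙 x))
      naturality x y f := by
        change D.functor.map _ ≫ _ = _ ≫ D.functor.map _
        rw [← D.functor.map_comp, ← D.functor.map_comp, updHom_comp, updHom_comp]
        simp }
  compatible x y z f g h hΔ := D.triangle_function i f g h hΔ a b φ

/-- The additivity data of a triangle in the `i`-th variable, as a morphism of determinant functors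
in the `j`-th variable. -/
def slotAddHom {i j : ι} (hij : i ≠ j) (a : ∀ k, Core (T k)) {x y z : T i} (f : x ⟶ y) (g : y ⟶ z)
    (h : z ⟶ x⟦(1 : ℤ)⟧) (hΔ : Triangle.mk f g h ∈ distTriang (T i)) :
    (D.inSlot j (Function.update a i ⟨z⟩)).sum (D.inSlot j (Function.update a i ⟨x⟩)) ⟶
      D.inSlot j (Function.update a i ⟨y⟩) where
  natTrans := (D.slotAdd i f g h hΔ).transpose hij (D.triangle_function i f g h hΔ) a
  compatible _ _ _ f' g' h' hΔ' :=
    (SlotOp.interchange_iff (D.triangle_function i f g h hΔ)).1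
      (D.two_triangles hij f g h hΔ f' g' h' hΔ') a

variable {V : ι → PicardGroupoid.{u}} {det : ∀ i, DetFunctor (T i) (V i)}
  (U : ∀ i, (det i).IsUniversal)

/-- The action of morphisms between values of universal determinants in one variable. -/
def slotAct (i : ι) (a : ∀ k, Core (T k)) :
    InducedCategory (V i) (det i).functor.obj ⥤ P := (U i).act (D.inSlot i a)

theorem slotAct_naturality (i : ι) {a b : ∀ k, Core (T k)} (φ : ∀ k, k ≠ i → (a k ⟶ b k))
    {p q : InducedCategory (V i) (det i).functor.obj} (f : p ⟶ q) :
    (D.slotAct U i a).map f ≫ D.functor.map (updHom i φ (CategoryStruct.id (obj := Core (T i)) q)) =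
      D.functor.map (updHom i φ (CategoryStruct.id (obj := Core (T i)) p)) ≫ (D.slotAct U i b).map f :=
  (U i).act_naturality (D.inSlotMap i φ) f

theorem natural_of_conj {A A' E E' A₁ A₁' L L' : P} {f : A ⟶ A'} {s : A' ⟶ A₁'}
    {s' : A ⟶ A₁} {f' : A₁ ⟶ A₁'} {g : A₁ ⟶ L} {g' : A₁' ⟶ L'} {h : L ⟶ L'} {r : L ⟶ E}
    {r' : L' ⟶ E'} {k : E ⟶ E'} (h₁ : f ≫ s = s' ≫ f') (h₂ : g ≫ h = f' ≫ g')
    (h₃ : h ≫ r' = r ≫ k) : f ≫ s ≫ g' ≫ r' = (s' ≫ g ≫ r) ≫ k := by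
  rw [reassoc_of% h₁, ← reassoc_of% h₂, h₃, assoc, assoc]

theorem compatible_of_conj {A B A' B' E E' A₁ B₁ A₁' B₁' L L' : P} {m : A ⊗ B ⟶ E}
    {m' : A' ⊗ B' ⟶ E'} {s : A₁ ⟶ A} {s₁ : A ⟶ A₁} {t : B₁ ⟶ B} {t₁ : B ⟶ B₁} {s' : A₁' ⟶ A'}
    {t' : B₁' ⟶ B'} {f : A₁ ⟶ A₁'} {g : B₁ ⟶ B₁'} {q : E ⟶ L} {q' : E' ⟶ L'} {q₁ : L' ⟶ E'}
    {k : L ⟶ L'} (h₁ : s₁ ≫ s = 𝟙 _) (h₂ : t₁ ≫ t = 𝟙 _) (h₃ : q' ≫ q₁ = 𝟙 _)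
    (h : (f ⊗ₘ g) ≫ ((s' ⊗ₘ t') ≫ m' ≫ q') = ((s ⊗ₘ t) ≫ m ≫ q) ≫ k) :
    m ≫ q ≫ k ≫ q₁ = ((s₁ ≫ f ≫ s') ⊗ₘ (t₁ ≫ g ≫ t')) ≫ m' := by
  have := congrArg (fun u => (s₁ ⊗ₘ t₁) ≫ u ≫ q₁) h
  simp only [assoc, h₃, comp_id] at this
  simp only [tensorHom_comp_tensorHom_assoc, h₁, h₂, id_tensorHom_id, id_comp] at this
  exact this.symm

/-- The action of a morphism between values of universal determinants in the `j`-th variable, as a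
morphism of determinant functors in the `i`-th variable. -/
def slotActHom {i j : ι} (hij : i ≠ j) (a : ∀ k, Core (T k))
    {r s : InducedCategory (V j) (det j).functor.obj} (g : r ⟶ s) :
    D.inSlot i (Function.update a j r) ⟶ D.inSlot i (Function.update a j s) where
  natTrans :=
    { app t := D.functor.map (swap (C := fun k => Core (T k)) hij.symm a r t) ≫
        (D.slotAct U j (Function.update a i t)).map g ≫
          D.functor.map (swap (C := fun k => Core (T k)) hij a t s)
      naturality t t' e := natural_of_conj
        (map_slot_comp_swap (F := D.functor) hij.symm a r e)
        (D.slotAct_naturality U j (fun k _ => updHom i (fun k _ => 𝟙 (a k)) e k) g)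
        (map_updHom_comp_swap (F := D.functor) hij.symm a s e) }
  compatible x y z f k h hΔ := by
    -- The two triangles axiom enters here: the triangle in the `i`-th variable gives a morphism of
    -- determinant functors in the `j`-th one, with which the action of `g` commutes. Its source is
    -- a sum, on which `g` acts summand by summand.
    have := (U j).act_naturality (D.slotAddHom hij a f k h hΔ) g
    rw [(U j).act_sum] at this
    exact compatible_of_conj (map_swap_comp_map_swap hij.symm a _ _)
      (map_swap_comp_map_swap hij.symm a _ _) (map_swap_comp_map_swap hij.symm a _ _) this

theorem updHom_eqToHom {C : ι → Type u} [∀ i, Category.{v} (C i)] {a b : ∀ k, C k} (i : ι)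
    (h : ∀ k, k ≠ i → a k = b k) (x : C i) :
    updHom i (fun k hk => eqToHom (h k hk)) (𝟙 x) = eqToHom (by
      funext k
      by_cases hk : k = i
      · subst hk; simp
      · simp [hk, h k hk]) := by
  funext k
  by_cases hk : k = i
  · subst hk; simp [updHom_self]
  · simp [updHom_of_ne _ _ _ hk]

/-- The `i`-th entry of the tuple is a dummy. The triangle-function axiom for equality morphisms in
the other entries shows that the action ignores it. -/
theorem slotAct_congr (i : ι) {a b : ∀ k, Core (T k)} (h : ∀ k, k ≠ i → a k = b k)
    {p q : InducedCategory (V i) (det i).functor.obj} (f : p ⟶ q) {X Y : P}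
    (e₁ : X = D.functor.obj (Function.update a i p))
    (e₁' : D.functor.obj (Function.update a i q) = Y)
    (e₂ : X = D.functor.obj (Function.update b i p))
    (e₂' : D.functor.obj (Function.update b i q) = Y) :
    eqToHom e₁ ≫ (D.slotAct U i a).map f ≫ eqToHom e₁' =
      eqToHom e₂ ≫ (D.slotAct U i b).map f ≫ eqToHom e₂' := by
  have := D.slotAct_naturality U i (fun k hk => eqToHom (h k hk)) f
  rw [updHom_eqToHom, updHom_eqToHom, eqToHom_map, eqToHom_map] at this
  have key : ∀ {X Y A B A' B' : P} (f : A ⟶ B) (g : A' ⟶ B') (p : B = B') (q : A = A')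
    (e₁ : X = A) (e₁' : B = Y) (e₂ : X = A') (e₂' : B' = Y), f ≫ eqToHom p = eqToHom q ≫ g →
    eqToHom e₁ ≫ f ≫ eqToHom e₁' = eqToHom e₂ ≫ g ≫ eqToHom e₂' := by
    intro X Y A B A' B' f g p q e₁ e₁' e₂ e₂' h
    subst p q e₁ e₁'
    simpa using h
  exact key _ _ _ _ _ _ _ _ this

end MultiDet

end Extension

/-! ### Commutation of the actions in different variables -/

section Values

variable {ι : Type} [DecidableEq ι]
  {T : ι → Type u} [∀ i, SmallCategory (T i)] [∀ i, Preadditive (T i)]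
  [∀ i, HasZeroObject (T i)] [∀ i, HasShift (T i) ℤ]
  [∀ i, ∀ n : ℤ, (shiftFunctor (T i) n).Additive] [∀ i, Pretriangulated (T i)]
  {P : PicardGroupoid.{u}}
  {V : ι → PicardGroupoid.{u}} {det : ∀ i, DetFunctor (T i) (V i)}

/-- The category of values of a determinant functor. -/
abbrev DetValues (det : ∀ i, DetFunctor (T i) (V i)) (i : ι) :=
  InducedCategory (V i) (det i).functor.obj

namespace MultiDet

theorem eq_update_of_eq {C : ι → Type u} {i : ι} {x y : ∀ k, C k} (h : ∀ k, k ≠ i → x k = y k)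
    {q : C i} (hq : y i = q) : Function.update x i q = y := by
  funext k
  by_cases hk : k = i
  · subst hk; simpa using hq.symm
  · simpa [hk] using h k hk

variable (D : MultiDet T P) (U : ∀ i, (det i).IsUniversal)

/-- The morphisms between values of universal determinants act on a multi-determinant functor. -/
def slotActMap (i : ι) {x y : ∀ k, DetValues det k} (h : ∀ k, k ≠ i → x k = y k)
    {p q : DetValues det i} (hp : x i = p) (hq : y i = q) (f : p ⟶ q) :
    D.functor.obj x ⟶ D.functor.obj y :=
  eqToHom (congrArg D.functor.obj (eq_update_of_eq (fun _ _ => rfl) hp).symm) ≫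
    (D.slotAct U i x).map f ≫ eqToHom (congrArg D.functor.obj (eq_update_of_eq h hq))

theorem slotActMap_eq (i : ι) {x y : ∀ k, DetValues det k} (h : ∀ k, k ≠ i → x k = y k)
    {p q : DetValues det i} (hp : x i = p) (hq : y i = q) (f : p ⟶ q) (a : ∀ k, Core (T k))
    (ha : ∀ k, k ≠ i → x k = a k)
    (e : D.functor.obj x = D.functor.obj (Function.update a i p))
    (e' : D.functor.obj (Function.update a i q) = D.functor.obj y) :
    D.slotActMap U i h hp hq f = eqToHom e ≫ (D.slotAct U i a).map f ≫ eqToHom e' :=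
  D.slotAct_congr U i ha f _ _ _ _

/-- The morphisms between values of universal determinants act on a multi-determinant functor. -/
def slotAction : SlotAction (C := DetValues det) (fun x => D.functor.obj x) where
  map := D.slotActMap U
  map_id i x p hp := by
    have key : ∀ {A B : P} (f : B ⟶ B) (e : A = B), f = 𝟙 B →
      eqToHom e ≫ f ≫ eqToHom e.symm = 𝟙 A := by
      rintro A B f rfl rfl; simp
    exact key _ _ ((D.slotAct U i x).map_id p)
  map_comp i x y z h h' h'' p q r hp hq hr f g := by
    rw [D.slotActMap_eq U i h' hq hr g x (fun k hk => (h k hk).symm)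
      (congrArg D.functor.obj (eq_update_of_eq h hq).symm)
      (congrArg D.functor.obj (eq_update_of_eq h'' hr))]
    have key : ∀ {A B B' C C' E : P} (f : B ⟶ C) (g : C ⟶ E) (k : B ⟶ E) (e : A = B)
      (e' : C = C') (e'' : E = B'), k = f ≫ g →
      (eqToHom e ≫ f ≫ eqToHom e') ≫ eqToHom e'.symm ≫ g ≫ eqToHom e'' =
        eqToHom e ≫ k ≫ eqToHom e'' := by
      rintro A B B' C C' E f g k rfl rfl rfl rfl; simp
    exact key _ _ _ _ _ _ ((D.slotAct U i x).map_comp f g)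
  map_comm {i j} hij x y z t hxy hyt hxz hzt p q r s hp hp' hq hq' hr hr' hs hs' f g := by
    -- This is the commutation of the two actions; the rest transports it along equalities between
    -- updated tuples.
    have key := (U i).act_naturality (D.slotActHom U hij x g) f
    have ey : Function.update x i q = y := eq_update_of_eq hxy hq
    have ez : Function.update x j s = z := eq_update_of_eq hxz hs
    have ex : Function.update x j r = x := eq_update_of_eq (fun _ _ => rfl) hr
    have ex' : Function.update x i p = x := eq_update_of_eq (fun _ _ => rfl) hp
    have et : Function.update y j s = t := eq_update_of_eq hyt hs'
    have et' : Function.update z i q = t := eq_update_of_eq hzt hq'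
    rw [D.slotActMap_eq U i hxy hp hq f (Function.update x j r) (fun k _ => congrFun ex.symm k)
        (congrArg D.functor.obj (by rw [ex, ex'])) (congrArg D.functor.obj (by rw [ex, ey])),
      D.slotActMap_eq U j hyt hr' hs' g (Function.update x i q) (fun k _ => congrFun ey.symm k)
        (congrArg D.functor.obj (by rw [ey, eq_update_of_eq (fun _ _ => rfl) hr']))
        (congrArg D.functor.obj (by rw [ey, et])),
      D.slotActMap_eq U j hxz hr hs g (Function.update x i p) (fun k _ => congrFun ex'.symm k)
        (congrArg D.functor.obj (by rw [ex', ex])) (congrArg D.functor.obj (by rw [ex', ez])),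
      D.slotActMap_eq U i hzt hp' hq' f (Function.update x j s) (fun k _ => congrFun ez.symm k)
        (congrArg D.functor.obj (by rw [ez, eq_update_of_eq (fun _ _ => rfl) hp']))
        (congrArg D.functor.obj (by rw [ez, et']))]
    have abs : ∀ {A₁ A₂ B₁ B₂ E₁ E₂ G₁ G₂ X Y Z W : P} {f₁ : A₁ ⟶ A₂} {g₁ : B₁ ⟶ B₂}
        {g₂ : E₁ ⟶ E₂} {f₂ : G₁ ⟶ G₂} (p₁ : X = A₁) (p₂ : A₂ = Y) (p₃ : Y = B₁) (p₄ : B₂ = W)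
        (p₅ : X = E₁) (p₆ : E₂ = Z) (p₇ : Z = G₁) (p₈ : G₂ = W) (q₁ : A₂ = B₁) (q₂ : B₂ = G₂)
        (q₃ : A₁ = E₁) (q₄ : E₂ = G₁),
        f₁ ≫ eqToHom q₁ ≫ g₁ ≫ eqToHom q₂ = (eqToHom q₃ ≫ g₂ ≫ eqToHom q₄) ≫ f₂ →
        (eqToHom p₁ ≫ f₁ ≫ eqToHom p₂) ≫ eqToHom p₃ ≫ g₁ ≫ eqToHom p₄ =
          (eqToHom p₅ ≫ g₂ ≫ eqToHom p₆) ≫ eqToHom p₇ ≫ f₂ ≫ eqToHom p₈ := by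
      intro A₁ A₂ B₁ B₂ E₁ E₂ G₁ G₂ X Y Z W f₁ g₁ g₂ f₂ p₁ p₂ p₃ p₄ p₅ p₆ p₇ p₈ q₁ q₂ q₃ q₄ h
      subst p₁ p₃ p₂ p₄ p₇ p₆ p₅ p₈
      simpa using h
    have hs₁ : ∀ (a : ∀ k, Core (T k)) {i j : ι} (h : i ≠ j) (x y), D.functor.map (swap h a x y) =
      eqToHom (congrArg D.functor.obj (Function.update_comm h x y a)) := fun a _ _ h x y =>
      eqToHom_map D.functor _
    refine abs _ _ _ _ _ _ _ _ (congrArg D.functor.obj (Function.update_comm hij.symm r q x))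
      (congrArg D.functor.obj (Function.update_comm hij q s x))
      (congrArg D.functor.obj (Function.update_comm hij.symm r p x))
      (congrArg D.functor.obj (Function.update_comm hij p s x)) ?_
    refine Eq.trans ?_ (key.trans ?_)
    · exact congrArg (_ ≫ ·) (congr (congrArg _ (hs₁ x hij.symm r q).symm)
        (congrArg (_ ≫ ·) (hs₁ x hij q s).symm))
    · exact congrArg (· ≫ _) (congr (congrArg _ (hs₁ x hij.symm r p))
        (congrArg (_ ≫ ·) (hs₁ x hij p s)))

end MultiDet

end Values

/-! ### Testing naturality of an operation on one entry at a time -/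

section NaturalOperations

variable {ι : Type w} [DecidableEq ι] [Finite ι] {C : ι → Type u} [∀ i, Category.{v} (C i)]
  {P : Type u'} [Category.{v'} P] [MonoidalCategory P] {F : (∀ k, C k) ⥤ P}

/-- Naturality of an operation can be tested on morphisms which change one entry. -/
theorem SlotOp.isNatural_of {i : ι} {z x y : C i} {m : SlotOp F i z x y}
    (h₁ : ∀ (a b : ∀ k, C k) (h : ∀ k, k ≠ i → a k = b k),
      m a ≫ F.map (updHom i (fun k hk => eqToHom (h k hk)) (𝟙 y)) =
        (F.map (updHom i (fun k hk => eqToHom (h k hk)) (𝟙 z)) ⊗ₘ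
          F.map (updHom i (fun k hk => eqToHom (h k hk)) (𝟙 x))) ≫ m b)
    (h₂ : ∀ (j : ι), i ≠ j → ∀ (a : ∀ k, C k) {p q : C j} (f : p ⟶ q),
      m (Function.update a j p) ≫
          F.map (updHom i (fun k _ => updHom j (fun k _ => 𝟙 (a k)) f k) (𝟙 y)) =
        (F.map (updHom i (fun k _ => updHom j (fun k _ => 𝟙 (a k)) f k) (𝟙 z)) ⊗ₘ
          F.map (updHom i (fun k _ => updHom j (fun k _ => 𝟙 (a k)) f k) (𝟙 x))) ≫
            m (Function.update a j q)) : m.IsNatural := by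
  have key : ∀ {a b : ∀ k, C k} (φ : a ⟶ b),
      m a ≫ F.map (updHom i (fun k _ => φ k) (𝟙 y)) =
        (F.map (updHom i (fun k _ => φ k) (𝟙 z)) ⊗ₘ F.map (updHom i (fun k _ => φ k) (𝟙 x))) ≫
          m b := by
    intro a b φ
    induction φ using pi_hom_induction with
    | id a =>
      have e (u : C i) : updHom i (fun k _ => (𝟙 a : a ⟶ a) k) (𝟙 u) = 𝟙 _ := updHom_id a i u
      rw [e, e, e]
      simp
    | comp φ ψ hφ hψ =>
      have e (u : C i) : updHom i (fun k _ => (φ ≫ ψ) k) (𝟙 u) =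
          updHom i (fun k _ => φ k) (𝟙 u) ≫ updHom i (fun k _ => ψ k) (𝟙 u) := by
        rw [updHom_comp, comp_id]; rfl
      rw [e, e, e, F.map_comp, F.map_comp, F.map_comp, reassoc_of% hφ, hψ,
        tensorHom_comp_tensorHom_assoc]
    | single j a f =>
      by_cases hij : i = j
      · subst hij
        rename_i p q
        have h (k) (hk : k ≠ i) : Function.update a i p k = Function.update a i q k := by simp [hk]
        have e : (fun k (_ : k ≠ i) => updHom i (fun k _ => 𝟙 (a k)) f k) =
            fun k hk => eqToHom (h k hk) := by
          funext k hk
          simp [updHom_of_ne _ _ _ hk]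
        rw [e]
        exact h₁ _ _ h
      · exact h₂ j hij a f
  intro a b φ
  -- The family `φ` has no entry at `i`. It is completed by an identity there, which changes the
  -- dummy entry of the target tuple; the hypothesis `h₁` on equalities changes it back.
  obtain ⟨ψ, e⟩ : ∃ ψ : a ⟶ Function.update b i (a i), ∀ u : C i, updHom i φ (𝟙 u) =
      updHom i (fun k _ => ψ k) (𝟙 u) ≫
        updHom i (fun k hk => eqToHom (Function.update_of_ne hk _ _)) (𝟙 u) := by
    refine ⟨eqToHom (Function.update_eq_self i a).symm ≫ updHom i φ (𝟙 (a i)), fun u => ?_⟩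
    rw [updHom_comp]
    congr 1
    · funext k hk
      rw [Pi.comp_apply, updHom_of_ne _ _ _ hk]
      simp
    · simp
  rw [e, e, e, F.map_comp, F.map_comp, F.map_comp, reassoc_of% (key ψ), h₁,
    tensorHom_comp_tensorHom_assoc]

end NaturalOperations

/-! ### The extension to tuples of values, and its additivity data -/

section Extension

variable {ι : Type} [DecidableEq ι] [Fintype ι]
  {T : ι → Type u} [∀ i, SmallCategory (T i)] [∀ i, Preadditive (T i)]
  [∀ i, HasZeroObject (T i)] [∀ i, HasShift (T i) ℤ]
  [∀ i, ∀ n : ℤ, (shiftFunctor (T i) n).Additive] [∀ i, Pretriangulated (T i)]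
  {P : PicardGroupoid.{u}}
  {V : ι → PicardGroupoid.{u}} {det : ∀ i, DetFunctor (T i) (V i)}

namespace MultiDet

variable (D : MultiDet T P) (U : ∀ i, (det i).IsUniversal)

/-- The extension of a multi-determinant functor to all morphisms between values of universal
determinants. -/
def ext : (∀ i, DetValues det i) ⥤ P := (D.slotAction U).functor

theorem ext_map_slot (a : ∀ k, DetValues det k) (i : ι) {p q : DetValues det i} (f : p ⟶ q) :
    (D.ext U).map (updHom i (fun k _ => 𝟙 (a k)) f) = (D.slotAct U i a).map f := by
  refine ((D.slotAction U).functor_map_updHom a i f).trans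
    ((D.slotActMap_eq U i (fun k hk => by simp [hk]) (Function.update_self i p a)
      (Function.update_self i q a) f a (fun k hk => by simp [hk]) rfl rfl).trans ?_)
  exact (id_comp _).trans (comp_id _)

theorem ext_map_eqToHom {x y : ∀ k, DetValues det k} (h : x = y) :
    (D.ext U).map (eqToHom h) = D.functor.map (eqToHom (C := ∀ k, Core (T k)) h) := by
  subst h
  exact ((D.ext U).map_id x).trans (D.functor.map_id (X := x)).symm

theorem ext_map_swap {i j : ι} (h : i ≠ j) (a : ∀ k, DetValues det k) (x : DetValues det i)
    (y : DetValues det j) :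
    (D.ext U).map (swap h a x y) = D.functor.map (swap (C := fun k => Core (T k)) h a x y) :=
  D.ext_map_eqToHom U _

theorem ext_map_updHom_eqToHom (i : ι) {a b : ∀ k, DetValues det k} (h : ∀ k, k ≠ i → a k = b k)
    (x : DetValues det i) :
    (D.ext U).map (updHom i (fun k hk => eqToHom (h k hk)) (𝟙 x)) =
      D.functor.map (updHom (C := fun k => Core (T k)) i (fun k hk => eqToHom (h k hk))
        (CategoryStruct.id (obj := Core (T i)) x)) := by
  rw [updHom_eqToHom, updHom_eqToHom]
  exact D.ext_map_eqToHom U _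

/-- After exchanging the two variables the morphism changes only the `j`-th entry, where the
extension is the action. Naturality of additivity data in new morphisms thus becomes a property of
`slotActHom`. -/
theorem ext_map_updHom_updHom {i j : ι} (h : i ≠ j) (a : ∀ k, DetValues det k)
    (u : DetValues det i) {p q : DetValues det j} (f : p ⟶ q) :
    (D.ext U).map (updHom i (fun k _ => updHom j (fun k _ => 𝟙 (a k)) f k) (𝟙 u)) =
      (D.slotActHom U h a f).natTrans.app u := by
  have e := map_updHom_comp_swap (F := D.ext U) h a u f
  rw [ext_map_swap, ext_map_swap, ext_map_slot] at e
  have key : ∀ {A B A' B' : P} {f : A ⟶ B} {s : B ⟶ B'} {s' : B' ⟶ B} {t : A ⟶ A'} {g : A' ⟶ B'},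
      f ≫ s = t ≫ g → s ≫ s' = 𝟙 _ → f = t ≫ g ≫ s' := by
    intro A B A' B' f s s' t g h h'
    rw [← reassoc_of% h, h', comp_id]
  exact key e (map_swap_comp_map_swap (F := D.functor) h.symm a q u)

/-- The additivity data, as operations on the extension of a multi-determinant functor. -/
def extAdd (i : ι) {x y z : T i} (f : x ⟶ y) (g : y ⟶ z) (h : z ⟶ x⟦(1 : ℤ)⟧)
    (hΔ : Triangle.mk f g h ∈ distTriang (T i)) :
    SlotOp (D.ext U) i (show DetValues det i from ⟨z⟩) (show DetValues det i from ⟨x⟩)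
      (show DetValues det i from ⟨y⟩) :=
  fun a => (D.data i a).add f g h hΔ

/-- Equalities of tuples are covered by the triangle-function axiom, and new morphisms in another
variable by `slotActHom` being a morphism of determinant functors. -/
theorem extAdd_isNatural (i : ι) {x y z : T i} (f : x ⟶ y) (g : y ⟶ z) (h : z ⟶ x⟦(1 : ℤ)⟧)
    (hΔ : Triangle.mk f g h ∈ distTriang (T i)) : (D.extAdd U i f g h hΔ).IsNatural := by
  refine SlotOp.isNatural_of (fun a b e => ?_) (fun j hij a p q k => ?_)
  · rw [ext_map_updHom_eqToHom, ext_map_updHom_eqToHom, ext_map_updHom_eqToHom]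
    exact D.triangle_function i f g h hΔ a b _
  · rw [ext_map_updHom_updHom _ _ hij, ext_map_updHom_updHom _ _ hij,
      ext_map_updHom_updHom _ _ hij]
    exact (D.slotActHom U hij a k).compatible f g h hΔ

/-- The interchange law involves only equality morphisms of tuples, on which the extension agrees
with `D`; so it is the two triangles axiom itself. -/
theorem extAdd_interchange {i j : ι} (hij : i ≠ j)
    {x y z : T i} (f : x ⟶ y) (g : y ⟶ z) (h : z ⟶ x⟦(1 : ℤ)⟧)
    (hΔ : Triangle.mk f g h ∈ distTriang (T i))
    {x' y' z' : T j} (f' : x' ⟶ y') (g' : y' ⟶ z') (h' : z' ⟶ x'⟦(1 : ℤ)⟧)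
    (hΔ' : Triangle.mk f' g' h' ∈ distTriang (T j)) :
    SlotOp.Interchange hij (D.extAdd U i f g h hΔ) (D.extAdd U j f' g' h' hΔ') := by
  intro a
  rw [ext_map_swap, ext_map_swap, ext_map_swap, ext_map_swap, ext_map_swap, ext_map_swap,
    ext_map_swap, ext_map_swap, ext_map_swap]
  exact D.two_triangles hij f g h hΔ f' g' h' hΔ' a

end MultiDet

end Extension

/-! ### Symmetry of the interchange law and its transport along morphisms -/

section Interchange

variable {ι : Type w} [DecidableEq ι] {C : ι → Type u} [∀ i, Category.{v} (C i)]
  {P : Type u'} [Category.{v'} P] [MonoidalCategory P] [SymmetricCategory P]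
  {F : (∀ k, C k) ⥤ P}

theorem tensorμ_tensorμ (W X Y Z : P) : tensorμ W X Y Z ≫ tensorμ W Y X Z = 𝟙 _ := by
  have h : (β_ Y X).hom = (β_ X Y).inv := (Iso.inv_ext (SymmetricCategory.symmetry X Y)).symm
  have : tensorμ W Y X Z = tensorδ W X Y Z := by simp only [tensorμ, tensorδ, h]
  rw [this, tensorμ_tensorδ]

theorem interchange_symm_key {A₁ A₂ A₃ A₄ B₁ B₂ B₃ B₄ Z Z' : P} {s₁ : A₁ ⟶ B₁} {s₂ : A₂ ⟶ B₂}
    {s₃ : A₃ ⟶ B₃} {s₄ : A₄ ⟶ B₄} {t₁ : B₁ ⟶ A₁} {t₂ : B₂ ⟶ A₂} {t₃ : B₃ ⟶ A₃} {t₄ : B₄ ⟶ A₄}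
    (h₁ : t₁ ≫ s₁ = 𝟙 _) (h₂ : t₂ ≫ s₂ = 𝟙 _) (h₃ : t₃ ≫ s₃ = 𝟙 _) (h₄ : t₄ ≫ s₄ = 𝟙 _)
    {M M' N N' : P} {m : (A₁ ⊗ A₂) ⊗ (A₃ ⊗ A₄) ⟶ M} {p : M ⟶ M'} {r : M' ⟶ Z}
    {n : (B₁ ⊗ B₃) ⊗ (B₂ ⊗ B₄) ⟶ N} {p' : N ⟶ N'} {r' : N' ⟶ Z'} {q : Z' ⟶ Z} {q' : Z ⟶ Z'}
    (hq : q ≫ q' = 𝟙 _)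
    (h : m ≫ p ≫ r =
      tensorμ A₁ A₂ A₃ A₄ ≫ ((s₁ ⊗ₘ s₃) ⊗ₘ (s₂ ⊗ₘ s₄)) ≫ n ≫ p' ≫ r' ≫ q) :
    n ≫ p' ≫ r' = tensorμ B₁ B₃ B₂ B₄ ≫ ((t₁ ⊗ₘ t₂) ⊗ₘ (t₃ ⊗ₘ t₄)) ≫ m ≫ p ≫ r ≫ q' := by
  have e := congrArg (· ≫ q') h
  simp only [assoc, hq, comp_id] at e
  have ht : ((t₁ ⊗ₘ t₃) ⊗ₘ (t₂ ⊗ₘ t₄)) ≫ ((s₁ ⊗ₘ s₃) ⊗ₘ (s₂ ⊗ₘ s₄)) = 𝟙 _ := by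
    simp only [tensorHom_comp_tensorHom, h₁, h₂, h₃, h₄, id_tensorHom_id]
  have c := tensorμ_natural t₁ t₃ t₂ t₄
  have hμ := tensorμ_tensorμ A₁ A₃ A₂ A₄
  rw [e, ← reassoc_of% c, reassoc_of% hμ, reassoc_of% ht]

/-- Exchanging the middle summands twice is the identity in a symmetric monoidal category.
Statements about one variable can therefore be reused for the other. -/
theorem SlotOp.Interchange.symm {i j : ι} {h : i ≠ j} {z x y : C i} {z' x' y' : C j}
    {m : SlotOp F i z x y} {m' : SlotOp F j z' x' y'} (H : SlotOp.Interchange h m m') :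
    SlotOp.Interchange h.symm m' m := fun a =>
  interchange_symm_key (map_swap_comp_map_swap h a z z') (map_swap_comp_map_swap h a x z')
    (map_swap_comp_map_swap h a z x') (map_swap_comp_map_swap h a x x')
    (map_swap_comp_map_swap h.symm a y' y) (H a)

theorem compatible_of_comp {A₁ A₂ A₃ A₄ B₁ B₂ B₃ B₄ M M' N N' L L' : P} {m : A₁ ⊗ A₃ ⟶ M}
    {n : A₂ ⊗ A₄ ⟶ N} {m' : B₁ ⊗ B₃ ⟶ M'} {n' : B₂ ⊗ B₄ ⟶ N'} {f₁ : A₁ ⟶ B₁} {f₂ : A₂ ⟶ B₂}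
    {f₃ : A₃ ⟶ B₃} {f₄ : A₄ ⟶ B₄} {g : M ⟶ M'} {g' : N ⟶ N'} {τ : M' ⊗ N' ⟶ L} {k : L ⟶ L'}
    {K₁ K₂ K₁' K₂' : P} {τ₁ : B₁ ⊗ B₂ ⟶ K₁} {τ₂ : B₃ ⊗ B₄ ⟶ K₂} {r : K₁ ⊗ K₂ ⟶ L}
    {k₁ : K₁ ⟶ K₁'} {k₂ : K₂ ⟶ K₂'} {r' : K₁' ⊗ K₂' ⟶ L'}
    (h₁ : m ≫ g = (f₁ ⊗ₘ f₃) ≫ m') (h₂ : n ≫ g' = (f₂ ⊗ₘ f₄) ≫ n')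
    (h : (tensorμ B₁ B₂ B₃ B₄ ≫ (m' ⊗ₘ n')) ≫ τ = (τ₁ ⊗ₘ τ₂) ≫ r)
    (h₃ : r ≫ k = (k₁ ⊗ₘ k₂) ≫ r') :
    (tensorμ A₁ A₂ A₃ A₄ ≫ (m ⊗ₘ n)) ≫ (g ⊗ₘ g') ≫ τ ≫ k =
      (((f₁ ⊗ₘ f₂) ≫ τ₁ ≫ k₁) ⊗ₘ ((f₃ ⊗ₘ f₄) ≫ τ₂ ≫ k₂)) ≫ r' := by
  rw [← assoc (_ ≫ _), tensorμ_comp_naturality h₁ h₂, assoc, ← assoc _ τ, h, assoc, h₃]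
  simp only [← tensorHom_comp_tensorHom, assoc]

/-- Seen in the `j`-th variable, the conjugated operation is a composite of transformations: those
induced by `ez`, `ex`, `ey` are compatible with `m'` by its naturality, and the transpose of `m` by
the given interchange. -/
theorem SlotOp.Interchange.conj_left {i j : ι} {h : i ≠ j} {z x y z₁ x₁ y₁ : C i} {z' x' y' : C j}
    {m : SlotOp F i z x y} {m' : SlotOp F j z' x' y'} (hm : m.IsNatural) (hm' : m'.IsNatural)
    (H : SlotOp.Interchange h m m') (ez : z₁ ⟶ z) (ex : x₁ ⟶ x) (ey : y ⟶ y₁) :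
    SlotOp.Interchange h (m.conj ez ex ey) m' := by
  have e (a : ∀ k, C k) (v : C j) :
      ((m.conj ez ex ey).transpose h (hm.conj ez ex ey) a).app v =
        (F.map (updHom j (fun k _ => updHom i (fun k _ => 𝟙 (a k)) ez k) (𝟙 v)) ⊗ₘ
          F.map (updHom j (fun k _ => updHom i (fun k _ => 𝟙 (a k)) ex k) (𝟙 v))) ≫
        (m.transpose h hm a).app v ≫
          F.map (updHom j (fun k _ => updHom i (fun k _ => 𝟙 (a k)) ey k) (𝟙 v)) := by
    have e₁ := map_slot_comp_swap (F := F) h.symm a v ey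
    have e₂ {u u' : C i} (f : u ⟶ u') := map_updHom_comp_swap (F := F) h.symm a v f
    have key : ∀ {A A' B B' A₁ A₁' B₁ B₁' M L L' M' : P} {s : A ⟶ A'} {t : B ⟶ B'} {f : A' ⟶ A₁}
        {g : B' ⟶ B₁} {n : A₁ ⊗ B₁ ⟶ M} {k : M ⟶ M'} {r : M' ⟶ L} {f' : A ⟶ A₁'} {s' : A₁' ⟶ A₁}
        {g' : B ⟶ B₁'} {t' : B₁' ⟶ B₁} {r' : M ⟶ L'} {k' : L' ⟶ L},
        k ≫ r = r' ≫ k' → f' ≫ s' = s ≫ f → g' ≫ t' = t ≫ g →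
        (s ⊗ₘ t) ≫ ((f ⊗ₘ g) ≫ n ≫ k) ≫ r = (f' ⊗ₘ g') ≫ ((s' ⊗ₘ t') ≫ n ≫ r') ≫ k' := by
      intro A A' B B' A₁ A₁' B₁ B₁' M L L' M' s t f g n k r f' s' g' t' r' k' h₁ h₂ h₃
      simp only [assoc, tensorHom_comp_tensorHom_assoc, h₁, h₂, h₃]
    exact key e₁ (e₂ ez) (e₂ ex)
  rw [SlotOp.interchange_iff (hm.conj ez ex ey)]
  intro a
  rw [e, e, e]
  exact compatible_of_comp (hm' _ _ _) (hm' _ _ _) ((SlotOp.interchange_iff hm).1 H a) (hm' _ _ _)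

theorem SlotOp.Interchange.conj {i j : ι} {h : i ≠ j} {z x y z₁ x₁ y₁ : C i}
    {z' x' y' z₁' x₁' y₁' : C j}
    {m : SlotOp F i z x y} {m' : SlotOp F j z' x' y'} (hm : m.IsNatural) (hm' : m'.IsNatural)
    (H : SlotOp.Interchange h m m') (ez : z₁ ⟶ z) (ex : x₁ ⟶ x) (ey : y ⟶ y₁)
    (ez' : z₁' ⟶ z') (ex' : x₁' ⟶ x') (ey' : y' ⟶ y₁') :
    SlotOp.Interchange h (m.conj ez ex ey) (m'.conj ez' ex' ey') :=
  ((H.conj_left hm hm' ez ex ey).symm.conj_left hm' (hm.conj ez ex ey) ez' ex' ey').symm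

end Interchange

/-! ### Symmetric monoidal structures determined by additivity data -/

namespace DetFunctor.IsUniversal

variable {T : Type u} [SmallCategory T] [Preadditive T] [HasZeroObject T]
  [HasShift T ℤ] [∀ n : ℤ, (shiftFunctor T n).Additive] [Pretriangulated T]
  {V : PicardGroupoid.{u}} {d : DetFunctor T V} {P : PicardGroupoid.{u}}

/-- The comparison of the lift with `d ⋙ g` is a priori natural for isomorphisms of `T` only. The
hypothesis on the action makes it natural for all morphisms of `V` between values. -/
theorem lift_map_comp_liftHom (U : d.IsUniversal) {g : V ⥤ P} (s : AdditivityData (d.functor ⋙ g))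
    (H : ∀ {x y : InducedCategory V d.functor.obj} (f : x ⟶ y), (U.act ⟨_, s⟩).map f = g.map f.hom)
    {x y : Core T} (f : d.functor.obj x ⟶ d.functor.obj y) :
    (U.lift ⟨_, s⟩).functor.map f ≫ (U.liftHom ⟨_, s⟩).natTrans.app y =
      (U.liftHom ⟨_, s⟩).natTrans.app x ≫ g.map f := by
  have := H (x := x) (y := y) (InducedCategory.homMk f)
  have key : ∀ {A B A' B' : P} {a : A ⟶ A'} {f : A ⟶ B} {b : B ⟶ B'} {g : A' ⟶ B'},
      pinv a ≫ f ≫ b = g → f ≫ b = a ≫ g := by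
    rintro A B A' B' a f b g rfl
    simp
  exact key this

/-- If the action of morphisms on additivity data for `d ⋙ g` is given by `g`, then `g` is isomorphic
to the induced symmetric monoidal functor. -/
def liftIso (U : d.IsUniversal) {g : V ⥤ P} (s : AdditivityData (d.functor ⋙ g))
    (H : ∀ {x y : InducedCategory V d.functor.obj} (f : x ⟶ y),
      (U.act ⟨_, s⟩).map f = g.map f.hom) : (U.lift ⟨_, s⟩).functor ≅ g :=
  NatIso.ofComponents (fun v =>
    (U.lift ⟨_, s⟩).functor.mapIso (U.essSurj v).choose_spec.some.symm ≪≫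
      ⟨(U.liftHom ⟨_, s⟩).natTrans.app (U.essSurj v).choose, pinv _, comp_pinv _, pinv_comp _⟩ ≪≫
        g.mapIso (U.essSurj v).choose_spec.some) fun {v w} f => by
    have h := U.lift_map_comp_liftHom s H
      ((U.essSurj v).choose_spec.some.hom ≫ f ≫ (U.essSurj w).choose_spec.some.inv)
    have key : ∀ {A B A' B' M M' N N' : P} {f : A ⟶ B} {r : B ⟶ B'} {l' : B' ⟶ N'} {k : N' ⟶ M'}
        {t : A' ⟶ A} {t' : A ⟶ A'} {l : A' ⟶ N} {k₁ : N ⟶ M} {f' : M ⟶ M'} {k' : M' ⟶ N'},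
        t' ≫ t = 𝟙 _ → k' ≫ k = 𝟙 _ → (t ≫ f ≫ r) ≫ l' = l ≫ k₁ ≫ f' ≫ k' →
        f ≫ r ≫ l' ≫ k = (t' ≫ l ≫ k₁) ≫ f' := by
      intro A B A' B' M M' N N' f r l' k t t' l k₁ f' k' h₁ h₂ h₃
      have := congrArg (fun u => t' ≫ u ≫ k) h₃
      simp only [assoc, h₂, comp_id] at this
      rw [reassoc_of% h₁] at this
      simpa using this
    refine key (t := (U.lift ⟨_, s⟩).functor.map (U.essSurj v).choose_spec.some.hom)
      (k' := g.map (U.essSurj w).choose_spec.some.inv) ?_ ?_ ?_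
    · exact ((U.lift ⟨_, s⟩).functor.mapIso (U.essSurj v).choose_spec.some).inv_hom_id
    · exact (g.mapIso (U.essSurj w).choose_spec.some).inv_hom_id
    · rw [Functor.map_comp, Functor.map_comp, Functor.map_comp, Functor.map_comp] at h
      exact h

/-- The value chosen to represent d(x) need not be the one at `x`; naturality on values removes the
choice. -/
theorem liftIso_app (U : d.IsUniversal) {g : V ⥤ P} (s : AdditivityData (d.functor ⋙ g))
    (H : ∀ {x y : InducedCategory V d.functor.obj} (f : x ⟶ y), (U.act ⟨_, s⟩).map f = g.map f.hom)
    (x : Core T) : (U.liftIso s H).hom.app (d.functor.obj x) =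
      (U.liftHom ⟨_, s⟩).natTrans.app x := by
  have h := U.lift_map_comp_liftHom s H (U.essSurj (d.functor.obj x)).choose_spec.some.inv
  have key : ∀ {A B A' B' : P} {a : A ⟶ A'} {f : A ⟶ B} {b : B ⟶ B'} {g : A' ⟶ B'}
      {g' : B' ⟶ A'}, f ≫ b = a ≫ g → g ≫ g' = 𝟙 _ → f ≫ b ≫ g' = a := by
    intro A B A' B' a f b g g' h h'
    rw [reassoc_of% h, h', comp_id]
  exact key h (g.mapIso (U.essSurj (d.functor.obj x)).choose_spec.some).inv_hom_id

/-- The symmetric monoidal structure on a functor `g` determined by additivity data on `d ⋙ g`. -/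
@[reducible]
def braided (U : d.IsUniversal) {g : V ⥤ P} (s : AdditivityData (d.functor ⋙ g))
    (H : ∀ {x y : InducedCategory V d.functor.obj} (f : x ⟶ y),
      (U.act ⟨_, s⟩).map f = g.map f.hom) : g.Braided :=
  letI : g.Monoidal := Functor.Monoidal.transport (U.liftIso s H)
  haveI := Functor.Monoidal.natTransIsMonoidal_of_transport (U.liftIso s H)
  { braided := (Functor.LaxBraided.ofNatIso (U.liftIso s H)).braided }

/-- The transported tensorator is a conjugate of that of the lift, and the comparison `liftHom`
respects additivity data. So the structure on `g` recovers `s`. -/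
theorem braided_post_add (U : d.IsUniversal) {g : V ⥤ P} (s : AdditivityData (d.functor ⋙ g))
    (H : ∀ {x y : InducedCategory V d.functor.obj} (f : x ⟶ y),
      (U.act ⟨_, s⟩).map f = g.map f.hom) {x y z : T} (f : x ⟶ y) (k : y ⟶ z)
    (h : z ⟶ x⟦(1 : ℤ)⟧) (hΔ : Triangle.mk f k h ∈ distTriang T) :
    letI := U.braided s H
    (d.data.post g).add f k h hΔ = s.add f k h hΔ := by
  have h₁ := (U.liftHom ⟨_, s⟩).compatible f k h hΔ
  have h₂ := (U.liftIso s H).hom.naturality (d.data.add f k h hΔ)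
  rw [liftIso_app] at h₂
  have key : ∀ {A B A' B' M N L : P} {i : A ≅ A'} {j : B ≅ B'} {μ : A ⊗ B ⟶ M} {t : M ⟶ N}
      {r : N ⟶ L} {f : M ⟶ L} {s : A' ⊗ B' ⟶ L}, (μ ≫ t) ≫ r = (i.hom ⊗ₘ j.hom) ≫ s →
      t ≫ r = f → (i.inv ⊗ₘ j.inv) ≫ μ ≫ f = s := by
    rintro A B A' B' M N L i j μ t r f s h rfl
    rw [← assoc μ, h, tensorHom_comp_tensorHom_assoc]
    simp
  have e (x : Core T) := U.liftIso_app s H x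
  have := key (i := (U.liftIso s H).app (d.functor.obj ⟨z⟩))
    (j := (U.liftIso s H).app (d.functor.obj ⟨x⟩))
    (h₁.trans (congrArg (· ≫ _) (congr (congrArg _ (e ⟨z⟩).symm) (e ⟨x⟩).symm))) h₂
  refine Eq.trans ?_ this
  exact (assoc _ _ _).trans (congrArg (_ ≫ ·) (assoc _ _ _))

end DetFunctor.IsUniversal

/-! ### Multiexact functors from additivity data on values -/

section Multiexact

variable {ι : Type} [DecidableEq ι]
  {T : ι → Type u} [∀ i, SmallCategory (T i)] [∀ i, Preadditive (T i)]
  [∀ i, HasZeroObject (T i)] [∀ i, HasShift (T i) ℤ]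
  [∀ i, ∀ n : ℤ, (shiftFunctor (T i) n).Additive] [∀ i, Pretriangulated (T i)]
  {P : PicardGroupoid.{u}}
  {V : ι → PicardGroupoid.{u}} {det : ∀ i, DetFunctor (T i) (V i)}
  (U : ∀ i, (det i).IsUniversal)

/-- The natural transformation in the `i`-th variable given by morphisms in the other variables. -/
def slotNatTrans {C : ι → Type w} [∀ i, Category.{v} (C i)] {D : Type w'} [Category.{v'} D]
    (F : (∀ k, C k) ⥤ D) (i : ι) {a b : ∀ k, C k} (φ : ∀ k, k ≠ i → (a k ⟶ b k)) :
    slot a i ⋙ F ⟶ slot b i ⋙ F where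
  app x := F.map (updHom i φ (𝟙 x))
  naturality x y f := by
    change F.map _ ≫ _ = _ ≫ F.map _
    rw [← F.map_comp, ← F.map_comp, updHom_comp, updHom_comp]
    simp

section

variable {F : (∀ k, V k) ⥤ P} {b : ∀ i a, (slot (C := fun k => V k) a i ⋙ F).Braided}

/-- The tensorators are natural if they are natural on the values of universal determinants. -/
theorem slotμ_isNatural (U : ∀ i, (det i).IsUniversal) (i : ι)
    (h : ∀ {x y z : T i} (f : x ⟶ y) (g : y ⟶ z) (k : z ⟶ x⟦(1 : ℤ)⟧)
      (hΔ : Triangle.mk f g k ∈ distTriang (T i)),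
      ((slotμ b i _ _).mapOut ((det i).data.add f g k hΔ)).IsNatural) (v w : V i) :
    (slotμ b i v w).IsNatural := by
  intro a a' φ
  let := b i a
  let := b i a'
  have := (U i).isMonoidal (slotNatTrans F i φ) fun x y z f g k hΔ => h f g k hΔ a a' φ
  exact NatTrans.IsMonoidal.tensor (τ := slotNatTrans F i φ) v w

/-- The tensorators in the `j`-th variable commute with an operation in the `i`-th variable if this
holds on the values of universal determinants. -/
theorem slotμ_interchange (U : ∀ i, (det i).IsUniversal) {i j : ι} (hij : i ≠ j) {z x y : V i} {m : SlotOp F i z x y}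
    (hm : m.IsNatural)
    (h : ∀ {x y z : T j} (f : x ⟶ y) (g : y ⟶ z) (k : z ⟶ x⟦(1 : ℤ)⟧)
      (hΔ : Triangle.mk f g k ∈ distTriang (T j)),
      SlotOp.Interchange hij m ((slotμ b j _ _).mapOut ((det j).data.add f g k hΔ)))
    (v w : V j) : SlotOp.Interchange hij m (slotμ b j v w) := by
  rw [SlotOp.interchange_iff hm]
  intro a
  let := b j (Function.update a i z)
  let := b j (Function.update a i x)
  let := b j (Function.update a i y)
  -- Interchange with the tensorators says that the transpose of `m` is monoidal in the `j`-th
  -- variable, which is tested on triangles.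
  have := (U j).isMonoidal (m.transpose hij hm a) fun x' y' z' f g k hΔ => by
    refine Eq.trans ?_ ((SlotOp.interchange_iff hm).1 (h f g k hΔ) a)
    refine congrArg (· ≫ _) ?_
    refine (congrArg (· ≫ _) (sumFunctor_μ _ _ _ _)).trans ((assoc _ _ _).trans ?_)
    exact congrArg (tensorμ _ _ _ _ ≫ ·) (tensorHom_comp_tensorHom _ _ _ _)
  have e := NatTrans.IsMonoidal.tensor (τ := m.transpose hij hm a) v w
  rw [sumFunctor_μ] at e
  exact e

end

variable {G : (∀ k, V k) ⥤ P}
  (s : ∀ i (a : ∀ k, V k), AdditivityData ((det i).functor ⋙ slot (C := fun k => V k) a i ⋙ G))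
  (H : ∀ i (a : ∀ k, V k) {x y : DetValues det i} (f : x ⟶ y),
    ((U i).act ⟨_, s i a⟩).map f = (slot (C := fun k => V k) a i ⋙ G).map f.hom)

/-- Additivity data in each variable, as operations in one variable. -/
def addOp (i : ι) {x y z : T i} (f : x ⟶ y) (g : y ⟶ z) (h : z ⟶ x⟦(1 : ℤ)⟧)
    (hΔ : Triangle.mk f g h ∈ distTriang (T i)) :
    SlotOp G i ((det i).functor.obj ⟨z⟩) ((det i).functor.obj ⟨x⟩) ((det i).functor.obj ⟨y⟩) :=
  fun a => (s i a).add f g h hΔ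

/-- The symmetric monoidal structure in one variable determined by additivity data. -/
@[reducible]
def slotBraided (i : ι) (a : ∀ k, V k) : (slot (C := fun k => V k) a i ⋙ G).Braided :=
  (U i).braided (s i a) (H i a)

theorem slotμ_mapOut (i : ι) {x y z : T i} (f : x ⟶ y) (g : y ⟶ z) (h : z ⟶ x⟦(1 : ℤ)⟧)
    (hΔ : Triangle.mk f g h ∈ distTriang (T i)) :
    (slotμ (slotBraided U s H) i _ _).mapOut ((det i).data.add f g h hΔ) = addOp s i f g h hΔ :=
  funext fun a => (U i).braided_post_add (s i a) (H i a) f g h hΔ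

/-- The multiexact functor given by a functor with compatible additivity data on the values of
universal determinants in each variable. -/
def MultiExact.ofData
    (nat : ∀ i {x y z : T i} (f : x ⟶ y) (g : y ⟶ z) (h : z ⟶ x⟦(1 : ℤ)⟧)
      (hΔ : Triangle.mk f g h ∈ distTriang (T i)), (addOp s i f g h hΔ).IsNatural)
    (int : ∀ {i j} (hij : i ≠ j) {x y z : T i} (f : x ⟶ y) (g : y ⟶ z) (h : z ⟶ x⟦(1 : ℤ)⟧)
      (hΔ : Triangle.mk f g h ∈ distTriang (T i)) {x' y' z' : T j} (f' : x' ⟶ y') (g' : y' ⟶ z')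
      (h' : z' ⟶ x'⟦(1 : ℤ)⟧) (hΔ' : Triangle.mk f' g' h' ∈ distTriang (T j)),
      SlotOp.Interchange hij (addOp s i f g h hΔ) (addOp s j f' g' h' hΔ')) :
    MultiExact (fun i => V i) P where
  functor := G
  braided := slotBraided U s H
  natural i := slotμ_isNatural U i fun f g h hΔ => by
    rw [slotμ_mapOut]
    exact nat i f g h hΔ
  interchange {i j} hij v w v' w' := by
    have hn (i) := slotμ_isNatural U (b := slotBraided U s H) i fun f g h hΔ => by
      rw [slotμ_mapOut]
      exact nat i f g h hΔ
    -- The tensorator of the `j`-th variable is reduced to triangles first; then, with the variables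
    -- exchanged, the tensorator of the `i`-th variable is tested against such a triangle.
    refine slotμ_interchange U hij (hn i v w) (fun f' g' h' hΔ' => ?_) v' w'
    rw [slotμ_mapOut]
    refine SlotOp.Interchange.symm (h := hij.symm)
      (slotμ_interchange U hij.symm (nat j f' g' h' hΔ') (fun f g h hΔ => ?_) v w)
    rw [slotμ_mapOut]
    exact int hij.symm f' g' h' hΔ' f g h hΔ

end Multiexact

/-! ### The multiexact functor induced by a multi-determinant functor -/

section Lift

variable {ι : Type} [DecidableEq ι] [Fintype ι]
  {T : ι → Type u} [∀ i, SmallCategory (T i)] [∀ i, Preadditive (T i)]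
  [∀ i, HasZeroObject (T i)] [∀ i, HasShift (T i) ℤ]
  [∀ i, ∀ n : ℤ, (shiftFunctor (T i) n).Additive] [∀ i, Pretriangulated (T i)]
  {P : PicardGroupoid.{u}}
  {V : ι → PicardGroupoid.{u}} {det : ∀ i, DetFunctor (T i) (V i)}

/-- The inclusion of the values of a universal determinant functor. -/
abbrev valuesInclusion (det : ∀ i, DetFunctor (T i) (V i)) (i : ι) : DetValues det i ⥤ V i :=
  inducedFunctor (det i).functor.obj

/-- Every object of the target of a universal determinant functor is isomorphic to a value. -/
def valuesEquivalence (U : ∀ i, (det i).IsUniversal) (i : ι) : DetValues det i ≌ V i :=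
  haveI : (valuesInclusion det i).EssSurj := ⟨(U i).essSurj⟩
  haveI : (valuesInclusion det i).IsEquivalence := { }
  (valuesInclusion det i).asEquivalence

/-- The choice of a value isomorphic to a given object. -/
abbrev toValues (U : ∀ i, (det i).IsUniversal) (i : ι) : V i ⥤ DetValues det i :=
  (valuesEquivalence U i).inverse

/-- Every value is isomorphic to the chosen one. -/
def valuesUnit (U : ∀ i, (det i).IsUniversal) (i : ι) :
    𝟭 (DetValues det i) ≅ valuesInclusion det i ⋙ toValues U i :=
  (valuesEquivalence U i).unitIso

/-- A morphism of tuples of objects as a morphism of tuples of values. -/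
def valuesMap (det : ∀ i, DetFunctor (T i) (V i)) {a b : ∀ i, Core (T i)} (φ : a ⟶ b) :
    (show ∀ i, DetValues det i from a) ⟶ (show ∀ i, DetValues det i from b) :=
  fun i => InducedCategory.homMk ((det i).functor.map (φ i))

theorem valuesMap_updHom (a : ∀ i, Core (T i)) (i : ι) {x y : Core (T i)} (f : x ⟶ y) :
    valuesMap det (updHom i (fun k _ => 𝟙 (a k)) f) =
      updHom (C := DetValues det) (a := a) (b := a) i (fun k _ => 𝟙 _)
        (InducedCategory.homMk ((det i).functor.map f)) := by
  let c (i : ι) : Core (T i) ⥤ DetValues det i :=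
    { obj x := x
      map f := InducedCategory.homMk ((det i).functor.map f)
      map_id x := InducedCategory.hom_ext ((det i).functor.map_id x)
      map_comp f g := InducedCategory.hom_ext ((det i).functor.map_comp f g) }
  have key : ∀ {i : ι} {x y x' y' : Core (T i)} (p : x = x') (f : x' ⟶ y') (q : y' = y),
      (c i).map (eqToHom p ≫ f ≫ eqToHom q) =
        eqToHom (C := DetValues det i) p ≫ (c i).map f ≫ eqToHom (C := DetValues det i) q := by
    rintro i x y x' y' rfl f rfl
    simp
  funext k
  by_cases h : k = i
  · subst h
    refine Eq.trans ?_ (updHom_self (C := DetValues det) (a := a) (b := a) k _ _).symm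
    have e := updHom_self (C := fun k => Core (T k)) (a := a) (b := a) k (fun k _ => 𝟙 (a k)) f
    exact (congrArg (fun t => (c k).map t) e).trans (key _ f _)
  · refine Eq.trans ?_ (updHom_of_ne (C := DetValues det) (a := a) (b := a) i _ _ h).symm
    have e := updHom_of_ne (C := fun k => Core (T k)) (a := a) (b := a) i (fun k _ => 𝟙 (a k)) f h
    refine (congrArg (fun t => (c k).map t) e).trans ((key _ (𝟙 (a k)) _).trans ?_)
    rw [(c k).map_id]

namespace MultiDet

variable (D : MultiDet T P) (U : ∀ i, (det i).IsUniversal)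

/-- For a change of one entry this is `act_map_det`: the image of an isomorphism of `T i` acts as
the isomorphism itself. Such changes generate all morphisms of tuples. -/
theorem ext_map_valuesMap {a b : ∀ i, Core (T i)} (φ : a ⟶ b) :
    (D.ext U).map (valuesMap det φ) = D.functor.map φ := by
  induction φ using pi_hom_induction with
  | id a =>
    have : valuesMap det (𝟙 a) = 𝟙 _ :=
      funext fun k => InducedCategory.hom_ext ((det k).functor.map_id (a k))
    rw [this]
    exact ((D.ext U).map_id _).trans (D.functor.map_id a).symm
  | comp φ ψ hφ hψ =>
    have : valuesMap det (φ ≫ ψ) = valuesMap det φ ≫ valuesMap det ψ :=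
      funext fun k => InducedCategory.hom_ext ((det k).functor.map_comp (φ k) (ψ k))
    rw [this]
    refine ((D.ext U).map_comp _ _).trans (Eq.trans ?_ (D.functor.map_comp _ _).symm)
    rw [hφ, hψ]
    rfl
  | single i a f =>
    rw [valuesMap_updHom]
    exact (D.ext_map_slot U a i _).trans ((U i).act_map_det (D.inSlot i a) f)

/-- The functor of several variables induced by a multi-determinant functor. -/
def liftFunctor : (∀ i, V i) ⥤ P := Functor.pi (toValues U) ⋙ D.ext U

/-- Putting a variable object in the `i`-th entry commutes with the choice of values. -/
def slotValuesIso (i : ι) (a : ∀ k, V k) :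
    slot ((Functor.pi (toValues U)).obj a) i ≅
      valuesInclusion det i ⋙ slot (C := fun k => V k) a i ⋙ Functor.pi (toValues U) :=
  NatIso.ofComponents (fun x => (slot ((Functor.pi (toValues U)).obj a) i).mapIso
    ((valuesUnit U i).app x) ≪≫ (slotPiIso (toValues U) a i).app ((valuesInclusion det i).obj x))
    fun {x y} f => by
      have h₁ := congrArg (slot ((Functor.pi (toValues U)).obj a) i).map
        ((valuesUnit U i).hom.naturality f)
      have h₂ := (slotPiIso (toValues U) a i).hom.naturality ((valuesInclusion det i).map f)
      rw [Functor.map_comp, Functor.map_comp] at h₁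
      have key : ∀ {C : Type u} [Category.{u} C] {A B A' B' E E' : C} {f : A ⟶ B} {f' : A' ⟶ B'}
          {f'' : E ⟶ E'} {p : A ⟶ A'} {q : B ⟶ B'} {p' : A' ⟶ E} {q' : B' ⟶ E'}, f ≫ q = p ≫ f' →
          f' ≫ q' = p' ≫ f'' → f ≫ q ≫ q' = (p ≫ p') ≫ f'' := by
        intro C _ A B A' B' E E' f f' f'' p q p' q' h h'
        rw [reassoc_of% h, h', assoc]
      exact key h₁ h₂

/-- The values of the induced functor in one variable. -/
def liftFunctorIso (i : ι) (a : ∀ k, V k) :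
    slot ((Functor.pi (toValues U)).obj a) i ⋙ D.ext U ≅
      valuesInclusion det i ⋙ slot (C := fun k => V k) a i ⋙ D.liftFunctor U :=
  Functor.isoWhiskerRight (slotValuesIso U i a) (D.ext U)

theorem liftFunctorIso_naturality (i : ι) (a : ∀ k, V k) {x y : DetValues det i} (f : x ⟶ y) :
    (D.slotAct U i ((Functor.pi (toValues U)).obj a)).map f ≫ (D.liftFunctorIso U i a).hom.app y =
      (D.liftFunctorIso U i a).hom.app x ≫
        (slot (C := fun k => V k) a i ⋙ D.liftFunctor U).map f.hom :=
  (congrArg (· ≫ _) (D.ext_map_slot U _ i f).symm).trans ((D.liftFunctorIso U i a).hom.naturality f)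

/-- The values of the induced functor in one variable, as a functor on isomorphisms. -/
def liftDataIso (i : ι) (a : ∀ k, V k) :
    (D.inSlot i ((Functor.pi (toValues U)).obj a)).functor ≅
      (det i).functor ⋙ slot (C := fun k => V k) a i ⋙ D.liftFunctor U :=
  NatIso.ofComponents (fun x => (D.liftFunctorIso U i a).app x) fun f =>
    (congrArg (· ≫ _) ((U i).act_map_det _ f).symm).trans
      (D.liftFunctorIso_naturality U i a (InducedCategory.homMk ((det i).functor.map f)))

/-- The additivity data of the induced functor in one variable. -/
def liftData (i : ι) (a : ∀ k, V k) :
    AdditivityData ((det i).functor ⋙ slot (C := fun k => V k) a i ⋙ D.liftFunctor U) :=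
  (D.data i ((Functor.pi (toValues U)).obj a)).ofIso (D.liftDataIso U i a)

theorem compatible_ofIso {T : Type u} [Category.{v} T] [Preadditive T] [HasZeroObject T]
    [HasShift T ℤ] [∀ n : ℤ, (shiftFunctor T n).Additive] [Pretriangulated T]
    {P : Type u'} [Category.{v'} P] [MonoidalCategory P] [BraidedCategory P]
    {F G : Core T ⥤ P} (s : AdditivityData F) (e : F ≅ G) : s.Compatible (s.ofIso e) e.hom :=
  fun x y z f g h hΔ => by
    simp [AdditivityData.ofIso]

/-- The comparison with the induced functor in one variable. -/
def liftDataHom (i : ι) (a : ∀ k, V k) :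
    D.inSlot i ((Functor.pi (toValues U)).obj a) ⟶ ⟨_, D.liftData U i a⟩ where
  natTrans := (D.liftDataIso U i a).hom
  compatible := compatible_ofIso _ _

/-- The isomorphism along which the additivity data were transported intertwines the action on `D`
with both sides, and it can be cancelled. -/
theorem act_liftData (i : ι) (a : ∀ k, V k) {x y : DetValues det i} (f : x ⟶ y) :
    ((U i).act ⟨_, D.liftData U i a⟩).map f =
      (slot (C := fun k => V k) a i ⋙ D.liftFunctor U).map f.hom := by
  have h₁ := (U i).act_naturality (D.liftDataHom U i a) f
  have h₂ := D.liftFunctorIso_naturality U i a f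
  have key : ∀ {A B : P} {e : A ≅ B} {C : P} {f : A ⟶ C} {g g' : B ⟶ C},
      f = e.hom ≫ g → f = e.hom ≫ g' → g = g' := by
    intro A B e C f g g' h h'
    rwa [h, cancel_epi] at h'
  exact key (e := (D.liftFunctorIso U i a).app x) h₁ h₂

/-- The data arise from `extAdd` by conjugation and pullback, two constructions that preserve
naturality and interchange. -/
theorem addOp_liftData (i : ι) {x y z : T i} (f : x ⟶ y) (g : y ⟶ z) (h : z ⟶ x⟦(1 : ℤ)⟧)
    (hΔ : Triangle.mk f g h ∈ distTriang (T i)) :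
    addOp (D.liftData U) i f g h hΔ =
      SlotOp.pull (toValues U) (F := D.ext U) ((D.extAdd U i f g h hΔ).conj
        ((valuesUnit U i).inv.app _) ((valuesUnit U i).inv.app _)
        ((valuesUnit U i).hom.app _)) := by
  funext a
  have key : ∀ {A B E A' B' E' A₁ B₁ E₁ : P} {p : A ⟶ A'} {q : B ⟶ B'} {p' : A' ⟶ A₁}
      {q' : B' ⟶ B₁} {m : A₁ ⊗ B₁ ⟶ E₁} {r' : E₁ ⟶ E'} {r : E' ⟶ E} {s : A ⟶ A₁} {t : B ⟶ B₁}
      {k : E₁ ⟶ E}, s = p ≫ p' → t = q ≫ q' → k = r' ≫ r →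
      (s ⊗ₘ t) ≫ m ≫ k = (p ⊗ₘ q) ≫ ((p' ⊗ₘ q') ≫ m ≫ r') ≫ r := by
    rintro A B E A' B' E' A₁ B₁ E₁ p q p' q' m r' r s t k rfl rfl rfl
    simp only [← tensorHom_comp_tensorHom, assoc]
  exact key ((D.ext U).map_comp _ _) ((D.ext U).map_comp _ _) ((D.ext U).map_comp _ _)

/-- The multiexact functor induced by a multi-determinant functor. -/
def lift : MultiExact (fun i => V i) P :=
  MultiExact.ofData U (D.liftData U) (D.act_liftData U)
    (fun i x y z f g h hΔ => by
      rw [addOp_liftData]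
      exact ((D.extAdd_isNatural U i f g h hΔ).conj _ _ _).pull _)
    (fun {i j} hij x y z f g h hΔ x' y' z' f' g' h' hΔ' => by
      rw [addOp_liftData, addOp_liftData]
      exact ((D.extAdd_interchange U hij f g h hΔ f' g' h' hΔ').conj
        (D.extAdd_isNatural U i f g h hΔ) (D.extAdd_isNatural U j f' g' h' hΔ') _ _ _ _ _ _).pull _)

end MultiDet

end Lift

/-! ### Comparison of a tuple with its entrywise replacement -/

section Tuples

variable {ι : Type} {C D : ι → Type u} [∀ i, Category.{u} (C i)] [∀ i, Category.{u} (D i)]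
  {J : ∀ i, C i ⥤ D i} {k : ∀ i, D i ⥤ C i}

/-- Applying a family of morphisms to each entry of a tuple. -/
def tupleHom (q : ∀ i (v : C i), (k i).obj ((J i).obj v) ⟶ v) (a : ∀ i, C i) :
    (Functor.pi k).obj ((Functor.pi J).obj a) ⟶ a :=
  fun i => q i (a i)

theorem tupleHom_apply (q : ∀ i (v : C i), (k i).obj ((J i).obj v) ⟶ v) (a : ∀ i, C i) {i : ι}
    {v : C i} (h : a i = v) : tupleHom q a i =
      eqToHom (congrArg (fun u => (k i).obj ((J i).obj u)) h) ≫ q i v ≫ eqToHom h.symm := by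
  subst h
  exact ((id_comp _).trans (comp_id _)).symm

theorem eqToHom_pi_apply {a b : ∀ i, C i} (h : a = b) (i : ι) :
    (eqToHom h : a ⟶ b) i = eqToHom (congrFun h i) := by
  subst h; rfl

theorem pi_map_eqToHom_apply {a b : ∀ i, D i} (h : a = b) (i : ι) :
    (Functor.pi k).map (eqToHom h) i = eqToHom (congrArg (fun c => (k i).obj (c i)) h) := by
  subst h; exact (k i).map_id _

variable [DecidableEq ι]

/-- Passing to the replacement in the `i`-th entry and then comparing all entries back leaves only
the comparisons of the other entries, as `p` and `q` cancel at `i`. -/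
theorem updHom_comp_tupleHom {p : ∀ i (v : C i), v ⟶ (k i).obj ((J i).obj v)}
    {q : ∀ i (v : C i), (k i).obj ((J i).obj v) ⟶ v} (hpq : ∀ i v, p i v ≫ q i v = 𝟙 v)
    (a : ∀ i, C i) (i : ι) (w : C i) :
    updHom i (fun j _ => 𝟙 ((Functor.pi k).obj ((Functor.pi J).obj a) j)) (p i w) ≫
      eqToHom (pi_obj_update k ((Functor.pi J).obj a) i ((J i).obj w)).symm ≫
        (Functor.pi k).map (eqToHom (pi_obj_update J a i w).symm) ≫ tupleHom q _ =
      updHom i (fun j _ => tupleHom q a j) (𝟙 w) := by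
  funext j
  rw [Pi.comp_apply, Pi.comp_apply, Pi.comp_apply]
  by_cases h : j = i
  · subst h
    rw [updHom_self, updHom_self, tupleHom_apply q _ (Function.update_self j w a),
      eqToHom_pi_apply, pi_map_eqToHom_apply]
    have key : ∀ {C : Type u} [Category.{u} C] {W W' W'' X X' Y Y' : C} {p : W ⟶ X} {q : X ⟶ W}
        (e₁ : W' = W) (e₂ : X = X') (e₃ : X' = Y) (e₄ : Y = Y') (e₅ : Y' = X) (e₆ : W = W''),
        p ≫ q = 𝟙 W → (eqToHom e₁ ≫ p ≫ eqToHom e₂) ≫ eqToHom e₃ ≫ eqToHom e₄ ≫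
          eqToHom e₅ ≫ q ≫ eqToHom e₆ = eqToHom e₁ ≫ 𝟙 W ≫ eqToHom e₆ := by
      rintro C _ W W' W'' X X' Y Y' p q rfl rfl rfl rfl e₅ rfl h
      simpa using h
    exact key _ _ _ _ _ _ (hpq j w)
  · rw [updHom_of_ne _ _ _ h, updHom_of_ne _ _ _ h,
      tupleHom_apply q _ (Function.update_of_ne h w a), eqToHom_pi_apply, pi_map_eqToHom_apply]
    have key : ∀ {C : Type u} [Category.{u} C] {X X' X'' Y Y' W W' : C} {q : X ⟶ W}
        (e₁ : X' = X) (e₂ : X = X'') (e₃ : X'' = Y) (e₄ : Y = Y') (e₅ : Y' = X) (e₆ : W = W'),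
        (eqToHom e₁ ≫ 𝟙 X ≫ eqToHom e₂) ≫ eqToHom e₃ ≫ eqToHom e₄ ≫
          eqToHom e₅ ≫ q ≫ eqToHom e₆ = eqToHom e₁ ≫ q ≫ eqToHom e₆ := by
      rintro C _ X X' X'' Y Y' W W' q rfl rfl rfl rfl e₅ rfl
      simp
    exact key _ _ _ _ _ _

theorem comp_updHom_eq_tupleHom (q : ∀ i (v : C i), (k i).obj ((J i).obj v) ⟶ v)
    (a : ∀ i, C i) (i : ι) (w : C i) :
    (Functor.pi k).map (eqToHom (pi_obj_update J a i w)) ≫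
        eqToHom (pi_obj_update k ((Functor.pi J).obj a) i ((J i).obj w)) ≫
          updHom i (fun j _ => 𝟙 ((Functor.pi k).obj ((Functor.pi J).obj a) j)) (q i w) ≫
            updHom i (fun j _ => tupleHom q a j) (𝟙 w) = tupleHom q _ := by
  rw [updHom_comp]
  funext j
  rw [Pi.comp_apply, Pi.comp_apply]
  by_cases h : j = i
  · subst h
    rw [updHom_self, tupleHom_apply q _ (Function.update_self j w a),
      eqToHom_pi_apply, pi_map_eqToHom_apply]
    have key : ∀ {C : Type u} [Category.{u} C] {X X' X'' Y W W' : C} {q : X ⟶ W}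
        (e₁ : Y = X'') (e₂ : X'' = X') (e₃ : X' = X) (e₄ : W = W') (e₅ : Y = X),
        eqToHom e₁ ≫ eqToHom e₂ ≫ eqToHom e₃ ≫ (q ≫ 𝟙 W) ≫ eqToHom e₄ =
          eqToHom e₅ ≫ q ≫ eqToHom e₄ := by
      rintro C _ X X' X'' Y W W' q rfl rfl rfl rfl e₅
      simp
    exact key _ _ _ _ _
  · rw [updHom_of_ne _ _ _ h, tupleHom_apply q _ (Function.update_of_ne h w a),
      eqToHom_pi_apply, pi_map_eqToHom_apply]
    have key : ∀ {C : Type u} [Category.{u} C] {X X' X'' Y W W' : C} {q : X ⟶ W}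
        (e₁ : Y = X'') (e₂ : X'' = X') (e₃ : X' = X) (e₄ : W = W') (e₅ : Y = X),
        eqToHom e₁ ≫ eqToHom e₂ ≫ eqToHom e₃ ≫ (𝟙 X ≫ q) ≫ eqToHom e₄ =
          eqToHom e₅ ≫ q ≫ eqToHom e₄ := by
      rintro C _ X X' X'' Y W W' q rfl rfl rfl rfl e₅
      simp
    exact key _ _ _ _ _

end Tuples

/-! ### The induced multiexact functor restricts to the given multi-determinant functor -/

section PullbackLift

variable {ι : Type} [DecidableEq ι] [Fintype ι]
  {T : ι → Type u} [∀ i, SmallCategory (T i)] [∀ i, Preadditive (T i)]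
  [∀ i, HasZeroObject (T i)] [∀ i, HasShift (T i) ℤ]
  [∀ i, ∀ n : ℤ, (shiftFunctor (T i) n).Additive] [∀ i, Pretriangulated (T i)]
  {P : PicardGroupoid.{u}}
  {V : ι → PicardGroupoid.{u}} {det : ∀ i, DetFunctor (T i) (V i)}

/-- The comparison of a tuple of values with the chosen one. -/
def valuesIso (U : ∀ i, (det i).IsUniversal) (a : ∀ i, DetValues det i) :
    (Functor.pi (toValues U)).obj (fun i => (valuesInclusion det i).obj (a i)) ≅ a where
  hom i := (valuesUnit U i).inv.app (a i)
  inv i := (valuesUnit U i).hom.app (a i)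
  hom_inv_id := funext fun i => (valuesUnit U i).inv_hom_id_app (a i)
  inv_hom_id := funext fun i => (valuesUnit U i).hom_inv_id_app (a i)

namespace MultiDet

variable (D : MultiDet T P) (U : ∀ i, (det i).IsUniversal)

/-- The functor induced by a multi-determinant functor extends it. -/
def liftFunctorPullbackIso : prodFunctor det ⋙ D.liftFunctor U ≅ D.functor :=
  NatIso.ofComponents (fun a => (D.ext U).mapIso (valuesIso U a)) fun {a b} φ => by
    have h : (Functor.pi (toValues U)).map ((prodFunctor det).map φ) ≫ (valuesIso U b).hom =
        (valuesIso U a).hom ≫ valuesMap det φ :=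
      funext fun i => (valuesUnit U i).inv.naturality
        (InducedCategory.homMk ((det i).functor.map (φ i)))
    exact ((D.ext U).map_comp _ _).symm.trans ((congrArg (D.ext U).map h).trans
      (((D.ext U).map_comp _ _).trans (congrArg (_ ≫ ·) (D.ext_map_valuesMap U φ))))

theorem pull_conj_compatible {P : Type u'} [Category.{v'} P] [MonoidalCategory P]
    {A B E A₁ B₁ E₁ A₂ B₂ E₂ A₃ B₃ E₃ A₄ B₄ E₄ : P} {p₁ : A ⟶ A₁} {q₁ : B ⟶ B₁} {r₁ : E₁ ⟶ E}
    {p₂ : A₁ ⟶ A₂} {q₂ : B₁ ⟶ B₂} {r₂ : E₂ ⟶ E₁} {p₃ : A₂ ⟶ A₃} {q₃ : B₂ ⟶ B₃} {r₃ : E₃ ⟶ E₂}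
    {m : A₃ ⊗ B₃ ⟶ E₃} {p₄ : A₃ ⟶ A₄} {q₄ : B₃ ⟶ B₄} {r₄ : E₃ ⟶ E₄} {m' : A₄ ⊗ B₄ ⟶ E₄}
    {p : A ⟶ A₄} {q : B ⟶ B₄} {r : E ⟶ E₄} (hm : m ≫ r₄ = (p₄ ⊗ₘ q₄) ≫ m')
    (hp : p₁ ≫ p₂ ≫ p₃ ≫ p₄ = p) (hq : q₁ ≫ q₂ ≫ q₃ ≫ q₄ = q) (hr : r₃ ≫ r₂ ≫ r₁ ≫ r = r₄) :
    ((p₁ ⊗ₘ q₁) ≫ ((p₂ ⊗ₘ q₂) ≫ ((p₃ ⊗ₘ q₃) ≫ m ≫ r₃) ≫ r₂) ≫ r₁) ≫ r = (p ⊗ₘ q) ≫ m' := by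
  simp only [assoc, hr, hm, ← hp, ← hq, ← tensorHom_comp_tensorHom]

theorem pullbackData_lift_add (i : ι) (a : ∀ i, Core (T i)) {x y z : T i} (f : x ⟶ y) (g : y ⟶ z)
    (h : z ⟶ x⟦(1 : ℤ)⟧) (hΔ : Triangle.mk f g h ∈ distTriang (T i)) :
    (pullbackData det (D.lift U) i a).add f g h hΔ =
      SlotOp.pull (fun i => (det i).functor) (z := ⟨z⟩) (x := ⟨x⟩) (y := ⟨y⟩) (F := D.liftFunctor U)
        (SlotOp.pull (toValues U) (F := D.ext U) ((D.extAdd U i f g h hΔ).conj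
        ((valuesUnit U i).inv.app _) ((valuesUnit U i).inv.app _)
        ((valuesUnit U i).hom.app _))) a := by
  rw [← addOp_liftData, ← slotμ_mapOut U (D.liftData U) (D.act_liftData U)]
  exact congrFun (pullbackData_add det (D.lift U) i f g h hΔ) a

/-- The multiexact functor induced by a multi-determinant functor extends it. -/
def pullbackLiftIso : pullbackObj det (D.lift U) ≅ D :=
  isoMk (D := pullbackObj det (D.lift U)) (D.liftFunctorPullbackIso U)
    fun i a x y z f g h hΔ => by
      refine (congrArg (· ≫ _) (D.pullbackData_lift_add U i a f g h hΔ)).trans ?_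
      let q (i : ι) (v : DetValues det i) :
        (toValues U i).obj ((valuesInclusion det i).obj v) ⟶ v := (valuesUnit U i).inv.app v
      -- The comparison in entries other than `i` is absorbed by naturality of the additivity data
      -- in those variables; in the `i`-th entry it is absorbed by the conjugation.
      have hm := D.extAdd_isNatural U i f g h hΔ _ _ fun j _ => tupleHom q a j
      have hp (w : DetValues det i) := congrArg (D.ext U).map
        (comp_updHom_eq_tupleHom (J := valuesInclusion det) (k := toValues U) q a i w)
      have hr := congrArg (D.ext U).map (updHom_comp_tupleHom (J := valuesInclusion det)
        (k := toValues U) (q := q) (p := fun i v => (valuesUnit U i).hom.app v)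
        (fun i v => (valuesUnit U i).hom_inv_id_app v) a i (show DetValues det i from ⟨y⟩))
      simp only [(D.ext U).map_comp] at hp hr
      exact pull_conj_compatible hm (hp _) (hp _) hr

end MultiDet

end PullbackLift

/-! ### Pullback is fully faithful and essentially surjective -/

section PullbackEquivalence

variable {ι : Type} [DecidableEq ι]
  {T : ι → Type u} [∀ i, SmallCategory (T i)] [∀ i, Preadditive (T i)]
  [∀ i, HasZeroObject (T i)] [∀ i, HasShift (T i) ℤ]
  [∀ i, ∀ n : ℤ, (shiftFunctor (T i) n).Additive] [∀ i, Pretriangulated (T i)]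
  {P : PicardGroupoid.{u}}
  {V : ι → PicardGroupoid.{u}} {det : ∀ i, DetFunctor (T i) (V i)}

theorem exists_prodFunctor_iso (U : ∀ i, (det i).IsUniversal) (v : ∀ i, V i) :
    ∃ a, Nonempty ((prodFunctor det).obj a ≅ v) := by
  choose a e using fun i => (U i).essSurj (v i)
  exact ⟨a, ⟨⟨fun i => (e i).some.hom, fun i => (e i).some.inv,
    funext fun i => (e i).some.hom_inv_id, funext fun i => (e i).some.inv_hom_id⟩⟩⟩

instance (P : PicardGroupoid.{u}) : IsGroupoid (MultiDet T P) where
  all_isIso {D E} α := by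
    let e : D.functor ≅ E.functor := NatIso.ofComponents
      (fun x => ⟨α.natTrans.app x, pinv _, comp_pinv _, pinv_comp _⟩) fun f =>
        α.natTrans.naturality f
    have : (MultiDet.isoMk e α.compatible).hom = α := MultiDet.hom_ext fun x => rfl
    rw [← this]
    infer_instance

instance (P : PicardGroupoid.{u}) : IsGroupoid (MultiExact (fun i => V i) P) where
  all_isIso {F G} α := by
    let e : F.functor ≅ G.functor := NatIso.ofComponents
      (fun x => ⟨α.natTrans.app x, pinv _, comp_pinv _, pinv_comp _⟩) fun f =>
        α.natTrans.naturality f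
    have : (MultiExact.isoMk e α.isMonoidal).hom = α := MultiExact.hom_ext fun x => rfl
    rw [← this]
    infer_instance

variable {F G : MultiExact (fun i => V i) P}

/-- Every tuple is isomorphic to a tuple of values, so naturality determines a transformation by its
components there. -/
theorem pullbackFunctor_faithful (U : ∀ i, (det i).IsUniversal) :
    (pullbackFunctor det P).Faithful where
  map_injective {F G α β} h := MultiExact.hom_ext fun v => by
    obtain ⟨a, ⟨e⟩⟩ := exists_prodFunctor_iso U v
    have := congrArg (fun t : pullbackObj det F ⟶ pullbackObj det G => t.natTrans.app a) h
    have h' : α.natTrans.app ((prodFunctor det).obj a) = β.natTrans.app ((prodFunctor det).obj a) :=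
      this
    rw [← cancel_epi (F.functor.map e.hom), α.natTrans.naturality, β.natTrans.naturality, h']

theorem compatible_of_ofIso {T : Type u} [Category.{v} T] [Preadditive T] [HasZeroObject T]
    [HasShift T ℤ] [∀ n : ℤ, (shiftFunctor T n).Additive] [Pretriangulated T]
    {P : Type u'} [Category.{v'} P] [MonoidalCategory P] [BraidedCategory P]
    {F G F' G' : Core T ⥤ P} {s : AdditivityData F} {t : AdditivityData G} {e : F ≅ F'}
    {e' : G ≅ G'} {θ : F' ⟶ G'} (h : (s.ofIso e).Compatible (t.ofIso e') θ) :
    s.Compatible t (e.hom ≫ θ ≫ e'.inv) := fun x y z f g k hΔ => by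
  have key : ∀ {A B E A₁ B₁ E₁ A' B' E' A₁' B₁' E₁' : P} {s : A ≅ A₁} {t : B ≅ B₁} {r : E ≅ E₁}
      {s' : A' ≅ A₁'} {t' : B' ≅ B₁'} {r' : E' ≅ E₁'} {m : A ⊗ B ⟶ E} {m' : A' ⊗ B' ⟶ E'}
      {α : A₁ ⟶ A₁'} {β : B₁ ⟶ B₁'} {γ : E₁ ⟶ E₁'}, ((s.inv ⊗ₘ t.inv) ≫ m ≫ r.hom) ≫ γ =
        (α ⊗ₘ β) ≫ (s'.inv ⊗ₘ t'.inv) ≫ m' ≫ r'.hom →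
      m ≫ r.hom ≫ γ ≫ r'.inv = ((s.hom ≫ α ≫ s'.inv) ⊗ₘ (t.hom ≫ β ≫ t'.inv)) ≫ m' := by
    intro A B E A₁ B₁ E₁ A' B' E' A₁' B₁' E₁' s t r s' t' r' m m' α β γ h
    have := congrArg (fun u => (s.hom ⊗ₘ t.hom) ≫ u ≫ r'.inv) h
    simp only [assoc, tensorHom_comp_tensorHom_assoc, Iso.hom_inv_id, id_tensorHom_id, id_comp,
      comp_id] at this
    exact this
  exact key (s := e.app _) (t := e.app _) (r := e.app _) (s' := e'.app _) (t' := e'.app _)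
    (r' := e'.app _) (h f g k hΔ)

/-- A morphism between pullbacks of multiexact functors, in one variable. -/
def slotPullbackHom (θ : pullbackObj det F ⟶ pullbackObj det G) (i : ι) (a : ∀ i, Core (T i)) :
    (det i).post (slot ((prodFunctor det).obj a) i ⋙ F.functor) ⟶
      (det i).post (slot ((prodFunctor det).obj a) i ⋙ G.functor) where
  natTrans := (Functor.isoWhiskerRight (slotPiIso (fun i => (det i).functor) a i) F.functor).hom ≫
    Functor.whiskerLeft (slot a i) θ.natTrans ≫
      (Functor.isoWhiskerRight (slotPiIso (fun i => (det i).functor) a i) G.functor).inv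
  compatible := compatible_of_ofIso (θ.compatible i a)

/-- The transformation `θ` is given as natural for isomorphisms of the `T i` only. In one variable
it is a morphism of determinant functors, hence by `existsUnique` the restriction of a
transformation `β` that is natural for all morphisms of `V i`. -/
theorem naturality_slot (U : ∀ i, (det i).IsUniversal)
    (θ : pullbackObj det F ⟶ pullbackObj det G) (a : ∀ i, DetValues det i) (i : ι)
    {p q : DetValues det i} (f : p ⟶ q) :
    F.functor.map ((Functor.pi (fun i => inducedFunctor (det i).functor.obj)).map
        (updHom i (fun k _ => 𝟙 (a k)) f)) ≫ θ.natTrans.app (Function.update a i q) =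
      θ.natTrans.app (Function.update a i p) ≫ G.functor.map
        ((Functor.pi (fun i => inducedFunctor (det i).functor.obj)).map
          (updHom i (fun k _ => 𝟙 (a k)) f)) := by
  obtain ⟨β, hβ, -⟩ := (U i).existsUnique
    (f := ⟨slot ((prodFunctor det).obj a) i ⋙ F.functor⟩)
    (g := ⟨slot ((prodFunctor det).obj a) i ⋙ G.functor⟩) (slotPullbackHom θ i a)
  have e (x : Core (T i)) : β.natTrans.app ((det i).functor.obj x) =
      (slotPullbackHom θ i a).natTrans.app x := congrArg (fun t => t.natTrans.app x) hβ
  have n := β.natTrans.naturality f.hom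
  have e₁ := e p
  have e₂ := e q
  have n' := (slotPiIso (fun i => inducedFunctor (det i).functor.obj) a i).hom.naturality f
  have nF := congrArg F.functor.map n'
  have nG := congrArg G.functor.map n'
  rw [Functor.map_comp, Functor.map_comp] at nF nG
  have key : ∀ {A B A' B' A₁ B₁ A₁' B₁' : P} {φ : A ⟶ B} {φ₁ : A₁ ⟶ B₁} {γ : A' ⟶ B'}
      {γ₁ : A₁' ⟶ B₁'} {β : A ⟶ A'} {β' : B ⟶ B'} {s : A ≅ A₁} {t : B ≅ B₁} {s' : A' ≅ A₁'}
      {t' : B' ≅ B₁'} {θ : A₁ ⟶ A₁'} {θ' : B₁ ⟶ B₁'}, φ ≫ β' = β ≫ γ →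
      β = s.hom ≫ θ ≫ s'.inv → β' = t.hom ≫ θ' ≫ t'.inv → φ ≫ t.hom = s.hom ≫ φ₁ →
      γ ≫ t'.hom = s'.hom ≫ γ₁ → φ₁ ≫ θ' = θ ≫ γ₁ := by
    intro A B A' B' A₁ B₁ A₁' B₁' φ φ₁ γ γ₁ β β' s t s' t' θ θ' h h₁ h₂ h₃ h₄
    subst h₁ h₂
    have := congrArg (fun u => s.inv ≫ u ≫ t'.hom) h
    simpa [reassoc_of% h₃, h₄] using this
  let I := slotPiIso (fun i => (det i).functor) a i
  exact key (s := F.functor.mapIso (I.app p)) (t := F.functor.mapIso (I.app q))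
    (s' := G.functor.mapIso (I.app p)) (t' := G.functor.mapIso (I.app q)) n e₁ e₂ nF nG

theorem naturality_values [Finite ι] (U : ∀ i, (det i).IsUniversal)
    (θ : pullbackObj det F ⟶ pullbackObj det G) {a b : ∀ i, DetValues det i} (φ : a ⟶ b) :
    F.functor.map ((Functor.pi (fun i => inducedFunctor (det i).functor.obj)).map φ) ≫
        θ.natTrans.app b =
      θ.natTrans.app a ≫
        G.functor.map ((Functor.pi (fun i => inducedFunctor (det i).functor.obj)).map φ) := by
  induction φ using pi_hom_induction with
  | id a =>
    have key : ∀ {A A' : P} {f : A ⟶ A} {g : A' ⟶ A'} {t : A ⟶ A'}, f = 𝟙 _ → g = 𝟙 _ →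
        f ≫ t = t ≫ g := by
      rintro A A' f g t rfl rfl; simp
    exact key (F.functor.map_id _) (G.functor.map_id _)
  | comp φ ψ hφ hψ =>
    have key : ∀ {A B C A' B' C' : P} {f : A ⟶ B} {g : B ⟶ C} {h : A ⟶ C} {f' : A' ⟶ B'}
        {g' : B' ⟶ C'} {h' : A' ⟶ C'} {s : A ⟶ A'} {t : B ⟶ B'} {r : C ⟶ C'},
        h = f ≫ g → h' = f' ≫ g' → f ≫ t = s ≫ f' → g ≫ r = t ≫ g' → h ≫ r = s ≫ h' := by
      rintro A B C A' B' C' f g h f' g' h' s t r rfl rfl e e'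
      rw [assoc, e', reassoc_of% e]
    exact key (F.functor.map_comp _ _) (G.functor.map_comp _ _) hφ hψ
  | single i a f => exact naturality_slot U θ a i f

theorem naturality_prodFunctor [Finite ι] (U : ∀ i, (det i).IsUniversal)
    (θ : pullbackObj det F ⟶ pullbackObj det G) {a b : ∀ i, Core (T i)}
    (φ : (prodFunctor det).obj a ⟶ (prodFunctor det).obj b) :
    F.functor.map φ ≫ θ.natTrans.app b = θ.natTrans.app a ≫ G.functor.map φ :=
  naturality_values (a := a) (b := b) U θ fun i => InducedCategory.homMk (φ i)

/-- The natural transformation given by its values on tuples of values of universal determinants. -/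
def extendNatTrans [Finite ι] (U : ∀ i, (det i).IsUniversal)
    (θ : pullbackObj det F ⟶ pullbackObj det G) : F.functor ⟶ G.functor where
  app v := F.functor.map (exists_prodFunctor_iso U v).choose_spec.some.inv ≫
    θ.natTrans.app (exists_prodFunctor_iso U v).choose ≫
      G.functor.map (exists_prodFunctor_iso U v).choose_spec.some.hom
  naturality v w f := by
    have h := naturality_prodFunctor U θ ((exists_prodFunctor_iso U v).choose_spec.some.hom ≫
      f ≫ (exists_prodFunctor_iso U w).choose_spec.some.inv)
    rw [F.functor.map_comp, F.functor.map_comp, G.functor.map_comp, G.functor.map_comp] at h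
    have key : ∀ {A B A₁ B₁ A' B' A₁' B₁' : P} {s : A ≅ A₁} {t : B ≅ B₁} {s' : A' ≅ A₁'}
        {t' : B' ≅ B₁'} {f : A₁ ⟶ B₁} {g : A₁' ⟶ B₁'} {θ : A ⟶ A'} {θ' : B ⟶ B'},
        (s.hom ≫ f ≫ t.inv) ≫ θ' = θ ≫ s'.hom ≫ g ≫ t'.inv →
        f ≫ t.inv ≫ θ' ≫ t'.hom = (s.inv ≫ θ ≫ s'.hom) ≫ g := by
      intro A B A₁ B₁ A' B' A₁' B₁' s t s' t' f g θ θ' h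
      have := congrArg (fun u => s.inv ≫ u ≫ t'.hom) h
      simpa using this
    exact key (s := F.functor.mapIso (exists_prodFunctor_iso U v).choose_spec.some)
      (t := F.functor.mapIso (exists_prodFunctor_iso U w).choose_spec.some)
      (s' := G.functor.mapIso (exists_prodFunctor_iso U v).choose_spec.some)
      (t' := G.functor.mapIso (exists_prodFunctor_iso U w).choose_spec.some) h

/-- The tuple chosen to represent the values at `a` may differ from `a`; naturality for morphisms of
values makes the choice irrelevant. -/
theorem extendNatTrans_app [Finite ι] (U : ∀ i, (det i).IsUniversal)
    (θ : pullbackObj det F ⟶ pullbackObj det G) (a : ∀ i, Core (T i)) :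
    (extendNatTrans U θ).app ((prodFunctor det).obj a) = θ.natTrans.app a := by
  have h := naturality_prodFunctor U θ
    (exists_prodFunctor_iso U ((prodFunctor det).obj a)).choose_spec.some.hom
  have key : ∀ {A A₁ A' A₁' : P} {s : A ≅ A₁} {s' : A' ⟶ A₁'} {θ : A ⟶ A'} {θ' : A₁ ⟶ A₁'},
      s.hom ≫ θ' = θ ≫ s' → s.inv ≫ θ ≫ s' = θ' := by
    intro A A₁ A' A₁' s s' θ θ' h
    rw [← h, Iso.inv_hom_id_assoc]
  exact key (s := F.functor.mapIso
    (exists_prodFunctor_iso U ((prodFunctor det).obj a)).choose_spec.some) h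

theorem extendNatTrans_compatible [Finite ι] (U : ∀ i, (det i).IsUniversal)
    (θ : pullbackObj det F ⟶ pullbackObj det G) (i : ι) (v : ∀ i, V i) :
    ((det i).data.post (slot (C := fun i => V i) v i ⋙ F.functor)).Compatible
      ((det i).data.post (slot (C := fun i => V i) v i ⋙ G.functor))
      (Functor.whiskerLeft (det i).functor
        (Functor.whiskerLeft (slot v i) (extendNatTrans U θ))) := by
  intro x y z f g h hΔ
  obtain ⟨a, ⟨e⟩⟩ := exists_prodFunctor_iso U v
  -- The claim is known when the other entries are values. Naturality of the additivity operations
  -- of `F` and `G` in those entries carries it along `e` to an arbitrary `v`.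
  have hF := ((F.natural i _ _).mapOut ((det i).data.add f g h hΔ)) _ v fun k _ => e.hom k
  have hG := ((G.natural i _ _).mapOut ((det i).data.add f g h hΔ)) _ v fun k _ => e.hom k
  have n (w : V i) := (extendNatTrans U θ).naturality (updHom i (fun k _ => e.hom k) (𝟙 w))
  have hθ := (slotPullbackHom θ i a).compatible f g h hΔ
  have hx (x : Core (T i)) : (slotPullbackHom θ i a).natTrans.app x =
      (extendNatTrans U θ).app (Function.update ((prodFunctor det).obj a) i
        ((det i).functor.obj x)) := by
    have := (extendNatTrans U θ).naturality
      ((slotPiIso (fun i => (det i).functor) a i).hom.app x)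
    have key : ∀ {A A' B B' : P} {s : A ⟶ A'} {s' : B ≅ B'} {θ θ₁ : A' ⟶ B'} {θ' : A ⟶ B},
        s ≫ θ = θ' ≫ s'.hom → θ = θ₁ → s ≫ θ₁ ≫ s'.inv = θ' := by
      rintro A A' B B' s s' θ θ₁ θ' h rfl
      rw [reassoc_of% h, Iso.hom_inv_id, comp_id]
    exact key (s' := G.functor.mapIso ((slotPiIso (fun i => (det i).functor) a i).app x)) this
      (extendNatTrans_app U θ _)
  rw [hx, hx, hx] at hθ
  have key : ∀ {A B E A₁ B₁ E₁ A' B' E' A₁' B₁' E₁' : P} {m : A ⊗ B ⟶ E} {m' : A' ⊗ B' ⟶ E'}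
      {n : A₁ ⊗ B₁ ⟶ E₁} {n' : A₁' ⊗ B₁' ⟶ E₁'} {p : A ⟶ A₁} {q : B ⟶ B₁} {r : E ⟶ E₁}
      {p' : A' ⟶ A₁'} {q' : B' ⟶ B₁'} {r' : E' ⟶ E₁'} {α : A ⟶ A'} {β : B ⟶ B'} {γ : E ⟶ E'}
      {α₁ : A₁ ⟶ A₁'} {β₁ : B₁ ⟶ B₁'} {γ₁ : E₁ ⟶ E₁'}, m ≫ r = (p ⊗ₘ q) ≫ n →
      m' ≫ r' = (p' ⊗ₘ q') ≫ n' → p ≫ α₁ = α ≫ p' → q ≫ β₁ = β ≫ q' → r ≫ γ₁ = γ ≫ r' →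
      m ≫ γ = (α ⊗ₘ β) ≫ m' → n ≫ γ₁ = (α₁ ⊗ₘ β₁) ≫ n' := by
    intro A B E A₁ B₁ E₁ A' B' E' A₁' B₁' E₁' m m' n n' p q r p' q' r' α β γ α₁ β₁ γ₁ h₁ h₂ h₃ h₄
      h₅ h₆
    rw [← cancel_epi (p ⊗ₘ q), ← reassoc_of% h₁, h₅, reassoc_of% h₆, h₂,
      tensorHom_comp_tensorHom_assoc, tensorHom_comp_tensorHom_assoc, h₃, h₄]
  exact key hF hG (n _) (n _) (n _) hθ

theorem pullbackFunctor_full [Finite ι] (U : ∀ i, (det i).IsUniversal) :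
    (pullbackFunctor det P).Full where
  map_surjective θ := ⟨⟨extendNatTrans U θ, fun i v =>
    (U i).isMonoidal _ (extendNatTrans_compatible U θ i v)⟩,
    MultiDet.hom_ext fun a => extendNatTrans_app U θ a⟩

theorem pullbackFunctor_isEquivalence [Fintype ι] (U : ∀ i, (det i).IsUniversal) :
    (pullbackFunctor det P).IsEquivalence where
  faithful := pullbackFunctor_faithful U
  full := pullbackFunctor_full U
  essSurj := ⟨fun D => ⟨D.lift U, ⟨D.pullbackLiftIso U⟩⟩⟩

end PullbackEquivalence

end MultiDeterminant

end

theorem corollary4p2 :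
    -- universal determinant functors exist for small triangulated categories
    (∀ (T : Type u) [SmallCategory T] [Preadditive T] [HasZeroObject T] [HasShift T ℤ]
      [∀ k : ℤ, (shiftFunctor T k).Additive] [Pretriangulated T] [IsTriangulated T],
      ∃ (V : PicardGroupoid.{u}) (d : DetFunctor T V), d.IsUniversal) ∧
    ∀ (n : ℕ) (T : Fin (n + 1) → Type u) [∀ i, SmallCategory (T i)] [∀ i, Preadditive (T i)]
      [∀ i, HasZeroObject (T i)] [∀ i, HasShift (T i) ℤ]
      [∀ i, ∀ k : ℤ, (shiftFunctor (T i) k).Additive] [∀ i, Pretriangulated (T i)]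
      [∀ i, IsTriangulated (T i)]
      (V : Fin (n + 1) → PicardGroupoid.{u}) (det : ∀ i, DetFunctor (T i) (V i)),
      (∀ i, (det i).IsUniversal) →
      -- pullback along the universal determinants is an equivalence of groupoids
      (∀ P : PicardGroupoid.{u},
        IsGroupoid (MultiDet T P) ∧ IsGroupoid (MultiExact (fun i => V i) P) ∧
          (pullbackFunctor det P).IsEquivalence) ∧
      -- co-representability: the transformation of 2-functors given by pullback is an equivalence
      ∀ P : PicardGroupoid.{u},
        ((detPullback det).app P : (picFunctor V).obj P ⟶
          (detFunctor T).obj P).toFunctor.IsEquivalence := by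
  refine ⟨fun T => ?_, fun n T => ?_⟩
  · intros
    exact ⟨freePicard T, freeDet T, freeDet_isUniversal⟩
  · intro _ _ _ _ _ _ _ V det U
    exact ⟨fun P => ⟨inferInstance, inferInstance, pullbackFunctor_isEquivalence U⟩,
      -- The component of `detPullback` at `P` is by definition the pullback functor.
      fun P => pullbackFunctor_isEquivalence U⟩
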